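/- Let $n\ge 1$. Let $\mathcal K$ be the set of convex bodies (nonempty compact convex subsets of $\mathbb R^n$) with the Hausdorff metric, let $B^n$ be the closed unit ball, $\Sigma=\mathbb R^n\times S^{n-1}$, $\kappa_m=\pi^{m/2}/\Gamma(1+m/2)$ and $\omega_m=m\kappa_m$. Symmetric tensors of rank $p$ are symmetric $p$-linear functionals on $\mathbb R^n$; the product of such tensors is the symmetric tensor product, $x^r$ is the $r$-fold symmetric tensor power of $x\in\mathbb R^n$, and integrals of tensors are taken coordinatewise. For $K\in\mathcal K$ let $\Lambda_0(K;\cdot),\dots,\Lambda_{n-1}(K;\cdot)$ be the support measures of $K$, that is, the Borel measures on $\Sigma$ determined by the local Steiner formula $$\lambda\bigl(\{x\in (K+\varepsilon B^n)\setminus K:(p(K,x),u(K,x))\in\eta\}\bigr)=\sum_{k=0}^{n-1}\varepsilon^{n-k}\kappa_{n-k}\Lambda_k(K;\eta)$$ for all $\varepsilon>0$ and Borel sets $\eta\subset\Sigma$, where $\lambda$ is Lebesgue measure, $p(K,x)$ is the metric projection of $x$ to $K$ and $u(K,x)=(x-p(K,x))/\|x-p(K,x)\|$. For $r,s\in\mathbb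 N_0$ define the Minkowski tensors $$\Phi_{n-1}^{r,s}(K)=\frac1{r!\,s!}\frac{\omega_1}{\omega_{1+s}}\int_\Sigma x^ru^s\,\Lambda_{n-1}(K;d(x,u)),\qquad \Phi_n^{r,0}(K)=\frac1{r!}\int_K x^r\,dx,$$ and denote by the same symbols their additive extensions to finite unions of convex bodies (with value $0$ at $\emptyset$). Let $\gamma>0$ and let $\mathbb Q$ be a probability measure on $\mathcal K$ that is concentrated on the convex bodies whose smallest enclosing ball is centered at $0$ and that satisfies $\int\lambda(K+B^n)\,\mathbb Q(dK)<\infty$. Let $X$ be a Poisson point process in $\mathcal K$ with intensity measure $\Theta(\mathcal A)=\gamma\int_{\mathbb R^n}\int_{\mathcal K}\mathbf 1_{\mathcal A}(K+x)\,\mathbb Q(dK)\,dx$, and let $Z=\bigcup_{K\in X}K$ be the corresponding stationary Boolean model with convex grains. Put $$\overline V_n(X)=\gamma\int \lambda(K)\,\mathbb Q(dK),\qquad \overline\Phi_{n-1}^{\,0,s}(X)=\gamma\int\Phi_{n-1}^{0,s}(K)\,\mathbb Q(dK).$$ Then, for every $W\in\mathcal K$ and all $r,s\in\mathbb N_0$,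 the two integrals defining these densities exist (the integrands are $\mathbb Q$-integrable), the random tensors $\Phi_{n-1}^{r,s}(Z\cap W)$ and $\Phi_n^{r,0}(Z\cap W)$ are integrable, and $$\mathbb E\bigl[\Phi_{n-1}^{r,s}(Z\cap W)\bigr]=\Phi_{n-1}^{r,s}(W)\bigl(1-e^{-\overline V_n(X)}\bigr)+\Phi_n^{r,0}(W)\,\overline\Phi_{n-1}^{\,0,s}(X)\,e^{-\overline V_n(X)},$$ $$\mathbb E\bigl[\Phi_n^{r,0}(Z\cap W)\bigr]=\Phi_n^{r,0}(W)\bigl(1-e^{-\overline V_n(X)}\bigr).$$ -/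

import Mathlib

open MeasureTheory ProbabilityTheory Set
open scoped Pointwise ENNReal

namespace MinkowskiBoolean

noncomputable section

/-- Euclidean space `ℝⁿ`. -/
abbrev E (n : ℕ) : Type := EuclideanSpace ℝ (Fin n)

/-- The unit sphere `S^{n-1}` of `ℝⁿ`. -/
abbrev Sph (n : ℕ) : Type := Metric.sphere (0 : E n) 1

/-- Convex bodies: nonempty compact convex subsets of `ℝⁿ`, with the Hausdorff metric. -/
abbrev Body (n : ℕ) : Type := ConvexBody (E n)

/-- The space of convex bodies carries the Borel `σ`-algebra of the Hausdorff metric. -/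
instance instMeasurableSpaceBody (n : ℕ) : MeasurableSpace (ConvexBody (EuclideanSpace ℝ (Fin n))) :=
  borel _

instance instBorelSpaceBody (n : ℕ) : BorelSpace (ConvexBody (EuclideanSpace ℝ (Fin n))) :=
  ⟨rfl⟩

/-! ### Symmetric tensors -/

/-- The subspace of symmetric `p`-linear functionals on `ℝⁿ`. All `p`-linear functionals on `ℝⁿ`
are continuous; the continuous ones carry a norm. -/
def symSubmodule (n p : ℕ) :
    Submodule ℝ (ContinuousMultilinearMap ℝ (fun _ : Fin p => E n) ℝ) where
  carrier := {T | ∀ (σ : Equiv.Perm (Fin p)) (v : Fin p → E n), T (fun i => v (σ i)) = T v}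
  add_mem' := by
    intro a b ha hb σ v
    simp only [add_apply, ha σ v, hb σ v]
  zero_mem' := by
    intro σ v
    simp
  smul_mem' := by
    intro c a ha σ v
    simp only [smul_apply, ha σ v]

/-- Symmetric tensors of rank `p` over `ℝⁿ`: symmetric `p`-linear functionals on `ℝⁿ`. -/
def SymTensor (n p : ℕ) : Type := symSubmodule n p

instance (n p : ℕ) : NormedAddCommGroup (SymTensor n p) :=
  inferInstanceAs (NormedAddCommGroup (symSubmodule n p))

instance (n p : ℕ) : NormedSpace ℝ (SymTensor n p) :=
  inferInstanceAs (NormedSpace ℝ (symSubmodule n p))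

/-- Bochner integrals of tensors are thus the coordinatewise integrals. -/
instance (n p : ℕ) : CompleteSpace (SymTensor n p) := by
  have hc : IsClosed
      (symSubmodule n p : Set (ContinuousMultilinearMap ℝ (fun _ : Fin p => E n) ℝ)) := by
    have h : (symSubmodule n p : Set (ContinuousMultilinearMap ℝ (fun _ : Fin p => E n) ℝ)) =
        ⋂ (σ : Equiv.Perm (Fin p)) (v : Fin p → E n), {T | T (fun i => v (σ i)) = T v} := by
      ext T
      simp [symSubmodule]
    rw [h]
    refine isClosed_iInter fun σ => isClosed_iInter fun v => isClosed_eq ?_ ?_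
    · exact (ContinuousMultilinearMap.apply ℝ (fun _ : Fin p => E n) ℝ
        (fun i => v (σ i))).continuous
    · exact (ContinuousMultilinearMap.apply ℝ (fun _ : Fin p => E n) ℝ v).continuous
  exact hc.completeSpace_coe

/-- The tensor power `x ^ r`, that is, `(y₁, …, y_r) ↦ ⟨x, y₁⟩ ⋯ ⟨x, y_r⟩`. -/
def tensorPow {n : ℕ} (r : ℕ) (x : E n) : SymTensor n r :=
  ⟨(ContinuousMultilinearMap.mkPiAlgebra ℝ (Fin r) ℝ).compContinuousLinearMap
      (fun _ => innerSL ℝ x), by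
    intro σ v
    simp only [ContinuousMultilinearMap.compContinuousLinearMap_apply,
      ContinuousMultilinearMap.mkPiAlgebra_apply]
    exact Equiv.prod_comp σ (fun i => innerSL ℝ x (v i))⟩

/-- The (not yet symmetrized) product `(y₁, …, y_m) ↦ a (y₁, …, y_p) * b (y_{p+1}, …, y_m)`,
where `m = p + q`. -/
def outerMul {n p q m : ℕ} (h : p + q = m)
    (a : ContinuousMultilinearMap ℝ (fun _ : Fin p => E n) ℝ)
    (b : ContinuousMultilinearMap ℝ (fun _ : Fin q => E n) ℝ) :
    ContinuousMultilinearMap ℝ (fun _ : Fin m => E n) ℝ where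
  toMultilinearMap :=
    ((LinearMap.mul' ℝ ℝ).compMultilinearMap
      (a.toMultilinearMap.domCoprod b.toMultilinearMap)).domDomCongr
        (finSumFinEquiv.trans (finCongr h))
  cont := by
    change Continuous fun v : Fin m → E n =>
      a (fun i => v (finCongr h (finSumFinEquiv (Sum.inl i)))) *
        b (fun i => v (finCongr h (finSumFinEquiv (Sum.inr i))))
    fun_prop

theorem outerMul_apply {n p q m : ℕ} (h : p + q = m)
    (a : ContinuousMultilinearMap ℝ (fun _ : Fin p => E n) ℝ)
    (b : ContinuousMultilinearMap ℝ (fun _ : Fin q => E n) ℝ) (v : Fin m → E n) :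
    outerMul h a b v =
      a (fun i => v (Fin.cast h (Fin.castAdd q i))) *
        b (fun i => v (Fin.cast h (Fin.natAdd p i))) := rfl

/-- The symmetric tensor product of `a` and `b`: the average of the product
`a (y₁, …, y_p) * b (y_{p+1}, …, y_m)` over all permutations of the `m = p + q` arguments. -/
def symMul {n p q m : ℕ} (h : p + q = m) (a : SymTensor n p) (b : SymTensor n q) :
    SymTensor n m :=
  ⟨((m.factorial : ℝ)⁻¹) • ∑ σ : Equiv.Perm (Fin m), (outerMul h a.1 b.1).domDomCongr σ, by
    intro τ v
    simp only [smul_apply, sum_apply,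
      ContinuousMultilinearMap.domDomCongr_apply]
    congr 1
    exact Equiv.sum_comp (Equiv.mulLeft τ)
      (fun σ : Equiv.Perm (Fin m) => outerMul h a.1 b.1 (fun i => v (σ i)))⟩

/-! ### Support measures and Minkowski tensors -/

/-- Volume of the unit ball of `ℝᵐ`. -/
def kappa (m : ℕ) : ℝ := Real.pi ^ ((m : ℝ) / 2) / Real.Gamma (1 + (m : ℝ) / 2)

/-- Surface area of the unit sphere of `ℝᵐ`. -/
def omega (m : ℕ) : ℝ := m * kappa m

/-- `y` is the metric projection `p(K, x)` of `x` to `K`. -/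
def IsMetricProj {n : ℕ} (K : Body n) (x y : E n) : Prop :=
  y ∈ K ∧ ∀ z ∈ K, dist x y ≤ dist x z

/-- The local parallel set `M_ε(K, η)`: the points `x ∈ (K + ε Bⁿ) \ K` for which
`(p(K, x), u(K, x)) ∈ η`, where `u(K, x)` is the unit vector with
`x - p(K, x) = ‖x - p(K, x)‖ u(K, x)`. -/
def localParallelSet {n : ℕ} (K : Body n) (ε : ℝ) (η : Set (E n × Sph n)) : Set (E n) :=
  {x | x ∈ ((K : Set (E n)) + Metric.closedBall (0 : E n) ε) \ (K : Set (E n)) ∧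
    ∃ z ∈ η, IsMetricProj K x z.1 ∧ x - z.1 = ‖x - z.1‖ • (z.2 : E n)}

/-- `Λ 0, …, Λ (n-1)` satisfy the local Steiner formula of the convex body `K`. -/
def IsSupportMeasures {n : ℕ} (K : Body n) (Λ : Fin n → Measure (E n × Sph n)) : Prop :=
  ∀ ε : ℝ, 0 < ε → ∀ η : Set (E n × Sph n), MeasurableSet η →
    volume (localParallelSet K ε η) =
      ∑ k : Fin n, ENNReal.ofReal (ε ^ (n - (k : ℕ)) * kappa (n - (k : ℕ))) * Λ k η

open Classical in
/-- The support measures `Λ_0(K; ·), …, Λ_{n-1}(K; ·)`: the measures given by the local Steiner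
formula. (The formula determines them; the value `0` for missing ones is never used.) -/
def supportMeasure {n : ℕ} (K : Body n) : Fin n → Measure (E n × Sph n) :=
  if h : ∃ Λ, IsSupportMeasures K Λ then h.choose else 0

/-- The Minkowski tensor `Φ_j^{r,s}(K)`, for `0 ≤ j ≤ n - 1`. -/
def minkowskiTensor {n : ℕ} (j : Fin n) (r s : ℕ) (K : Body n) : SymTensor n (r + s) :=
  ((1 / ((r.factorial : ℝ) * s.factorial)) *
      (omega (n - (j : ℕ)) / omega (n - (j : ℕ) + s))) •
    ∫ z, symMul rfl (tensorPow r z.1) (tensorPow s (z.2 : E n)) ∂(supportMeasure K j)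

/-- The volume tensor `Φ_n^{r,0}(K)`. -/
def volumeTensor {n : ℕ} (r : ℕ) (K : Body n) : SymTensor n r :=
  (1 / (r.factorial : ℝ)) • ∫ x in (K : Set (E n)), tensorPow r x

/-! ### Additive extension to the convex ring -/

/-- Polyconvex sets: finite unions of convex bodies (the empty union is allowed). -/
def Polyconvex {n : ℕ} (A : Set (E n)) : Prop :=
  ∃ s : Set (Body n), s.Finite ∧ A = ⋃ K ∈ s, (K : Set (E n))

/-- `ψ` is the additive extension of `φ` from convex bodies to polyconvex sets (by convention `ψ`
vanishes on the remaining sets). -/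
structure IsAdditiveExtension {n p : ℕ} (φ : Body n → SymTensor n p)
    (ψ : Set (E n) → SymTensor n p) : Prop where
  extends_body : ∀ K : Body n, ψ (K : Set (E n)) = φ K
  map_empty : ψ ∅ = 0
  map_union : ∀ A B : Set (E n), Polyconvex A → Polyconvex B →
    ψ (A ∪ B) + ψ (A ∩ B) = ψ A + ψ B
  map_other : ∀ A : Set (E n), ¬ Polyconvex A → ψ A = 0

open Classical in
/-- The additive extension of `φ` (which is unique if it exists). -/
def additiveExtension {n p : ℕ} (φ : Body n → SymTensor n p) : Set (E n) → SymTensor n p :=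
  if h : ∃ ψ, IsAdditiveExtension φ ψ then h.choose else 0

/-! ### The stationary Boolean model -/

/-- `K + x`. -/
def translate {n : ℕ} (K : Body n) (x : E n) : Body n :=
  K + ⟨{x}, convex_singleton x, isCompact_singleton, singleton_nonempty x⟩

/-- `c` is the center of the smallest ball that contains `K`. -/
def IsSmallestBallCenter {n : ℕ} (K : Body n) (c : E n) : Prop :=
  ∃ ρ : ℝ, (K : Set (E n)) ⊆ Metric.closedBall c ρ ∧
    ∀ (c' : E n) (ρ' : ℝ), (K : Set (E n)) ⊆ Metric.closedBall c' ρ' → ρ ≤ ρ'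

/-- The intensity measure `Θ(𝒜) = γ ∫ ∫ 1{K + x ∈ 𝒜} Q(dK) dx` of the particle process. -/
def particleIntensity {n : ℕ} (γ : ℝ) (Q : Measure (Body n)) : Measure (Body n) :=
  ENNReal.ofReal γ •
    Measure.map (fun z : Body n × E n => translate z.1 z.2) (Q.prod volume)

/-- The random set of points `X` is a (simple) Poisson point process in `α` with intensity
measure `Θ`: the numbers of points in Borel sets of finite intensity are Poisson distributed, and
the numbers of points in disjoint Borel sets are independent. -/
structure IsPoissonProcess {Ω α : Type*} [MeasurableSpace Ω] [MeasurableSpace α]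
    (P : Measure Ω) (X : Ω → Set α) (Θ : Measure α) : Prop where
  measurable_count : ∀ A : Set α, MeasurableSet A → Measurable fun ω => (X ω ∩ A).encard
  poisson_count : ∀ A : Set α, MeasurableSet A → Θ A ≠ ∞ →
    P.map (fun ω => (X ω ∩ A).encard) =
      (poissonMeasure (Θ A).toNNReal).map (Nat.cast : ℕ → ℕ∞)
  indep_count : ∀ (m : ℕ) (A : Fin m → Set α), (∀ i, MeasurableSet (A i)) →
    (Pairwise fun i j => Disjoint (A i) (A j)) →
      iIndepFun (fun i ω => (X ω ∩ A i).encard) P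

/-- The stationary Boolean model in `ℝⁿ` with convex grains, intensity `γ` and grain
distribution `Q`, on the probability space `(Ω, P)`, given through its particle process `X`. -/
structure IsBooleanModel {n : ℕ} {Ω : Type*} [MeasurableSpace Ω] (P : Measure Ω)
    (γ : ℝ) (Q : Measure (Body n)) (X : Ω → Set (Body n)) : Prop where
  intensity_pos : 0 < γ
  grain_prob : IsProbabilityMeasure Q
  grain_centered : ∀ᵐ K ∂Q, IsSmallestBallCenter K 0
  grain_integrable : ∫⁻ K, volume ((K : Set (E n)) + Metric.closedBall (0 : E n) 1) ∂Q < ∞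
  poisson : IsPoissonProcess P X (particleIntensity γ Q)

/-- The union set `Z` of the particles. -/
def unionSet {n : ℕ} {Ω : Type*} (X : Ω → Set (Body n)) (ω : Ω) : Set (E n) :=
  ⋃ K ∈ X ω, (K : Set (E n))

/-- The volume density `γ ∫ V_n dQ` of the particle process. -/
def volumeDensity {n : ℕ} (γ : ℝ) (Q : Measure (Body n)) : ℝ :=
  γ * ∫ K, volume.real (K : Set (E n)) ∂Q

/-- The density `γ ∫ Φ_j^{0,s} dQ` of the particle process. -/
def tensorDensity {n : ℕ} (γ : ℝ) (Q : Measure (Body n)) (j : Fin n) (s : ℕ) :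
    SymTensor n (0 + s) :=
  γ • ∫ K, minkowskiTensor j 0 s K ∂Q

end

end MinkowskiBoolean

namespace MinkowskiBoolean

open Filter Topology

noncomputable section

section

variable {n : ℕ}

/-! ### The metric projection -/

/-! The surface tensors are recovered from a first variation. For a convex body `K`, a body `C` with
`0` in its interior and a continuous `h`, the right derivative at `t = 0` of the integral of `h`
over `K + tC` is the integral of `h(x) h_C(u)` against `S(K; d(x,u))`. Here `h_C` is the support
function and `S = κ₁ Λ_{n-1}` (`tendsto_dilationQuot_body`). Volume integrals over a Boolean model
have explicit expectations, so it suffices to differentiate those.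

The support measures come from the map that scales the segment from `p(K,x)` to `x` by `s`. Its
Jacobian is `det(P + s(I - P))`, where `P` is the derivative of the metric projection. `P` is
symmetric with spectrum in `[0,1]` and kills the normal direction, so the determinant is a
polynomial in `s` with nonnegative coefficients and no constant term (`exists_scaleDet_polynomial`).
A change of variables gives the local Steiner formula; the linear coefficient gives `S(K; ·)`.

The additive extension exists because the first variation is additive: the part of `(A + tC) ∩ (B +
tC)` outside `(A ∩ B) + tC` has volume `o(t)` (`tendsto_volume_gapSet`). Hence every polyconvex set
has a surface measure, written as a difference of two finite measures (`SurfRep`). It is unique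
(`SurfRep.add_eq_add`), since differences of support functions are dense in the continuous functions
on the sphere (`exists_suppFun_sub_suppFun_near`).

For the expectation, `x` lies in `(Z ∩ W) + tC` exactly when `Z` hits `W ∩ (x - tC)`, which has
probability `1 - exp(-Θ)` with `Θ` the mass of the particles hitting that set. For `x` in the
interior of `W` and `t` small this mass is `γ ∫ λ(K + tC) Q(dK)`, and its derivative produces
`exp(-V) γ ∫∫ h_C dS(K) Q(dK)`. On the layer `(W + tC) \ W` the probability is `1 - exp(-V) + O(t)`
and the layer has volume `O(t)`, which produces `(1 - exp(-V)) ∫ h h_C dS(W)`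
(`IsBooleanModel.tendsto_integral_dilationQuot`). Limit and expectation are exchanged by domination
with a multiple of `3^N`, where `N` is the Poisson number of grains hitting `W`. Density replaces
`h_C` by any continuous `g`, and taking `h`, `g` to be monomials gives the tensor formula coordinate
by coordinate. -/

theorem exists_isMetricProj (K : Body n) (x : E n) : ∃ y, IsMetricProj K x y := by
  obtain ⟨y, hy, h⟩ := K.isCompact.exists_isMinOn K.nonempty
    (continuous_const.dist continuous_id : Continuous fun z : E n => dist x z).continuousOn
  exact ⟨y, hy, fun z hz => h hz⟩

/-- The metric projection to a convex body. -/
def proj (K : Body n) (x : E n) : E n := (exists_isMetricProj K x).choose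

theorem isMetricProj_proj (K : Body n) (x : E n) : IsMetricProj K x (proj K x) :=
  (exists_isMetricProj K x).choose_spec

theorem proj_mem (K : Body n) (x : E n) : proj K x ∈ K := (isMetricProj_proj K x).1

theorem IsMetricProj.inner_nonpos {K : Body n} {x y : E n} (h : IsMetricProj K x y) {z : E n}
    (hz : z ∈ K) : inner ℝ (x - y) (z - y) ≤ 0 := by
  refine (norm_eq_iInf_iff_real_inner_le_zero K.convex h.1).1 ?_ z hz
  have : Nonempty (K : Set (E n)) := K.nonempty.to_subtype
  refine le_antisymm (le_ciInf fun w => ?_) (ciInf_le ⟨0, ?_⟩ (⟨y, h.1⟩ : (K : Set (E n))))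
  · simpa [dist_eq_norm] using h.2 w w.2
  · rintro _ ⟨w, rfl⟩
    exact norm_nonneg _

theorem isMetricProj_of_inner {K : Body n} {x y : E n} (hy : y ∈ K)
    (h : ∀ z ∈ K, inner ℝ (x - y) (z - y) ≤ 0) : IsMetricProj K x y := by
  refine ⟨hy, fun z hz => ?_⟩
  have h1 := h z hz
  have h2 : ‖x - z‖ ^ 2 = ‖x - y‖ ^ 2 - 2 * inner ℝ (x - y) (z - y) + ‖z - y‖ ^ 2 := by
    rw [← norm_sub_sq_real]; congr 2; abel
  rw [dist_eq_norm, dist_eq_norm]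
  refine abs_le_of_sq_le_sq' ?_ (norm_nonneg _) |>.2
  nlinarith [sq_nonneg ‖z - y‖]

/-- Sum of the two variational inequalities, each tested with the other projection. This firm
nonexpansiveness is stronger than the Lipschitz bound: it later puts the spectrum of the derivative
in `[0,1]`. -/
theorem inner_proj_le (K : Body n) (x y : E n) :
    ‖proj K x - proj K y‖ ^ 2 ≤ inner ℝ (proj K x - proj K y) (x - y) := by
  have h1 := (isMetricProj_proj K x).inner_nonpos (proj_mem K y)
  have h2 := (isMetricProj_proj K y).inner_nonpos (proj_mem K x)
  rw [← real_inner_self_eq_norm_sq]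
  simp only [inner_sub_left, inner_sub_right] at *
  have e1 := real_inner_comm (proj K x) (proj K y)
  have e2 := real_inner_comm x (proj K y)
  have e3 := real_inner_comm x (proj K x)
  have e4 := real_inner_comm y (proj K y)
  have e5 := real_inner_comm y (proj K x)
  linarith

theorem norm_proj_sub_le (K : Body n) (x y : E n) : ‖proj K x - proj K y‖ ≤ ‖x - y‖ := by
  have h := (inner_proj_le K x y).trans (real_inner_le_norm _ _)
  by_contra! hlt
  nlinarith [norm_nonneg (x - y), norm_nonneg (proj K x - proj K y)]

theorem lipschitzWith_proj (K : Body n) : LipschitzWith 1 (proj K) :=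
  LipschitzWith.of_dist_le_mul fun x y => by
    simpa [dist_eq_norm] using norm_proj_sub_le K x y

theorem continuous_proj (K : Body n) : Continuous (proj K) := (lipschitzWith_proj K).continuous

theorem IsMetricProj.eq_proj {K : Body n} {x y : E n} (h : IsMetricProj K x y) :
    y = proj K x := by
  have h1 := h.inner_nonpos (proj_mem K x)
  have h2 := (isMetricProj_proj K x).inner_nonpos h.1
  rw [← sub_eq_zero, ← norm_eq_zero, ← sq_eq_zero_iff, ← real_inner_self_eq_norm_sq]
  refine le_antisymm ?_ real_inner_self_nonneg
  have : inner ℝ (y - proj K x) (y - proj K x) =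
      inner ℝ (x - y) (proj K x - y) + inner ℝ (x - proj K x) (y - proj K x) := by
    rw [show proj K x - y = -(y - proj K x) by abel, inner_neg_right, ← sub_eq_neg_add,
      ← inner_sub_left]
    congr 1; abel
  linarith

theorem proj_eq_self_iff {K : Body n} {x : E n} : proj K x = x ↔ x ∈ K := by
  refine ⟨fun h => h ▸ proj_mem K x, fun h => ?_⟩
  exact (isMetricProj_of_inner h (by simp)).eq_proj.symm

/-- The distance to a convex body. -/
def bodyDist (K : Body n) (x : E n) : ℝ := ‖x - proj K x‖

theorem bodyDist_nonneg (K : Body n) (x : E n) : 0 ≤ bodyDist K x := norm_nonneg _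

theorem continuous_bodyDist (K : Body n) : Continuous (bodyDist K) :=
  (continuous_id.sub (continuous_proj K)).norm

theorem bodyDist_pos_iff {K : Body n} {x : E n} : 0 < bodyDist K x ↔ x ∉ K := by
  rw [bodyDist, norm_pos_iff, sub_ne_zero, ← proj_eq_self_iff (K := K), ne_comm, Ne]

theorem bodyDist_le_iff {K : Body n} {x : E n} {ε : ℝ} :
    bodyDist K x ≤ ε ↔ x ∈ (K : Set (E n)) + Metric.closedBall (0 : E n) ε := by
  constructor
  · intro h
    exact ⟨proj K x, proj_mem K x, x - proj K x, by simpa [bodyDist] using h, by simp⟩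
  · rintro ⟨y, hy, z, hz, rfl⟩
    have := (isMetricProj_proj K (y + z)).2 y hy
    rw [dist_eq_norm, dist_eq_norm] at this
    simpa [bodyDist] using this.trans (by simpa using hz)

/-- Scaling of `ℝⁿ` along the normals of a convex body. -/
def normalScale (K : Body n) (s : ℝ) (x : E n) : E n := proj K x + s • (x - proj K x)

/-- The variational inequality is homogeneous in `x - proj K x`, so the whole normal ray projects to
the same point. -/
theorem proj_normalScale (K : Body n) {s : ℝ} (hs : 0 ≤ s) (x : E n) :
    proj K (normalScale K s x) = proj K x := by
  refine (IsMetricProj.eq_proj (isMetricProj_of_inner (proj_mem K x) fun z hz => ?_)).symm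
  rw [normalScale, add_sub_cancel_left, real_inner_smul_left]
  exact mul_nonpos_of_nonneg_of_nonpos hs ((isMetricProj_proj K x).inner_nonpos hz)

theorem normalScale_sub_proj (K : Body n) {s : ℝ} (hs : 0 ≤ s) (x : E n) :
    normalScale K s x - proj K (normalScale K s x) = s • (x - proj K x) := by
  rw [proj_normalScale K hs, normalScale, add_sub_cancel_left]

theorem bodyDist_normalScale (K : Body n) {s : ℝ} (hs : 0 ≤ s) (x : E n) :
    bodyDist K (normalScale K s x) = s * bodyDist K x := by
  rw [bodyDist, normalScale_sub_proj K hs, norm_smul, Real.norm_of_nonneg hs, bodyDist]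

theorem normalScale_normalScale (K : Body n) {s t : ℝ} (ht : 0 ≤ t) (x : E n) :
    normalScale K s (normalScale K t x) = normalScale K (s * t) x := by
  rw [normalScale, normalScale_sub_proj K ht, proj_normalScale K ht, smul_smul, normalScale]

theorem normalScale_one (K : Body n) (x : E n) : normalScale K 1 x = x := by
  simp [normalScale]

theorem normalScale_injective (K : Body n) {s : ℝ} (hs : 0 < s) :
    Function.Injective (normalScale K s) := by
  intro x y h
  have := congrArg (normalScale K s⁻¹) h
  simpa [normalScale_normalScale K hs.le, inv_mul_cancel₀ hs.ne', normalScale_one] using this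

theorem lipschitzWith_normalScale (K : Body n) (s : ℝ) :
    LipschitzWith (1 + ‖s‖₊ * (1 + 1)) (normalScale K s) :=
  (lipschitzWith_proj K).add
    ((lipschitzWith_smul s).comp (LipschitzWith.id.sub (lipschitzWith_proj K)))

/-! ### The outer normal -/

theorem sph_nonempty (hn : 0 < n) : Nonempty (Sph n) := by
  have : Nonempty (Fin n) := ⟨⟨0, hn⟩⟩
  exact (NormedSpace.sphere_nonempty.2 zero_le_one).to_subtype

open Classical in
/-- The outer unit normal `u(K, x)`; an arbitrary value is taken at points of `K`. -/
def outerNormal [Nonempty (Sph n)] (K : Body n) (x : E n) : Sph n :=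
  if h : x ∉ K then
    ⟨(bodyDist K x)⁻¹ • (x - proj K x), by
      have := bodyDist_pos_iff.2 h
      rw [mem_sphere_zero_iff_norm, norm_smul, norm_inv, Real.norm_of_nonneg this.le]
      exact inv_mul_cancel₀ this.ne'⟩
  else Classical.arbitrary _

theorem bodyDist_smul_outerNormal [Nonempty (Sph n)] {K : Body n} {x : E n} (h : x ∉ K) :
    bodyDist K x • (outerNormal K x : E n) = x - proj K x := by
  rw [outerNormal, dif_pos h, smul_smul, mul_inv_cancel₀ (bodyDist_pos_iff.2 h).ne', one_smul]

theorem coe_outerNormal [Nonempty (Sph n)] {K : Body n} {x : E n} (h : x ∉ K) :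
    (outerNormal K x : E n) = (bodyDist K x)⁻¹ • (x - proj K x) := by
  rw [outerNormal, dif_pos h]

theorem measurable_outerNormal [Nonempty (Sph n)] (K : Body n) : Measurable (outerNormal K) := by
  classical
  rw [← (MeasurableEmbedding.subtype_coe Metric.isClosed_sphere.measurableSet).measurable_comp_iff]
  have : (Subtype.val ∘ outerNormal K : E n → E n) = fun x =>
      if x ∈ (K : Set (E n))ᶜ then (bodyDist K x)⁻¹ • (x - proj K x)
      else (Classical.arbitrary (Sph n) : E n) := by
    ext1 x
    by_cases h : x ∈ K
    · simp [outerNormal, h]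
    · simp [outerNormal, h]
  rw [this]
  exact Measurable.ite K.isClosed.measurableSet.compl
    ((continuous_bodyDist K).measurable.inv.smul
      (continuous_id.sub (continuous_proj K)).measurable) measurable_const

theorem outerNormal_eq [Nonempty (Sph n)] {K : Body n} {x : E n} (h : x ∉ K) {u : Sph n} {c : ℝ}
    (hc : 0 < c) (hu : x - proj K x = c • (u : E n)) : outerNormal K x = u := by
  have : bodyDist K x = c := by
    rw [bodyDist, hu, norm_smul, Real.norm_of_nonneg hc.le, norm_eq_of_mem_sphere, mul_one]
  ext1
  rw [coe_outerNormal h, this, hu, smul_smul, inv_mul_cancel₀ hc.ne', one_smul]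

theorem normalScale_notMem {K : Body n} {x : E n} (h : x ∉ K) {s : ℝ} (hs : 0 < s) :
    normalScale K s x ∉ K := by
  rw [← bodyDist_pos_iff, bodyDist_normalScale K hs.le]
  exact mul_pos hs (bodyDist_pos_iff.2 h)

theorem outerNormal_normalScale [Nonempty (Sph n)] {K : Body n} {x : E n} (h : x ∉ K) {s : ℝ}
    (hs : 0 < s) : outerNormal K (normalScale K s x) = outerNormal K x := by
  refine outerNormal_eq (normalScale_notMem h hs) (mul_pos hs (bodyDist_pos_iff.2 h)) ?_
  rw [normalScale_sub_proj K hs.le, mul_smul, bodyDist_smul_outerNormal h]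

/-! ### The derivative of the metric projection -/

/-- The function is the supremum over `z ∈ K` of the affine functions `⟨x, z⟩ - ‖z‖²/2`, attained at
`proj K x`. Thus `proj K x` is a subgradient, and the Lipschitz bound on `proj` makes the remainder
quadratic. The projection is thereby a gradient field. -/
theorem hasFDerivAt_half_sq_sub (K : Body n) (x : E n) :
    HasFDerivAt (fun x : E n => (‖x‖ ^ 2 - bodyDist K x ^ 2) / 2) (innerSL ℝ (proj K x)) x := by
  -- The subgradient inequality; using it in both directions between `x` and `y` brackets the
  -- remainder.
  have key : ∀ y z : E n, inner ℝ (proj K y) (z - y) ≤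
      (‖z‖ ^ 2 - bodyDist K z ^ 2) / 2 - (‖y‖ ^ 2 - bodyDist K y ^ 2) / 2 := by
    intro y z
    have h := (isMetricProj_proj K z).2 _ (proj_mem K y)
    rw [dist_eq_norm, dist_eq_norm] at h
    have h' : bodyDist K z ^ 2 ≤ ‖z - proj K y‖ ^ 2 := by
      unfold bodyDist; gcongr
    have h1 : ‖z - proj K y‖ ^ 2 = ‖z‖ ^ 2 - 2 * inner ℝ z (proj K y) + ‖proj K y‖ ^ 2 :=
      norm_sub_sq_real _ _
    have h2 : bodyDist K y ^ 2 = ‖y‖ ^ 2 - 2 * inner ℝ y (proj K y) + ‖proj K y‖ ^ 2 :=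
      norm_sub_sq_real _ _
    rw [inner_sub_right, real_inner_comm, real_inner_comm y]
    linarith
  rw [hasFDerivAt_iff_isLittleO]
  refine Asymptotics.IsBigO.trans_isLittleO (g := fun y => ‖y - x‖ ^ 2) ?_ ?_
  · refine Asymptotics.IsBigO.of_bound 1 (Eventually.of_forall fun y => ?_)
    have h1 := key x y
    have h2 := key y x
    have h3 := real_inner_le_norm (proj K y - proj K x) (y - x)
    have h4 := norm_proj_sub_le K y x
    rw [inner_sub_left] at h3
    have h5 : inner ℝ (proj K y) (x - y) = - inner ℝ (proj K y) (y - x) := by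
      rw [← inner_neg_right, neg_sub]
    have h6 : ‖proj K y - proj K x‖ * ‖y - x‖ ≤ ‖y - x‖ ^ 2 := by
      rw [sq]; gcongr
    rw [Real.norm_eq_abs, innerSL_apply_apply, abs_of_nonneg (by linarith), one_mul, norm_pow,
      norm_norm]
    linarith
  · have := (Asymptotics.isLittleO_norm_pow_id (E' := E n) one_lt_two).comp_tendsto
      (show Tendsto (fun y => y - x) (𝓝 x) (𝓝 0) from by
        simpa using (show Continuous fun y : E n => y - x by fun_prop).tendsto x)
    exact this

/-- The derivative of a gradient is a Hessian, hence symmetric. -/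
theorem fderiv_proj_symm {K : Body n} {x : E n} (h : DifferentiableAt ℝ (proj K) x) (v w : E n) :
    inner ℝ (fderiv ℝ (proj K) x v) w = inner ℝ v (fderiv ℝ (proj K) x w) := by
  have h1 : HasFDerivAt (fun y => innerSL ℝ (proj K y))
      ((innerSL ℝ).comp (fderiv ℝ (proj K) x)) x :=
    (innerSL ℝ : E n →L[ℝ] E n →L[ℝ] ℝ).hasFDerivAt.comp x h.hasFDerivAt
  have := second_derivative_symmetric (fun y => hasFDerivAt_half_sq_sub K y) h1 v w
  simp only [ContinuousLinearMap.comp_apply, innerSL_apply_apply] at this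
  rw [this, real_inner_comm]

/-- Limit of `inner_proj_le` along difference quotients. On an eigenvector it reads `μ² ≤ μ`. -/
theorem norm_sq_fderiv_proj_le {K : Body n} {x : E n} (h : DifferentiableAt ℝ (proj K) x)
    (v : E n) : ‖fderiv ℝ (proj K) x v‖ ^ 2 ≤ inner ℝ (fderiv ℝ (proj K) x v) v := by
  have h1 : Tendsto (fun t : ℝ => t⁻¹ • (proj K (x + t • v) - proj K x)) (𝓝[≠] 0)
      (𝓝 (fderiv ℝ (proj K) x v)) := by
    have : HasDerivAt (fun t : ℝ => proj K (x + t • v)) _ 0 := h.hasFDerivAt.hasLineDerivAt v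
    simpa using this.tendsto_slope_zero
  refine le_of_tendsto_of_tendsto ((h1.norm).pow 2) (h1.inner tendsto_const_nhds)
    (eventually_mem_nhdsWithin.mono fun t ht => ?_)
  have := inner_proj_le K (x + t • v) x
  rw [add_sub_cancel_left, real_inner_smul_right] at this
  have ht' : t ≠ 0 := ht
  dsimp only
  rw [norm_smul, mul_pow, real_inner_smul_left, norm_inv, Real.norm_eq_abs, inv_pow, sq_abs]
  have h3 : (t ^ 2)⁻¹ * ‖proj K (x + t • v) - proj K x‖ ^ 2 ≤
      (t ^ 2)⁻¹ * (t * inner ℝ (proj K (x + t • v) - proj K x) v) := by gcongr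
  refine h3.trans (le_of_eq ?_)
  field_simp

theorem fderiv_proj_normal {K : Body n} {x : E n} (h : DifferentiableAt ℝ (proj K) x) :
    fderiv ℝ (proj K) x (x - proj K x) = 0 := by
  have h1 := h.hasFDerivAt.hasLineDerivAt (x - proj K x)
  have h2 : HasLineDerivAt ℝ (proj K) 0 x (x - proj K x) := by
    refine HasDerivAt.congr_of_eventuallyEq (hasDerivAt_const (0 : ℝ) (proj K x)) ?_
    -- For `t > -1` the factor `1 + t` is nonnegative, so the projection is constant along the
    -- normal ray near `x`.
    filter_upwards [Ioi_mem_nhds (show (-1 : ℝ) < 0 by norm_num)] with t ht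
    have := proj_normalScale K (s := 1 + t) (by linarith [mem_Ioi.1 ht]) x
    rw [normalScale] at this
    exact Eq.trans (congrArg _ (by module)) this
  exact h1.unique h2

end

section

variable {n : ℕ}

/-! ### The Jacobian of the scaling along normals -/

/-- The Jacobian determinant of `normalScale K s` at a point of differentiability. -/
def scaleDet (K : Body n) (s : ℝ) (x : E n) : ℝ :=
  (fderiv ℝ (proj K) x + s • (ContinuousLinearMap.id ℝ (E n) - fderiv ℝ (proj K) x)).det

/-- The coefficients of the polynomial `s ↦ scaleDet K s x`. -/
def scaleCoeff (K : Body n) (j : ℕ) (x : E n) : ℝ :=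
  (Lagrange.interpolate (Finset.range (n + 1)) (fun i : ℕ => (i : ℝ))
    (fun i => scaleDet K i x)).coeff j

theorem measurable_scaleDet (K : Body n) (s : ℝ) : Measurable (scaleDet K s) := by
  have h := measurable_fderiv ℝ (proj K)
  have hc : Continuous fun A : E n →L[ℝ] E n =>
      (A + s • (ContinuousLinearMap.id ℝ (E n) - A)).det :=
    ContinuousLinearMap.continuous_det.comp (by fun_prop)
  exact hc.measurable.comp h

/-- Interpolation at the nodes `0, …, n` makes each coefficient a fixed linear combination of
determinants, so no measurable choice of eigenvalues is needed. -/
theorem measurable_scaleCoeff (K : Body n) (j : ℕ) : Measurable (scaleCoeff K j) := by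
  unfold scaleCoeff
  simp only [Lagrange.interpolate_apply, Polynomial.finsetSum_coeff, Polynomial.coeff_C_mul]
  exact Finset.measurable_fun_sum _ fun i _ => (measurable_scaleDet K i).mul_const _

theorem coeff_prod_nonneg {ι : Type*} (s : Finset ι) (q : ι → Polynomial ℝ)
    (h : ∀ i ∈ s, ∀ j, 0 ≤ (q i).coeff j) (j : ℕ) : 0 ≤ (∏ i ∈ s, q i).coeff j := by
  classical
  induction s using Finset.induction_on generalizing j with
  | empty => rw [Finset.prod_empty, Polynomial.coeff_one]; split_ifs <;> norm_num
  | insert a s ha ih =>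
    rw [Finset.prod_insert ha, Polynomial.coeff_mul]
    exact Finset.sum_nonneg fun p _ => mul_nonneg (h a (Finset.mem_insert_self _ _) _)
      (ih (fun i hi => h i (Finset.mem_insert_of_mem hi)) _)

/-- In an orthonormal eigenbasis of the derivative the determinant is the product of `μ i + (1 - μ
i) s` with `0 ≤ μ i ≤ 1`. The nonzero normal vector lies in the kernel, so some `μ i` vanishes and
contributes a factor `s`. If the linear coefficient is nonzero, that eigenvalue is simple, and the
derivative maps onto the orthogonal complement of the normal. -/
theorem exists_scaleDet_polynomial {K : Body n} {x : E n} (hx : x ∉ K)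
    (hd : DifferentiableAt ℝ (proj K) x) :
    ∃ q : Polynomial ℝ, q.natDegree ≤ n ∧ (∀ j, 0 ≤ q.coeff j) ∧ q.coeff 0 = 0 ∧
      (∀ s, scaleDet K s x = q.eval s) ∧
      (q.coeff 1 ≠ 0 → ∀ w, inner ℝ w (x - proj K x) = 0 → ∃ v, fderiv ℝ (proj K) x v = w) := by
  set P := fderiv ℝ (proj K) x with hP
  have hT : (P : E n →ₗ[ℝ] E n).IsSymmetric := fun v w => fderiv_proj_symm hd v w
  have hfin : Module.finrank ℝ (E n) = n := by simp
  set b := hT.eigenvectorBasis hfin with hb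
  set μ := hT.eigenvalues hfin with hμ
  have hPb : ∀ i, P (b i) = μ i • b i := fun i => hT.apply_eigenvectorBasis hfin i
  have hμ01 : ∀ i, μ i ^ 2 ≤ μ i := by
    intro i
    have := norm_sq_fderiv_proj_le hd (b i)
    rw [← hP, hPb, norm_smul, real_inner_smul_left, real_inner_self_eq_norm_sq] at this
    simpa using this
  have hμ0 : ∀ i, 0 ≤ μ i := fun i => (sq_nonneg _).trans (hμ01 i)
  have hμ1 : ∀ i, μ i ≤ 1 := fun i => by nlinarith [hμ01 i, hμ0 i]
  have hne : x - proj K x ≠ 0 := by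
    rw [sub_ne_zero]; exact fun h => hx (proj_eq_self_iff.1 h.symm)
  have hnormal : ∀ i, μ i * inner ℝ (b i) (x - proj K x) = 0 := by
    intro i
    rw [← real_inner_smul_left, ← hPb, hP, fderiv_proj_symm hd, fderiv_proj_normal hd,
      inner_zero_right]
  obtain ⟨i₀, hi₀⟩ : ∃ i, μ i = 0 := by
    by_contra! h
    refine hne (b.repr.injective ?_)
    ext i
    rw [b.repr_apply_apply]
    simpa using (mul_eq_zero.1 (hnormal i)).resolve_left (h i)
  refine ⟨∏ i, (Polynomial.C (μ i) + Polynomial.C (1 - μ i) * Polynomial.X), ?_, ?_, ?_, ?_, ?_⟩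
  · refine (Polynomial.natDegree_prod_le _ _).trans ?_
    refine (Finset.sum_le_card_nsmul _ _ 1 fun i _ => ?_).trans (by simp)
    rw [add_comm]
    exact Polynomial.natDegree_linear_le
  · refine coeff_prod_nonneg _ _ fun i _ j => ?_
    rw [Polynomial.coeff_add, Polynomial.coeff_C, Polynomial.coeff_C_mul, Polynomial.coeff_X]
    have := hμ0 i
    have := hμ1 i
    split_ifs <;> simp <;> linarith
  · rw [Polynomial.coeff_zero_eq_eval_zero, Polynomial.eval_prod]
    exact Finset.prod_eq_zero (Finset.mem_univ i₀) (by simp [hi₀])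
  · intro s
    rw [scaleDet, Polynomial.eval_prod, ContinuousLinearMap.det,
      ← LinearMap.det_toMatrix b.toBasis]
    have : LinearMap.toMatrix b.toBasis b.toBasis
        ((P + s • (ContinuousLinearMap.id ℝ (E n) - P) : E n →L[ℝ] E n) : E n →ₗ[ℝ] E n) =
        Matrix.diagonal fun i => μ i + (1 - μ i) * s := by
      ext i j
      have h1 : (P + s • (ContinuousLinearMap.id ℝ (E n) - P)) (b j) =
          (μ j + (1 - μ j) * s) • b j := by
        simp only [add_apply, smul_apply, sub_apply, ContinuousLinearMap.id_apply, hPb]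
        module
      rw [LinearMap.toMatrix_apply]
      simp only [OrthonormalBasis.coe_toBasis, ContinuousLinearMap.coe_coe, h1, map_smul]
      by_cases hij : i = j
      · subst hij; simp
      · simp [hij]
    rw [this, Matrix.det_diagonal]
    simp
  · intro h1 w hw
    -- A second zero eigenvalue would give a second factor `X`, and the linear coefficient would
    -- vanish.
    have hμne : ∀ i, i ≠ i₀ → μ i ≠ 0 := by
      intro i hi hi0
      refine h1 ?_
      rw [← Finset.mul_prod_erase _ _ (Finset.mem_univ i₀),
        ← Finset.mul_prod_erase _ _ (Finset.mem_erase.2 ⟨hi, Finset.mem_univ i⟩), hi₀, hi0]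
      simp only [map_zero, sub_zero, map_one, one_mul, zero_add]
      rw [← mul_assoc, mul_comm, ← sq, Polynomial.coeff_mul_X_pow']
      simp
    have horth : ∀ i, i ≠ i₀ → inner ℝ (b i) (x - proj K x) = 0 := fun i hi =>
      (mul_eq_zero.1 (hnormal i)).resolve_left (hμne i hi)
    have hxb : x - proj K x = inner ℝ (b i₀) (x - proj K x) • b i₀ := by
      conv_lhs => rw [← b.sum_repr' (x - proj K x)]
      refine Finset.sum_eq_single i₀ (fun i _ hi => by rw [horth i hi, zero_smul]) (by simp)
    have hc : inner ℝ (b i₀) (x - proj K x) ≠ 0 := fun h => hne (by rw [hxb, h, zero_smul])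
    have hw0 : inner ℝ (b i₀) w = 0 := by
      rw [hxb, real_inner_smul_right] at hw
      rw [real_inner_comm]
      exact (mul_eq_zero.1 hw).resolve_left hc
    refine ⟨∑ i, ((μ i)⁻¹ * inner ℝ (b i) w) • b i, ?_⟩
    rw [map_sum]
    conv_rhs => rw [← b.sum_repr' w]
    refine Finset.sum_congr rfl fun i _ => ?_
    rw [map_smul, hPb, smul_smul]
    by_cases hi : i = i₀
    · rw [hi, hw0]; simp
    · congr 1
      field_simp [hμne i hi]

theorem scaleCoeff_eq_coeff {K : Body n} {x : E n} {q : Polynomial ℝ} (hdeg : q.natDegree ≤ n)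
    (hq : ∀ s, scaleDet K s x = q.eval s) (j : ℕ) : scaleCoeff K j x = q.coeff j := by
  rw [scaleCoeff]
  congr 1
  refine (Lagrange.eq_interpolate_of_eval_eq _ (fun a _ b _ h => by exact_mod_cast h) ?_ ?_).symm
  · rw [Finset.card_range]
    exact Polynomial.degree_le_natDegree.trans_lt (by exact_mod_cast Nat.lt_succ_of_le hdeg)
  · intro i _
    rw [hq]

theorem scaleCoeff_nonneg {K : Body n} {x : E n} (hx : x ∉ K)
    (hd : DifferentiableAt ℝ (proj K) x) (j : ℕ) : 0 ≤ scaleCoeff K j x := by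
  obtain ⟨q, h1, h2, -, h4, -⟩ := exists_scaleDet_polynomial hx hd
  rw [scaleCoeff_eq_coeff h1 h4]
  exact h2 j

/-- The constant term is zero, so the exponents are `1, …, n`; writing them as `n - k` matches the
order in the Steiner formula. -/
theorem scaleDet_eq_sum {K : Body n} {x : E n} (hx : x ∉ K)
    (hd : DifferentiableAt ℝ (proj K) x) (s : ℝ) :
    scaleDet K s x = ∑ k : Fin n, s ^ (n - (k : ℕ)) * scaleCoeff K (n - (k : ℕ)) x := by
  obtain ⟨q, h1, -, h3, h4, -⟩ := exists_scaleDet_polynomial hx hd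
  have hc : ∀ j, scaleCoeff K j x = q.coeff j := scaleCoeff_eq_coeff h1 h4
  simp only [hc]
  rw [h4, Polynomial.eval_eq_sum_range' (Nat.lt_succ_of_le h1), Finset.sum_range_succ', h3,
    Fin.sum_univ_eq_sum_range (fun k => s ^ (n - k) * q.coeff (n - k)),
    ← Finset.sum_range_reflect (fun k => q.coeff (k + 1) * s ^ (k + 1)), zero_mul, add_zero]
  refine Finset.sum_congr rfl fun k hk => ?_
  rw [show n - 1 - k + 1 = n - k by have := Finset.mem_range.1 hk; omega, mul_comm]

theorem scaleDet_nonneg {K : Body n} {x : E n} (hx : x ∉ K)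
    (hd : DifferentiableAt ℝ (proj K) x) {s : ℝ} (hs : 0 ≤ s) : 0 ≤ scaleDet K s x := by
  rw [scaleDet_eq_sum hx hd]
  exact Finset.sum_nonneg fun k _ => mul_nonneg (pow_nonneg hs _) (scaleCoeff_nonneg hx hd _)

theorem scaleDet_one (K : Body n) (x : E n) : scaleDet K 1 x = 1 := by
  rw [scaleDet, one_smul, add_sub_cancel]
  exact LinearMap.det_id

/-- Every power `s ^ j` with `j ≥ 1` is at most `s`, and the nonnegative coefficients add up to
`scaleDet K 1 x = 1`. This linear bound is the source of all dominations by `t`. -/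
theorem scaleDet_le {K : Body n} {x : E n} (hx : x ∉ K)
    (hd : DifferentiableAt ℝ (proj K) x) {s : ℝ} (hs : 0 ≤ s) (hs1 : s ≤ 1) :
    scaleDet K s x ≤ s := by
  calc scaleDet K s x = ∑ k : Fin n, s ^ (n - (k : ℕ)) * scaleCoeff K (n - (k : ℕ)) x :=
        scaleDet_eq_sum hx hd s
    _ ≤ ∑ k : Fin n, s * (1 ^ (n - (k : ℕ)) * scaleCoeff K (n - (k : ℕ)) x) := by
        refine Finset.sum_le_sum fun k _ => ?_
        rw [one_pow, one_mul]
        refine mul_le_mul_of_nonneg_right ?_ (scaleCoeff_nonneg hx hd _)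
        exact pow_le_of_le_one hs hs1 (by have := k.2; omega)
    _ = s := by rw [← Finset.mul_sum, ← scaleDet_eq_sum hx hd, scaleDet_one, mul_one]

theorem tendsto_scaleDet_div {K : Body n} {x : E n} (hx : x ∉ K)
    (hd : DifferentiableAt ℝ (proj K) x) :
    Tendsto (fun s => scaleDet K s x / s) (𝓝[>] 0) (𝓝 (scaleCoeff K 1 x)) := by
  obtain ⟨q, h1, -, h3, h4, -⟩ := exists_scaleDet_polynomial hx hd
  rw [scaleCoeff_eq_coeff h1 h4]
  have : Tendsto (fun s => q.divX.eval s) (𝓝[>] 0) (𝓝 (q.divX.eval 0)) :=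
    q.divX.continuous.continuousWithinAt
  rw [← Polynomial.coeff_zero_eq_eval_zero, Polynomial.coeff_divX] at this
  refine this.congr' (eventually_mem_nhdsWithin.mono fun s hs => ?_)
  change _ = scaleDet K s x / s
  rw [h4]
  conv_rhs => rw [← Polynomial.divX_mul_X_add q]
  have hs' : s ≠ 0 := (mem_Ioi.1 hs).ne'
  simp [h3, hs']

theorem exists_fderiv_proj_eq {K : Body n} {x : E n} (hx : x ∉ K)
    (hd : DifferentiableAt ℝ (proj K) x) (h1 : scaleCoeff K 1 x ≠ 0) {w : E n}
    (hw : inner ℝ w (x - proj K x) = 0) : ∃ v, fderiv ℝ (proj K) x v = w := by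
  obtain ⟨q, hq1, -, -, h4, h5⟩ := exists_scaleDet_polynomial hx hd
  exact h5 (scaleCoeff_eq_coeff hq1 h4 1 ▸ h1) w hw

theorem ae_differentiableAt_proj (K : Body n) : ∀ᵐ x, DifferentiableAt ℝ (proj K) x :=
  (lipschitzWith_proj K).ae_differentiableAt

/-- The `n`-dimensional Hausdorff measure has the same null sets as Lebesgue measure and grows at
most by a factor under Lipschitz maps. -/
theorem volume_image_eq_zero_of_lipschitzWith {f : E n → E n} {c : NNReal} (hf : LipschitzWith c f)
    {N : Set (E n)} (hN : volume N = 0) : volume (f '' N) = 0 := by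
  have h1 : (μH[Module.finrank ℝ (E n)] : Measure (E n)) ≪ volume :=
    Measure.absolutelyContinuous_isAddHaarMeasure _ _
  have h2 : (volume : Measure (E n)) ≪ μH[Module.finrank ℝ (E n)] :=
    Measure.absolutelyContinuous_isAddHaarMeasure _ _
  refine h2 (le_antisymm ?_ bot_le)
  refine (hf.hausdorffMeasure_image_le (by positivity) N).trans ?_
  rw [h1 hN, mul_zero]

/-- Change of variables for the scaling along normals. -/
theorem lintegral_image_normalScale (K : Body n) {s : ℝ} (hs : 0 < s) {B : Set (E n)}
    (hB : MeasurableSet B) (hBK : ∀ x ∈ B, x ∉ K) (f : E n → ℝ≥0∞) :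
    ∫⁻ x in normalScale K s '' B, f x =
      ∫⁻ x in B, ENNReal.ofReal (scaleDet K s x) * f (normalScale K s x) := by
  set D := {x | DifferentiableAt ℝ (proj K) x} with hD
  have hDm : MeasurableSet D := measurableSet_of_differentiableAt ℝ (proj K)
  have hDn : volume Dᶜ = 0 := ae_differentiableAt_proj K
  have h1 : (B : Set (E n)) =ᵐ[volume] (B ∩ D : Set (E n)) := by
    filter_upwards [ae_differentiableAt_proj K] with x hx
    exact propext ⟨fun h => ⟨h, hx⟩, fun h => h.1⟩
  -- Points where the projection is not differentiable form a null set, and so does their Lipschitz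
  -- image.
  have h2 : (normalScale K s '' B : Set (E n)) =ᵐ[volume] (normalScale K s '' (B ∩ D) : Set _) := by
    have h0 : volume (normalScale K s '' Dᶜ) = 0 :=
      volume_image_eq_zero_of_lipschitzWith (lipschitzWith_normalScale K s) hDn
    have h0' : ∀ᵐ x, x ∉ normalScale K s '' Dᶜ := measure_eq_zero_iff_ae_notMem.1 h0
    filter_upwards [h0'] with y hy
    refine propext ⟨?_, ?_⟩
    · rintro ⟨x, hx, rfl⟩
      refine ⟨x, ⟨hx, ?_⟩, rfl⟩
      by_contra hxD
      exact hy ⟨x, hxD, rfl⟩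
    · rintro ⟨x, hx, rfl⟩
      exact ⟨x, hx.1, rfl⟩
  rw [setLIntegral_congr h1, setLIntegral_congr h2,
    lintegral_image_eq_lintegral_abs_det_fderiv_mul volume (hB.inter hDm)
      (f' := fun x => fderiv ℝ (proj K) x +
        s • (ContinuousLinearMap.id ℝ (E n) - fderiv ℝ (proj K) x))
      (fun x hx => ?_) (normalScale_injective K hs).injOn]
  · refine setLIntegral_congr_fun (hB.inter hDm) fun x hx => ?_
    rw [← scaleDet, abs_of_nonneg (scaleDet_nonneg (hBK x hx.1) hx.2 hs.le)]
  · have hd : HasFDerivAt (proj K) _ x := (show DifferentiableAt ℝ (proj K) x from hx.2).hasFDerivAt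
    exact (hd.add (((hasFDerivAt_id x).sub hd).const_smul s)).hasFDerivWithinAt

end

section

variable {n : ℕ}

/-! ### The support measures -/

/-- The points outside `K` at distance at most `R`. -/
def collar (K : Body n) (R : ℝ) : Set (E n) := {x | x ∉ K ∧ bodyDist K x ≤ R}

theorem measurableSet_collar (K : Body n) (R : ℝ) : MeasurableSet (collar K R) :=
  K.isClosed.measurableSet.compl.inter
    (measurableSet_le (continuous_bodyDist K).measurable measurable_const)

theorem collar_subset (K : Body n) (R : ℝ) :
    collar K R ⊆ (K : Set (E n)) + Metric.closedBall (0 : E n) R := fun _ hx =>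
  bodyDist_le_iff.1 hx.2

theorem volume_collar_lt_top (K : Body n) (R : ℝ) : volume (collar K R) < ∞ :=
  (measure_mono (collar_subset K R)).trans_lt
    (K.isCompact.add (isCompact_closedBall 0 R)).measure_lt_top

theorem normalScale_image_collar (K : Body n) {s : ℝ} (hs : 0 < s) (R : ℝ) :
    normalScale K s '' collar K R = collar K (s * R) := by
  ext y
  constructor
  · rintro ⟨x, ⟨hx, hR⟩, rfl⟩
    refine ⟨normalScale_notMem hx hs, ?_⟩
    rw [bodyDist_normalScale K hs.le]
    gcongr
  · rintro ⟨hy, hR⟩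
    refine ⟨normalScale K s⁻¹ y, ⟨normalScale_notMem hy (inv_pos.2 hs), ?_⟩, ?_⟩
    · rw [bodyDist_normalScale K (inv_pos.2 hs).le, inv_mul_le_iff₀ hs]
      exact hR
    · rw [normalScale_normalScale K (inv_pos.2 hs).le, mul_inv_cancel₀ hs.ne', normalScale_one]

theorem ae_collar_differentiableAt (K : Body n) (R : ℝ) :
    ∀ᵐ x ∂(volume.restrict (collar K R)), x ∉ K ∧ DifferentiableAt ℝ (proj K) x := by
  filter_upwards [ae_restrict_mem (measurableSet_collar K R),
    ae_restrict_of_ae (ae_differentiableAt_proj K)] with x hx hd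
  exact ⟨hx.1, hd⟩

theorem kappa_pos (m : ℕ) : 0 < kappa m :=
  div_pos (by positivity) (Real.Gamma_pos_of_pos (by positivity))

theorem scaleCoeff_one_le {K : Body n} {x : E n} (hx : x ∉ K)
    (hd : DifferentiableAt ℝ (proj K) x) : scaleCoeff K 1 x ≤ 1 := by
  refine le_of_tendsto (tendsto_scaleDet_div hx hd) ?_
  filter_upwards [Ioc_mem_nhdsGT (zero_lt_one : (0 : ℝ) < 1)] with s hs
  rw [div_le_one hs.1]
  exact scaleDet_le hx hd hs.1.le hs.2

/-- Two polynomials that agree on `(0, ∞)` coincide. Finiteness allows the passage to real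
coefficients, and only the linear one, at index `n - 1`, is read off. -/
theorem eq_of_sum_pow_mul_eq (hn : 0 < n) {a b : Fin n → ℝ≥0∞} (ha : ∀ k, a k ≠ ∞)
    (hb : ∀ k, b k ≠ ∞) (h : ∀ s : ℝ, 0 < s → ∑ k : Fin n, ENNReal.ofReal (s ^ (n - (k : ℕ))) * a k =
      ∑ k : Fin n, ENNReal.ofReal (s ^ (n - (k : ℕ))) * b k) :
    a ⟨n - 1, Nat.sub_lt hn one_pos⟩ = b ⟨n - 1, Nat.sub_lt hn one_pos⟩ := by
  set q : Polynomial ℝ := ∑ k : Fin n,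
    Polynomial.C ((a k).toReal - (b k).toReal) * Polynomial.X ^ (n - (k : ℕ)) with hq
  have hroot : ∀ s : ℝ, 0 < s → q.IsRoot s := by
    intro s hs
    have h1 := congrArg ENNReal.toReal (h s hs)
    rw [ENNReal.toReal_sum fun k _ => ENNReal.mul_ne_top ENNReal.ofReal_ne_top (ha k),
      ENNReal.toReal_sum fun k _ => ENNReal.mul_ne_top ENNReal.ofReal_ne_top (hb k)] at h1
    simp only [ENNReal.toReal_mul, ENNReal.toReal_ofReal (pow_nonneg hs.le _)] at h1
    rw [Polynomial.IsRoot, hq, Polynomial.eval_finsetSum]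
    simp only [Polynomial.eval_mul, Polynomial.eval_C, Polynomial.eval_pow, Polynomial.eval_X,
      sub_mul, Finset.sum_sub_distrib]
    rw [sub_eq_zero]
    simpa only [mul_comm] using h1
  have hq0 : q = 0 := Polynomial.eq_zero_of_infinite_isRoot q
    ((Ioi_infinite (0 : ℝ)).mono fun s hs => hroot s hs)
  have hc : q.coeff 1 = 0 := by rw [hq0]; simp
  rw [hq, Polynomial.finsetSum_coeff, Finset.sum_eq_single ⟨n - 1, Nat.sub_lt hn one_pos⟩] at hc
  · rw [Polynomial.coeff_C_mul, Polynomial.coeff_X_pow,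
      if_pos (show 1 = n - (n - 1) by omega), mul_one, sub_eq_zero] at hc
    exact (ENNReal.toReal_eq_toReal_iff' (ha _) (hb _)).1 hc
  · intro k _ hk
    rw [Polynomial.coeff_C_mul, Polynomial.coeff_X_pow, if_neg, mul_zero]
    intro h1
    exact hk (Fin.ext (by have := k.2; simp only; omega))
  · simp

variable [Nonempty (Sph n)]

/-- The pair `(p(K, x), u(K, x))`. -/
def normalPair (K : Body n) (x : E n) : E n × Sph n := (proj K x, outerNormal K x)

theorem measurable_normalPair (K : Body n) : Measurable (normalPair K) :=
  (continuous_proj K).measurable.prodMk (measurable_outerNormal K)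

theorem normalPair_normalScale {K : Body n} {x : E n} (h : x ∉ K) {s : ℝ} (hs : 0 < s) :
    normalPair K (normalScale K s x) = normalPair K x := by
  rw [normalPair, proj_normalScale K hs.le, outerNormal_normalScale h hs, normalPair]

theorem localParallelSet_eq (K : Body n) (ε : ℝ) (η : Set (E n × Sph n)) :
    localParallelSet K ε η = collar K ε ∩ normalPair K ⁻¹' η := by
  ext x
  constructor
  · rintro ⟨⟨h1, h2⟩, z, hz, hp, hu⟩
    refine ⟨⟨h2, bodyDist_le_iff.2 h1⟩, ?_⟩
    have hzp : z.1 = proj K x := hp.eq_proj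
    have : normalPair K x = z := by
      refine Prod.ext hzp.symm (outerNormal_eq h2 (bodyDist_pos_iff.2 h2) ?_)
      rw [hzp] at hu
      exact hu
    rwa [mem_preimage, this]
  · rintro ⟨⟨h2, h1⟩, hη⟩
    exact ⟨⟨bodyDist_le_iff.1 h1, h2⟩, normalPair K x, hη, isMetricProj_proj K x,
      (bodyDist_smul_outerNormal h2).symm⟩

theorem normalScale_image_collar_inter (K : Body n) {s : ℝ} (hs : 0 < s) (R : ℝ)
    (η : Set (E n × Sph n)) :
    normalScale K s '' (collar K R ∩ normalPair K ⁻¹' η) =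
      collar K (s * R) ∩ normalPair K ⁻¹' η := by
  rw [← normalScale_image_collar K hs]
  ext y
  constructor
  · rintro ⟨x, hx, rfl⟩
    refine ⟨⟨x, hx.1, rfl⟩, ?_⟩
    rw [mem_preimage, normalPair_normalScale hx.1.1 hs]
    exact hx.2
  · rintro ⟨⟨x, hx, rfl⟩, hy⟩
    rw [mem_preimage, normalPair_normalScale hx.1 hs] at hy
    exact ⟨x, ⟨hx, hy⟩, rfl⟩

/-- The measures on normal pairs given by the coefficients of the Jacobian. -/
def coeffMeasure (K : Body n) (R : ℝ) (j : ℕ) : Measure (E n × Sph n) :=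
  ((volume.restrict (collar K R)).withDensity fun x => ENNReal.ofReal (scaleCoeff K j x)).map
    (normalPair K)

theorem coeffMeasure_apply (K : Body n) (R : ℝ) (j : ℕ) {η : Set (E n × Sph n)}
    (hη : MeasurableSet η) : coeffMeasure K R j η =
      ∫⁻ x in collar K R ∩ normalPair K ⁻¹' η, ENNReal.ofReal (scaleCoeff K j x) := by
  have hm := measurable_normalPair K hη
  rw [coeffMeasure, Measure.map_apply (measurable_normalPair K) hη, withDensity_apply _ hm,
    Measure.restrict_restrict hm, inter_comm]

/-- Scaling along normals does not change the normal pair, so the change of variables expands the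
volume with the Jacobian polynomial. Up to the constants `kappa` this is the local Steiner formula.
-/
theorem volume_collar_inter (K : Body n) {s : ℝ} (hs : 0 < s) (R : ℝ) {η : Set (E n × Sph n)}
    (hη : MeasurableSet η) : volume (collar K (s * R) ∩ normalPair K ⁻¹' η) =
      ∑ k : Fin n, ENNReal.ofReal (s ^ (n - (k : ℕ))) * coeffMeasure K R (n - (k : ℕ)) η := by
  have hm := (measurableSet_collar K R).inter (measurable_normalPair K hη)
  have h := lintegral_image_normalScale K hs hm (fun x hx => hx.1.1) 1
  rw [normalScale_image_collar_inter K hs] at h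
  simp only [Pi.one_apply, lintegral_one, Measure.restrict_apply_univ, mul_one] at h
  rw [h]
  simp only [coeffMeasure_apply K R _ hη]
  have h2 : ∀ᵐ x ∂(volume.restrict (collar K R ∩ normalPair K ⁻¹' η)),
      ENNReal.ofReal (scaleDet K s x) = ∑ k : Fin n, ENNReal.ofReal (s ^ (n - (k : ℕ))) *
        ENNReal.ofReal (scaleCoeff K (n - (k : ℕ)) x) := by
    filter_upwards [ae_restrict_mem hm, ae_restrict_of_ae (ae_differentiableAt_proj K)] with x hx hd
    rw [scaleDet_eq_sum hx.1.1 hd, ENNReal.ofReal_sum_of_nonneg]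
    · exact Finset.sum_congr rfl fun k _ => ENNReal.ofReal_mul (by positivity)
    · exact fun k _ => mul_nonneg (by positivity) (scaleCoeff_nonneg hx.1.1 hd _)
  rw [lintegral_congr_ae h2, lintegral_finsetSum]
  · refine Finset.sum_congr rfl fun k _ => ?_
    rw [lintegral_const_mul]
    exact (measurable_scaleCoeff K _).ennreal_ofReal
  · exact fun k _ => ((measurable_scaleCoeff K _).ennreal_ofReal).const_mul _

theorem isSupportMeasures_coeffMeasure (K : Body n) :
    IsSupportMeasures K fun k => (ENNReal.ofReal (kappa (n - (k : ℕ))))⁻¹ •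
      coeffMeasure K 1 (n - (k : ℕ)) := by
  intro ε hε η hη
  rw [localParallelSet_eq]
  have := volume_collar_inter K hε 1 hη
  rw [mul_one] at this
  rw [this]
  refine Finset.sum_congr rfl fun k _ => ?_
  rw [ENNReal.ofReal_mul (by positivity), Measure.smul_apply, smul_eq_mul, mul_assoc,
    ← mul_assoc (ENNReal.ofReal (kappa _)), ENNReal.mul_inv_cancel, one_mul]
  · simpa using kappa_pos _
  · exact ENNReal.ofReal_ne_top

/-- The coefficient measures witness existence, so the choice in `supportMeasure` is never the
default value. -/
theorem isSupportMeasures_supportMeasure (K : Body n) :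
    IsSupportMeasures K (supportMeasure K) := by
  have h : ∃ Λ, IsSupportMeasures K Λ := ⟨_, isSupportMeasures_coeffMeasure K⟩
  rw [supportMeasure, dif_pos h]
  exact h.choose_spec

theorem coeffMeasure_ne_top (K : Body n) {R : ℝ} (k : Fin n) {η : Set (E n × Sph n)}
    (hη : MeasurableSet η) : coeffMeasure K R (n - (k : ℕ)) η ≠ ∞ := by
  have h := volume_collar_inter K one_pos R hη
  rw [one_mul] at h
  have h2 : volume (collar K R ∩ normalPair K ⁻¹' η) ≠ ∞ :=
    ((measure_mono inter_subset_left).trans_lt (volume_collar_lt_top K R)).ne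
  rw [h] at h2
  have := ENNReal.sum_ne_top.1 h2 k (Finset.mem_univ k)
  simpa using this

/-- The surface measure on normal pairs, a multiple of the support measure of order `n - 1`. -/
def surfMeasure (K : Body n) : Measure (E n × Sph n) := coeffMeasure K 1 1

/-- The chosen measures and the coefficient measures expand the same local parallel volumes, so
their linear coefficients agree. -/
theorem supportMeasure_top (hn : 0 < n) (K : Body n) :
    supportMeasure K ⟨n - 1, Nat.sub_lt hn one_pos⟩ =
      (ENNReal.ofReal (kappa 1))⁻¹ • surfMeasure K := by
  have hn1 : n - (n - 1) = 1 := by omega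
  have hκ : ENNReal.ofReal (kappa 1) ≠ 0 := by simpa using kappa_pos 1
  ext η hη
  have h := eq_of_sum_pow_mul_eq hn
    (a := fun k => ENNReal.ofReal (kappa (n - (k : ℕ))) * supportMeasure K k η)
    (b := fun k => coeffMeasure K 1 (n - (k : ℕ)) η) ?_ (fun k => coeffMeasure_ne_top K k hη) ?_
  · simp only [hn1] at h
    rw [Measure.smul_apply, smul_eq_mul, surfMeasure, ← h, ← mul_assoc,
      ENNReal.inv_mul_cancel hκ ENNReal.ofReal_ne_top, one_mul]
  · intro k
    have h1 := isSupportMeasures_supportMeasure K 1 one_pos η hη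
    rw [localParallelSet_eq] at h1
    have h2 : volume (collar K 1 ∩ normalPair K ⁻¹' η) ≠ ∞ :=
      ((measure_mono inter_subset_left).trans_lt (volume_collar_lt_top K 1)).ne
    rw [h1] at h2
    have := ENNReal.sum_ne_top.1 h2 k (Finset.mem_univ k)
    simpa using this
  · intro s hs
    have h1 := isSupportMeasures_supportMeasure K s hs η hη
    have h2 := volume_collar_inter K hs 1 hη
    rw [localParallelSet_eq] at h1
    rw [mul_one, h1] at h2
    rw [← h2]
    refine Finset.sum_congr rfl fun k _ => ?_
    rw [ENNReal.ofReal_mul (by positivity), mul_assoc]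

/-- The collar of radius `s * a` is a scaled copy both of the collar of radius `a` and of the unit
collar; compare the linear terms in `s`. -/
theorem coeffMeasure_one_scale (hn : 0 < n) (K : Body n) {a : ℝ} (ha : 0 < a)
    {η : Set (E n × Sph n)} (hη : MeasurableSet η) :
    coeffMeasure K a 1 η = ENNReal.ofReal a * surfMeasure K η := by
  have hn1 : n - (n - 1) = 1 := by omega
  have h := eq_of_sum_pow_mul_eq hn
    (a := fun k => coeffMeasure K a (n - (k : ℕ)) η)
    (b := fun k => ENNReal.ofReal (a ^ (n - (k : ℕ))) * coeffMeasure K 1 (n - (k : ℕ)) η)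
    (fun k => coeffMeasure_ne_top K k hη)
    (fun k => ENNReal.mul_ne_top ENNReal.ofReal_ne_top (coeffMeasure_ne_top K k hη)) ?_
  · simpa only [hn1, pow_one, surfMeasure] using h
  · intro s hs
    have h1 := volume_collar_inter K hs a hη
    have h2 := volume_collar_inter K (mul_pos hs ha) 1 hη
    rw [mul_one, h1] at h2
    rw [h2]
    refine Finset.sum_congr rfl fun k _ => ?_
    rw [mul_pow, ENNReal.ofReal_mul (by positivity), mul_assoc]

theorem surfMeasure_univ_le (K : Body n) : surfMeasure K univ ≤ volume (collar K 1) := by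
  rw [surfMeasure, coeffMeasure_apply K 1 1 MeasurableSet.univ, preimage_univ, inter_univ]
  calc ∫⁻ x in collar K 1, ENNReal.ofReal (scaleCoeff K 1 x)
      ≤ ∫⁻ _ in collar K 1, 1 := by
        refine lintegral_mono_ae ?_
        filter_upwards [ae_collar_differentiableAt K 1] with x hx
        exact ENNReal.ofReal_le_one.2 (scaleCoeff_one_le hx.1 hx.2)
    _ = volume (collar K 1) := by simp

instance isFiniteMeasure_surfMeasure (K : Body n) : IsFiniteMeasure (surfMeasure K) :=
  ⟨(surfMeasure_univ_le K).trans_lt (volume_collar_lt_top K 1)⟩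

theorem ae_surfMeasure_mem (K : Body n) : ∀ᵐ z ∂surfMeasure K, z.1 ∈ K := by
  have hm : MeasurableSet {z : E n × Sph n | z.1 ∈ K} :=
    K.isClosed.measurableSet.preimage measurable_fst
  rw [surfMeasure, coeffMeasure, ae_map_iff (measurable_normalPair K).aemeasurable hm]
  exact Eventually.of_forall fun x => proj_mem K x

/-- Integration over a collar splits into the distance and the normal pair. -/
theorem map_bodyDist_normalPair (hn : 0 < n) (K : Body n) :
    ((volume.restrict (collar K 1)).withDensity fun x => ENNReal.ofReal (scaleCoeff K 1 x)).map
        (fun x => (bodyDist K x, normalPair K x)) =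
      (volume.restrict (Ioc (0 : ℝ) 1)).prod (surfMeasure K) := by
  set m := (volume.restrict (collar K 1)).withDensity fun x => ENNReal.ofReal (scaleCoeff K 1 x)
    with hm
  have hmd := (continuous_bodyDist K).measurable
  have hmn := measurable_normalPair K
  have hmuniv : m univ < ∞ := by
    have : surfMeasure K univ = m univ := by
      rw [surfMeasure, coeffMeasure, Measure.map_apply hmn MeasurableSet.univ, preimage_univ]
    rw [← this]
    exact measure_lt_top _ _
  have : IsFiniteMeasure m := ⟨hmuniv⟩
  refine (Measure.prod_eq fun s η hs hη => ?_).symm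
  rw [Measure.map_apply (hmd.prodMk hmn) (hs.prod hη)]
  -- By `coeffMeasure_one_scale` the mass at distance at most `a` is proportional to `a`: for any
  -- set `η` of normal pairs the distance is uniform on `(0, 1]`.
  have key : (m.restrict (normalPair K ⁻¹' η)).map (bodyDist K) =
      surfMeasure K η • volume.restrict (Ioc (0 : ℝ) 1) := by
    refine Measure.ext_of_Iic _ _ fun a => ?_
    rw [Measure.map_apply hmd measurableSet_Iic,
      Measure.restrict_apply (hmd measurableSet_Iic), Measure.smul_apply, smul_eq_mul,
      Measure.restrict_apply measurableSet_Iic]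
    have hms : MeasurableSet (bodyDist K ⁻¹' Iic a ∩ normalPair K ⁻¹' η) :=
      (hmd measurableSet_Iic).inter (hmn hη)
    have hset : (bodyDist K ⁻¹' Iic a ∩ normalPair K ⁻¹' η) ∩ collar K 1 =
        collar K (min a 1) ∩ normalPair K ⁻¹' η := by
      ext x
      simp only [collar, mem_inter_iff, mem_preimage, mem_Iic, mem_ofPred_eq, le_min_iff]
      tauto
    have hI : Iic a ∩ Ioc (0 : ℝ) 1 = Ioc 0 (min a 1) := by
      ext x
      simp only [mem_inter_iff, mem_Iic, mem_Ioc, le_min_iff]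
      tauto
    rw [hm, withDensity_apply _ hms, Measure.restrict_restrict hms, hset,
      ← coeffMeasure_apply K _ _ hη, hI]
    rcases le_or_gt a 0 with ha | ha
    · have : collar K (min a 1) = ∅ := by
        ext x
        simp only [collar, mem_ofPred_eq, mem_empty_iff_false, iff_false, not_and, not_le]
        intro hx
        exact lt_of_le_of_lt ((min_le_left _ _).trans ha) (bodyDist_pos_iff.2 hx)
      rw [coeffMeasure_apply K _ _ hη, this]
      simp [Ioc_eq_empty_of_le ((min_le_left a 1).trans ha)]
    · rw [coeffMeasure_one_scale hn K (lt_min ha one_pos) hη, Real.volume_Ioc, sub_zero, mul_comm]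
  have h2 := congrArg (fun ν => ν s) key
  simp only [Measure.map_apply hmd hs, Measure.restrict_apply (hmd hs), Measure.smul_apply,
    smul_eq_mul] at h2
  rw [mul_comm, ← h2]
  rfl

end

section

variable {n : ℕ}

/-! ### Support functions -/

/-- The support function of a convex body. -/
def suppFun (C : Body n) (u : E n) : ℝ := sSup ((fun c => inner ℝ c u) '' (C : Set (E n)))

theorem isGreatest_suppFun (C : Body n) (u : E n) :
    IsGreatest ((fun c => inner ℝ c u) '' (C : Set (E n))) (suppFun C u) :=
  (C.isCompact.image (by fun_prop)).isGreatest_sSup (C.nonempty.image _)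

theorem inner_le_suppFun {C : Body n} {c : E n} (hc : c ∈ C) (u : E n) :
    inner ℝ c u ≤ suppFun C u := (isGreatest_suppFun C u).2 ⟨c, hc, rfl⟩

theorem exists_inner_eq_suppFun (C : Body n) (u : E n) : ∃ c ∈ C, inner ℝ c u = suppFun C u :=
  (isGreatest_suppFun C u).1

theorem suppFun_le_iff {C : Body n} {u : E n} {a : ℝ} :
    suppFun C u ≤ a ↔ ∀ c ∈ C, inner ℝ c u ≤ a := by
  refine ⟨fun h c hc => (inner_le_suppFun hc u).trans h, fun h => ?_⟩
  obtain ⟨c, hc, hcu⟩ := exists_inner_eq_suppFun C u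
  exact hcu ▸ h c hc

theorem suppFun_nonneg {C : Body n} (hC : (0 : E n) ∈ C) (u : E n) : 0 ≤ suppFun C u := by
  simpa using inner_le_suppFun hC u

theorem suppFun_le_mul {C : Body n} {R : ℝ} (hR : (C : Set (E n)) ⊆ Metric.closedBall 0 R)
    (u : E n) : suppFun C u ≤ R * ‖u‖ :=
  suppFun_le_iff.2 fun c hc => (real_inner_le_norm _ _).trans (by
    gcongr; simpa using hR hc)

theorem continuous_suppFun (C : Body n) : Continuous (suppFun C) := by
  obtain ⟨R, hR⟩ := C.isBounded.subset_closedBall 0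
  have hR0 : 0 ≤ R := by
    obtain ⟨c, hc⟩ := C.nonempty
    exact (norm_nonneg c).trans (by simpa using hR hc)
  have key : ∀ u v : E n, suppFun C u ≤ suppFun C v + R * dist u v := by
    refine fun u v => suppFun_le_iff.2 fun c hc => ?_
    have h1 := inner_le_suppFun hc v
    have h2 := real_inner_le_norm c (u - v)
    have h3 : ‖c‖ * ‖u - v‖ ≤ R * ‖u - v‖ := by gcongr; simpa using hR hc
    rw [inner_sub_right] at h2
    rw [dist_eq_norm]
    linarith
  exact (LipschitzWith.of_le_add_mul ⟨R, hR0⟩ key).continuous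

/-! ### First order behaviour of dilations -/

theorem integral_image_normalScale (K : Body n) {s : ℝ} (hs : 0 < s) {B : Set (E n)}
    (hB : MeasurableSet B) (hBK : ∀ x ∈ B, x ∉ K) {f : E n → ℝ} (hf : Measurable f) :
    ∫ x in normalScale K s '' B, f x =
      ∫ x in B, scaleDet K s x * f (normalScale K s x) := by
  have hT : Measurable (normalScale K s) := (lipschitzWith_normalScale K s).continuous.measurable
  have hd := (measurable_scaleDet K s)
  have hmap : volume.restrict (normalScale K s '' B) =
      ((volume.restrict B).withDensity fun x => ENNReal.ofReal (scaleDet K s x)).map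
        (normalScale K s) := by
    ext A hA
    rw [Measure.map_apply hT hA, withDensity_apply _ (hT hA), ← lintegral_indicator (hT hA)]
    have h := lintegral_image_normalScale K hs hB hBK (A.indicator 1)
    rw [lintegral_indicator_one hA] at h
    rw [h]
    refine lintegral_congr fun x => ?_
    by_cases hx : normalScale K s x ∈ A
    · rw [indicator_of_mem hx, indicator_of_mem (by exact hx)]; simp
    · rw [indicator_of_notMem hx, indicator_of_notMem (by exact hx), mul_zero]
  rw [hmap, integral_map hT.aemeasurable hf.aestronglyMeasurable,
    integral_withDensity_eq_integral_toReal_smul hd.ennreal_ofReal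
      (Eventually.of_forall fun _ => ENNReal.ofReal_lt_top)]
  refine integral_congr_ae ?_
  filter_upwards [ae_restrict_mem hB, ae_restrict_of_ae (ae_differentiableAt_proj K)] with x hx hdx
  rw [ENNReal.toReal_ofReal (scaleDet_nonneg (hBK x hx) hdx hs.le), smul_eq_mul]

/-- Pull the collar of radius `t * R` back to the unit collar. The Jacobian divided by `t` is at
most `R` and tends to `R * scaleCoeff K 1 x`, so dominated convergence applies. Where this limit is
zero, boundedness of `F` suffices, so `G` matters only elsewhere. -/
theorem tendsto_integral_collar_div (K : Body n) {R : ℝ} (hR : 0 < R) {F : ℝ → E n → ℝ}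
    (hF : ∀ t, Measurable (F t)) {M : ℝ} (hM : ∀ t, ∀ x ∈ collar K 1,
      0 < t → t * R ≤ 1 → |F t (normalScale K (t * R) x)| ≤ M) {G : E n → ℝ}
    (hG : ∀ᵐ x ∂(volume.restrict (collar K 1)), scaleCoeff K 1 x ≠ 0 →
      Tendsto (fun t => F t (normalScale K (t * R) x)) (𝓝[>] 0) (𝓝 (G x))) :
    Tendsto (fun t => t⁻¹ * ∫ x in collar K (t * R), F t x) (𝓝[>] 0)
      (𝓝 (∫ x in collar K 1, R * scaleCoeff K 1 x * G x)) := by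
  have hpos : ∀ᶠ t : ℝ in 𝓝[>] 0, 0 < t := eventually_mem_nhdsWithin
  have hle : ∀ᶠ t : ℝ in 𝓝[>] 0, t * R ≤ 1 := by
    filter_upwards [Ioc_mem_nhdsGT (one_div_pos.2 hR)] with t ht
    exact (le_div_iff₀ hR).1 ht.2
  have hEq : ∀ᶠ t : ℝ in 𝓝[>] 0,
      ∫ x in collar K 1, (scaleDet K (t * R) x / t) * F t (normalScale K (t * R) x) =
        t⁻¹ * ∫ x in collar K (t * R), F t x := by
    filter_upwards [hpos] with t ht
    have h := integral_image_normalScale K (mul_pos ht hR) (measurableSet_collar K 1)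
      (fun x hx => hx.1) (hF t)
    rw [normalScale_image_collar K (mul_pos ht hR), mul_one] at h
    rw [h, ← integral_const_mul]
    exact integral_congr_ae (Eventually.of_forall fun x => by ring)
  refine Tendsto.congr' hEq ?_
  have hfin : IsFiniteMeasure (volume.restrict (collar K 1)) :=
    ⟨by simpa using volume_collar_lt_top K 1⟩
  refine tendsto_integral_filter_of_dominated_convergence (fun _ => R * |M|) ?_ ?_
    (integrable_const _) ?_
  · refine Eventually.of_forall fun t => Measurable.aestronglyMeasurable ?_
    exact ((measurable_scaleDet K _).div_const _).mul
      ((hF t).comp (lipschitzWith_normalScale K _).continuous.measurable)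
  · filter_upwards [hpos, hle] with t ht htR
    filter_upwards [ae_collar_differentiableAt K 1,
      ae_restrict_mem (measurableSet_collar K 1)] with x hx hxc
    have h0 := scaleDet_nonneg hx.1 hx.2 (mul_pos ht hR).le
    have h1 := scaleDet_le hx.1 hx.2 (mul_pos ht hR).le htR
    rw [norm_mul, Real.norm_eq_abs, Real.norm_eq_abs, abs_of_nonneg (div_nonneg h0 ht.le)]
    refine mul_le_mul ?_ ((hM t x hxc ht htR).trans (le_abs_self M)) (abs_nonneg _) hR.le
    rw [div_le_iff₀ ht]; linarith
  · filter_upwards [ae_collar_differentiableAt K 1, hG,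
      ae_restrict_mem (measurableSet_collar K 1)] with x hx hGx hxc
    have hlim : Tendsto (fun t => scaleDet K (t * R) x / t) (𝓝[>] 0)
        (𝓝 (R * scaleCoeff K 1 x)) := by
      have h1 : Tendsto (fun t : ℝ => t * R) (𝓝[>] 0) (𝓝[>] 0) := by
        refine tendsto_nhdsWithin_iff.2 ⟨?_, hpos.mono fun t ht => mul_pos ht hR⟩
        have : Tendsto (fun t : ℝ => t * R) (𝓝 0) (𝓝 (0 * R)) := (continuous_mul_const R).tendsto 0
        rw [zero_mul] at this
        exact this.mono_left nhdsWithin_le_nhds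
      refine (((tendsto_scaleDet_div hx.1 hx.2).comp h1).const_mul R).congr' ?_
      filter_upwards [hpos] with t ht
      simp only [Function.comp]
      field_simp
    by_cases h1 : scaleCoeff K 1 x = 0
    · rw [h1] at hlim ⊢
      simp only [mul_zero, zero_mul] at hlim ⊢
      refine hlim.zero_mul_isBoundedUnder_le ⟨M, ?_⟩
      rw [eventually_map]
      filter_upwards [hpos, hle] with t ht htR
      exact hM t x hxc ht htR
    · exact hlim.mul (hGx h1)

/-- If `c` attains the support function value `H`, then `ρ u = w + (ρ / H) c` with `w` tangential.
Since `ρ < H`, the second term is interior to `C`, so there is room to absorb the error with which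
`M` approximates `y + t w`. -/
theorem eventually_mem_add_smul {M : Set (E n)} {y u : E n} {C : Body n}
    (hC : (0 : E n) ∈ interior (C : Set (E n))) (hu : ‖u‖ = 1)
    (htan : ∀ w : E n, inner ℝ w u = 0 → ∀ δ > 0, ∀ᶠ t : ℝ in 𝓝[>] 0,
      ∃ m ∈ M, ‖m - (y + t • w)‖ ≤ t * δ) {ρ : ℝ} (hρ : 0 ≤ ρ) (hρC : ρ < suppFun C u) :
    ∀ᶠ t : ℝ in 𝓝[>] 0, y + (t * ρ) • u ∈ M + t • (C : Set (E n)) := by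
  obtain ⟨c, hc, hcu⟩ := exists_inner_eq_suppFun C u
  set H := suppFun C u with hH
  have hHpos : 0 < H := hρ.trans_lt hρC
  have hInt : (ρ / H) • c ∈ interior (C : Set (E n)) := by
    have h1 : ρ / H < 1 := (div_lt_one hHpos).2 hρC
    have := C.convex.combo_interior_self_mem_interior hC hc (a := 1 - ρ / H) (b := ρ / H)
      (by linarith) (by positivity) (by ring)
    simpa using this
  obtain ⟨δ, hδ, hball⟩ := Metric.mem_nhds_iff.1 (mem_interior_iff_mem_nhds.1 hInt)
  have hw : inner ℝ (ρ • u - (ρ / H) • c) u = 0 := by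
    rw [inner_sub_left, real_inner_smul_left, real_inner_smul_left, hcu,
      real_inner_self_eq_norm_sq, hu]
    field_simp
    ring
  filter_upwards [htan _ hw (δ / 2) (by positivity), eventually_mem_nhdsWithin] with t ht ht0
  obtain ⟨m, hm, hmt⟩ := ht
  have ht0' : 0 < t := ht0
  refine ⟨m, hm, t • ((ρ / H) • c - t⁻¹ • (m - (y + t • (ρ • u - (ρ / H) • c)))),
    smul_mem_smul_set (hball ?_), ?_⟩
  · rw [Metric.mem_ball, dist_eq_norm, sub_sub_cancel_left, norm_neg, norm_smul, norm_inv,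
      Real.norm_of_nonneg ht0'.le, inv_mul_lt_iff₀ ht0']
    refine hmt.trans_lt ?_
    gcongr
    linarith
  · simp only [smul_sub, smul_smul, mul_inv_cancel₀ ht0'.ne', one_smul]
    module

/-- A tangential `w` is the derivative of the projection in some direction `v`. Density gives points
`x + t b` with `b` close to `v` whose projections lie in `L`; these projections are close to `proj K
x + t w`. -/
theorem tangent_of_density {K : Body n} {L : Set (E n)} {x : E n} (hx : x ∉ K)
    (hd : DifferentiableAt ℝ (proj K) x) (h1 : scaleCoeff K 1 x ≠ 0)
    (hdens : Tendsto (fun r => volume (proj K ⁻¹' L ∩ Metric.closedBall x r) /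
      volume (Metric.closedBall x r)) (𝓝[>] 0) (𝓝 1)) {w : E n}
    (hw : inner ℝ w (x - proj K x) = 0) {δ : ℝ} (hδ : 0 < δ) :
    ∀ᶠ t : ℝ in 𝓝[>] 0, ∃ m ∈ (K : Set (E n)) ∩ L, ‖m - (proj K x + t • w)‖ ≤ t * δ := by
  obtain ⟨v, hv⟩ := exists_fderiv_proj_eq hx hd h1 hw
  have e1 := Measure.eventually_nonempty_inter_smul_of_density_one volume _ x hdens
    (Metric.closedBall v (δ / 2)) measurableSet_closedBall
    (Metric.measure_closedBall_pos volume v (half_pos hδ)).ne'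
  have e2 : Tendsto (fun t : ℝ => t⁻¹ • (proj K (x + t • v) - proj K x)) (𝓝[>] 0) (𝓝 w) := by
    have : HasDerivAt (fun t : ℝ => proj K (x + t • v)) (fderiv ℝ (proj K) x v) 0 :=
      hd.hasFDerivAt.hasLineDerivAt v
    rw [hv] at this
    have h2 := this.tendsto_slope_zero
    simp only [zero_add, zero_smul, add_zero] at h2
    exact h2.mono_left (nhdsWithin_mono _ fun t ht => (mem_Ioi.1 ht).ne')
  filter_upwards [e1, e2 (Metric.closedBall_mem_nhds w (half_pos hδ)),
    eventually_mem_nhdsWithin] with t ht ht2 ht0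
  have ht0' : 0 < t := ht0
  obtain ⟨z, hzL, hz⟩ := ht
  rw [singleton_add] at hz
  obtain ⟨-, ⟨b, hb, rfl⟩, rfl⟩ := hz
  refine ⟨proj K (x + t • b), ⟨proj_mem K _, hzL⟩, ?_⟩
  have h3 : ‖proj K (x + t • b) - proj K (x + t • v)‖ ≤ t * (δ / 2) := by
    refine (norm_proj_sub_le K _ _).trans ?_
    rw [add_sub_add_left_eq_sub, ← smul_sub, norm_smul, Real.norm_of_nonneg ht0'.le]
    gcongr
    simpa [dist_eq_norm] using hb
  have h4 : ‖proj K (x + t • v) - (proj K x + t • w)‖ ≤ t * (δ / 2) := by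
    have : proj K (x + t • v) - (proj K x + t • w) =
        t • (t⁻¹ • (proj K (x + t • v) - proj K x) - w) := by
      rw [smul_sub, smul_smul, mul_inv_cancel₀ ht0'.ne', one_smul]; abel
    rw [this, norm_smul, Real.norm_of_nonneg ht0'.le]
    gcongr
    simpa [dist_eq_norm] using ht2
  calc ‖proj K (x + t • b) - (proj K x + t • w)‖
      ≤ ‖proj K (x + t • b) - proj K (x + t • v)‖ +
        ‖proj K (x + t • v) - (proj K x + t • w)‖ := norm_sub_le_norm_sub_add_norm_sub _ _ _
    _ ≤ t * δ := by linarith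

theorem norm_coe_sph (u : Sph n) : ‖(u : E n)‖ = 1 := norm_eq_of_mem_sphere u

/-- The bodies used to probe surfaces: they contain `0` in the interior. -/
def IsProbe (C : Body n) : Prop := (0 : E n) ∈ interior (C : Set (E n))

theorem IsProbe.zero_mem {C : Body n} (hC : IsProbe C) : (0 : E n) ∈ C := interior_subset hC

theorem exists_subset_closedBall (C : Body n) :
    ∃ R : ℝ, 0 < R ∧ (C : Set (E n)) ⊆ Metric.closedBall 0 R := by
  obtain ⟨R, hR⟩ := C.isBounded.subset_closedBall 0
  exact ⟨max R 1, by positivity, hR.trans (Metric.closedBall_subset_closedBall (le_max_left _ _))⟩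

variable [Nonempty (Sph n)]

theorem normalScale_eq {K : Body n} {x : E n} (hx : x ∉ K) (s : ℝ) :
    normalScale K s x = proj K x + (s * bodyDist K x) • (outerNormal K x : E n) := by
  rw [normalScale, mul_smul, bodyDist_smul_outerNormal hx]

/-- Almost every point that projects into `L` is a density point of `proj K ⁻¹' L`. With `L = univ`
this concerns `K` alone; with another body it controls `K ∩ L`. -/
theorem ae_eventually_normalScale_mem (K : Body n) {L : Set (E n)} (hL : IsClosed L) {C : Body n}
    (hC : (0 : E n) ∈ interior (C : Set (E n))) {R : ℝ} (hR : 0 < R) :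
    ∀ᵐ x ∂(volume.restrict (collar K 1)), scaleCoeff K 1 x ≠ 0 → proj K x ∈ L →
      R * bodyDist K x < suppFun C (outerNormal K x) →
      ∀ᶠ t : ℝ in 𝓝[>] 0, normalScale K (t * R) x ∈ ((K : Set (E n)) ∩ L) + t • (C : Set (E n)) := by
  have hY : MeasurableSet (proj K ⁻¹' L) := (hL.preimage (continuous_proj K)).measurableSet
  have hdens := Besicovitch.ae_tendsto_measure_inter_div (volume : Measure (E n)) (proj K ⁻¹' L)
  rw [ae_restrict_iff' hY] at hdens
  filter_upwards [ae_collar_differentiableAt K 1, ae_restrict_of_ae hdens] with x hx hxd h1 hxL hlt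
  have hpos := bodyDist_pos_iff.2 hx.1
  have := eventually_mem_add_smul (M := (K : Set (E n)) ∩ L) (y := proj K x) hC
    (norm_coe_sph (outerNormal K x)) (fun w hw δ hδ => ?_) (by positivity) hlt
  · filter_upwards [this] with t ht
    rw [normalScale_eq hx.1, mul_assoc]
    exact ht
  · refine tangent_of_density hx.1 hx.2 h1 (hxd hxL) ?_ hδ
    rw [← bodyDist_smul_outerNormal hx.1, real_inner_smul_right, hw, mul_zero]

/-- With `u` the outer normal at `x`, `K + tC` lies in the half-space of height `t h_C(u)` above the
supporting hyperplane at `proj K x`, while the scaled point has height `t R d(K, x)`. -/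
theorem normalScale_notMem_add_smul {K : Body n} {x : E n} (hx : x ∉ K) {C : Body n} {R t : ℝ}
    (ht : 0 < t) (hlt : suppFun C (outerNormal K x) < R * bodyDist K x) :
    normalScale K (t * R) x ∉ (K : Set (E n)) + t • (C : Set (E n)) := by
  rintro ⟨k, hk, -, ⟨c, hc, rfl⟩, h⟩
  have h1 := (isMetricProj_proj K x).inner_nonpos hk
  rw [← bodyDist_smul_outerNormal hx, real_inner_smul_left] at h1
  have hpos := bodyDist_pos_iff.2 hx
  have h2 : inner ℝ (outerNormal K x : E n) (k - proj K x) ≤ 0 := by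
    by_contra! h'
    exact absurd h1 (not_le.2 (mul_pos hpos h'))
  have h3 : (k - proj K x) + t • c = (t * R * bodyDist K x) • (outerNormal K x : E n) := by
    have h' : k + t • c = normalScale K (t * R) x := h
    rw [normalScale_eq hx] at h'
    rw [sub_add_eq_add_sub, h', add_sub_cancel_left]
  have h4 := congrArg (inner ℝ (outerNormal K x : E n)) h3
  rw [inner_add_right, real_inner_smul_right, real_inner_smul_right, real_inner_self_eq_norm_sq,
    norm_coe_sph] at h4
  have h5 := inner_le_suppFun hc (outerNormal K x : E n)
  have h6 : t * inner ℝ c (outerNormal K x : E n) < t * (R * bodyDist K x) := by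
    gcongr; linarith
  rw [real_inner_comm] at h6
  linarith

/-- The distance is uniform given the normal pair, so it avoids the single critical value `h_C(u) /
R` almost surely. -/
theorem ae_suppFun_ne (hn : 0 < n) (K C : Body n) {R : ℝ} (hR : 0 < R) :
    ∀ᵐ x ∂(volume.restrict (collar K 1)), scaleCoeff K 1 x ≠ 0 →
      R * bodyDist K x ≠ suppFun C (outerNormal K x) := by
  set N : Set (ℝ × (E n × Sph n)) := {z | R * z.1 = suppFun C z.2.2} with hN
  have hNm : MeasurableSet N := measurableSet_eq_fun (by fun_prop)
    ((continuous_suppFun C).measurable.comp (by fun_prop))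
  have h0 : ((volume.restrict (Ioc (0 : ℝ) 1)).prod (surfMeasure K)) N = 0 := by
    rw [Measure.prod_apply_symm hNm, lintegral_eq_zero_iff]
    · refine Eventually.of_forall fun z => ?_
      refine measure_mono_null (t := {suppFun C z.2 / R}) ?_ (by simp)
      intro ρ hρ
      have hρ' : R * ρ = suppFun C z.2 := hρ
      rw [mem_singleton_iff, ← hρ']
      field_simp
    · exact measurable_measure_prodMk_right hNm
  have hmeas : Measurable fun x => (bodyDist K x, normalPair K x) :=
    (continuous_bodyDist K).measurable.prodMk (measurable_normalPair K)
  rw [← map_bodyDist_normalPair hn, Measure.map_apply hmeas hNm,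
    withDensity_apply_eq_zero (measurable_scaleCoeff K 1).ennreal_ofReal] at h0
  have h0' := measure_eq_zero_iff_ae_notMem.1 h0
  filter_upwards [h0', ae_collar_differentiableAt K 1] with x hx hxc h1 heq
  refine hx ⟨?_, heq⟩
  have := scaleCoeff_nonneg hxc.1 hxc.2 1
  simpa using lt_of_le_of_ne this (Ne.symm h1)

end

/-! ### The first variation of dilations and the gap between two bodies -/

section

variable {n : ℕ}

/-- The difference quotient at `0` of `t ↦ ∫ h` over `A + t C`. -/
def dilationQuot (h : E n → ℝ) (C : Body n) (A : Set (E n)) (t : ℝ) : ℝ :=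
  t⁻¹ * ((∫ x in A + t • (C : Set (E n)), h x) - ∫ x in A, h x)

theorem subset_add_smul {C : Body n} (hC : (0 : E n) ∈ C) (A : Set (E n)) (t : ℝ) :
    A ⊆ A + t • (C : Set (E n)) := fun a ha =>
  ⟨a, ha, 0, ⟨0, hC, smul_zero t⟩, add_zero a⟩

theorem isCompact_add_smul {A : Set (E n)} (hA : IsCompact A) (C : Body n) (t : ℝ) :
    IsCompact (A + t • (C : Set (E n))) := hA.add (C.isCompact.smul t)

theorem setIntegral_sub_eq_diff {h : E n → ℝ} (hh : Continuous h) {A B : Set (E n)}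
    (hA : IsCompact A) (hB : IsCompact B) (hAB : A ⊆ B) :
    (∫ x in B, h x) - ∫ x in A, h x = ∫ x in B \ A, h x := by
  rw [setIntegral_sdiff hA.measurableSet (hh.continuousOn.integrableOn_compact hB) hAB]

theorem add_smul_subset_closedBall {C : Body n} {R : ℝ}
    (hCR : (C : Set (E n)) ⊆ Metric.closedBall 0 R) {t : ℝ} (ht : 0 ≤ t) (A : Set (E n)) :
    A + t • (C : Set (E n)) ⊆ A + Metric.closedBall (0 : E n) (t * R) := by
  rintro _ ⟨a, ha, _, ⟨c, hc, rfl⟩, rfl⟩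
  refine ⟨a, ha, t • c, ?_, rfl⟩
  have : ‖c‖ ≤ R := by simpa using hCR hc
  rw [mem_closedBall_zero_iff, norm_smul, Real.norm_of_nonneg ht]
  gcongr

theorem add_smul_diff_subset_collar {K C : Body n} {R : ℝ}
    (hCR : (C : Set (E n)) ⊆ Metric.closedBall 0 R) {t : ℝ} (ht : 0 ≤ t) :
    ((K : Set (E n)) + t • (C : Set (E n))) \ K ⊆ collar K (t * R) := fun _ hx =>
  ⟨hx.2, bodyDist_le_iff.2 (add_smul_subset_closedBall hCR ht _ hx.1)⟩

theorem volume_collar_mul_le (K : Body n) {s : ℝ} (hs : 0 < s) (hs1 : s ≤ 1) (R : ℝ) :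
    volume (collar K (s * R)) ≤ ENNReal.ofReal s * volume (collar K R) := by
  have h := lintegral_image_normalScale K hs (measurableSet_collar K R) (fun x hx => hx.1) 1
  rw [normalScale_image_collar K hs] at h
  simp only [Pi.one_apply, lintegral_one, Measure.restrict_apply_univ, mul_one] at h
  rw [h, ← setLIntegral_const]
  refine lintegral_mono_ae ?_
  filter_upwards [ae_collar_differentiableAt K R] with x hx
  exact ENNReal.ofReal_le_ofReal (scaleDet_le hx.1 hx.2 hs.le hs1)

/-- The points near `A` and `B` that are not near `A ∩ B`. -/
def gapSet (C : Body n) (A B : Set (E n)) (t : ℝ) : Set (E n) :=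
  ((A + t • (C : Set (E n))) ∩ (B + t • (C : Set (E n)))) \ ((A ∩ B) + t • (C : Set (E n)))

theorem measurableSet_gapSet (C : Body n) {A B : Set (E n)} (hA : IsCompact A) (hB : IsCompact B)
    (t : ℝ) : MeasurableSet (gapSet C A B t) :=
  ((isCompact_add_smul hA C t).measurableSet.inter (isCompact_add_smul hB C t).measurableSet).diff
    (isCompact_add_smul (hA.inter hB) C t).measurableSet

theorem gapSet_comm (C : Body n) (A B : Set (E n)) (t : ℝ) :
    gapSet C A B t = gapSet C B A t := by
  rw [gapSet, gapSet, inter_comm, inter_comm A B]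

variable [Nonempty (Sph n)]

/-- By Fubini the distance is uniform on `(0, 1]`, so the condition `R d < h_C(u)` has weight
`h_C(u) / R`. The inclusion of `C` in the ball of radius `R` ensures that this is at most `1`. -/
theorem integral_surfMeasure_mul_suppFun (hn : 0 < n) (K : Body n) {C : Body n} (hC : IsProbe C)
    {R : ℝ} (hR : 0 < R) (hCR : (C : Set (E n)) ⊆ Metric.closedBall 0 R) {h : E n → ℝ}
    (hh : Continuous h) :
    ∫ x in collar K 1, R * scaleCoeff K 1 x * (h (proj K x) *
        {x | R * bodyDist K x < suppFun C (outerNormal K x)}.indicator 1 x) =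
      ∫ z, h z.1 * suppFun C z.2 ∂surfMeasure K := by
  set S : Set (ℝ × (E n × Sph n)) := {z | R * z.1 < suppFun C z.2.2} with hS
  have hSm : MeasurableSet S := measurableSet_lt (by fun_prop)
    ((continuous_suppFun C).measurable.comp (by fun_prop))
  have hmeas : Measurable fun x => (bodyDist K x, normalPair K x) :=
    (continuous_bodyDist K).measurable.prodMk (measurable_normalPair K)
  set f : ℝ × (E n × Sph n) → ℝ := fun z => R * (h z.2.1 * S.indicator 1 z) with hf
  have hfm : Measurable f := by
    refine (Measurable.mul ?_ (measurable_const.indicator hSm)).const_mul R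
    exact hh.measurable.comp (by fun_prop)
  have h1 : ∫ x in collar K 1, R * scaleCoeff K 1 x * (h (proj K x) *
        {x | R * bodyDist K x < suppFun C (outerNormal K x)}.indicator 1 x) =
      ∫ z, f z ∂((volume.restrict (Ioc (0 : ℝ) 1)).prod (surfMeasure K)) := by
    rw [← map_bodyDist_normalPair hn, integral_map hmeas.aemeasurable hfm.aestronglyMeasurable,
      integral_withDensity_eq_integral_toReal_smul (measurable_scaleCoeff K 1).ennreal_ofReal
        (Eventually.of_forall fun _ => ENNReal.ofReal_lt_top)]
    refine integral_congr_ae ?_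
    filter_upwards [ae_collar_differentiableAt K 1] with x hx
    rw [ENNReal.toReal_ofReal (scaleCoeff_nonneg hx.1 hx.2 1), smul_eq_mul, hf]
    have : {x | R * bodyDist K x < suppFun C (outerNormal K x)}.indicator (1 : E n → ℝ) x =
        S.indicator 1 (bodyDist K x, normalPair K x) := rfl
    rw [this]
    simp only [normalPair]
    ring
  have hfi : Integrable f ((volume.restrict (Ioc (0 : ℝ) 1)).prod (surfMeasure K)) := by
    obtain ⟨M, hM⟩ := K.isCompact.exists_bound_of_continuousOn hh.continuousOn
    refine Integrable.of_bound hfm.aestronglyMeasurable (R * M) ?_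
    have : ∀ᵐ z ∂((volume.restrict (Ioc (0 : ℝ) 1)).prod (surfMeasure K)), z.2.1 ∈ K :=
      Measure.quasiMeasurePreserving_snd.ae (ae_surfMeasure_mem K)
    filter_upwards [this] with z hz
    have h2 := hM _ hz
    have hM0 : 0 ≤ M := (norm_nonneg _).trans h2
    rw [hf]
    simp only [norm_mul, Real.norm_of_nonneg hR.le]
    gcongr
    calc ‖h z.2.1‖ * ‖S.indicator (1 : ℝ × (E n × Sph n) → ℝ) z‖ ≤ M * 1 := by
          gcongr
          by_cases hz : z ∈ S <;> simp [hz]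
      _ = M := mul_one M
  rw [h1, integral_prod_symm _ hfi]
  refine integral_congr_ae (Eventually.of_forall fun z => ?_)
  have hH0 : 0 ≤ suppFun C z.2 := suppFun_nonneg hC.zero_mem _
  have hHR : suppFun C z.2 ≤ R := by
    simpa [norm_coe_sph] using suppFun_le_mul hCR (z.2 : E n)
  have h2 : ∀ ρ : ℝ, f (ρ, z) = (R * h z.1) * (Iio (suppFun C z.2 / R)).indicator 1 ρ := by
    intro ρ
    have : S.indicator (1 : ℝ × (E n × Sph n) → ℝ) (ρ, z) = (Iio (suppFun C z.2 / R)).indicator 1 ρ := by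
      simp only [indicator_apply, hS, mem_ofPred_eq, mem_Iio, lt_div_iff₀ hR, mul_comm R ρ,
        Pi.one_apply]
    rw [hf]
    simp only [this]
    ring
  simp only [h2]
  rw [integral_const_mul, integral_indicator_one measurableSet_Iio, measureReal_restrict_apply
    measurableSet_Iio]
  have h3 : volume.real (Iio (suppFun C z.2 / R) ∩ Ioc 0 1) = suppFun C z.2 / R := by
    have hle : suppFun C z.2 / R ≤ 1 := (div_le_one hR).2 hHR
    have : Iio (suppFun C z.2 / R) ∩ Ioc 0 1 = Ioo 0 (suppFun C z.2 / R) := by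
      ext ρ
      simp only [mem_inter_iff, mem_Iio, mem_Ioc, mem_Ioo]
      constructor
      · rintro ⟨h, h', -⟩; exact ⟨h', h⟩
      · rintro ⟨h, h'⟩; exact ⟨h', h, h'.le.trans hle⟩
    rw [this, Real.volume_real_Ioo_of_le (by positivity), sub_zero]
  rw [h3]
  field_simp

/-- The first variation of `∫ h` over `K + t C`. -/
theorem tendsto_dilationQuot_body (hn : 0 < n) (K : Body n) {C : Body n} (hC : IsProbe C)
    {h : E n → ℝ} (hh : Continuous h) :
    Tendsto (dilationQuot h C K) (𝓝[>] 0)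
      (𝓝 (∫ z, h z.1 * suppFun C z.2 ∂surfMeasure K)) := by
  obtain ⟨R, hR, hCR⟩ := exists_subset_closedBall C
  rw [← integral_surfMeasure_mul_suppFun hn K hC hR hCR hh]
  have hpos : ∀ᶠ t : ℝ in 𝓝[>] 0, 0 < t := eventually_mem_nhdsWithin
  have hmeas : ∀ t : ℝ, MeasurableSet ((K : Set (E n)) + t • (C : Set (E n))) := fun t =>
    (isCompact_add_smul K.isCompact C t).measurableSet
  obtain ⟨M, hM⟩ := (K.isCompact.add (isCompact_closedBall (0 : E n) 1)).exists_bound_of_continuousOn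
    hh.continuousOn
  have key := tendsto_integral_collar_div K hR
    (F := fun t => ((K : Set (E n)) + t • (C : Set (E n))).indicator h) (M := M)
    (fun t => hh.measurable.indicator (hmeas t)) ?_
    (G := fun x => h (proj K x) *
        {x | R * bodyDist K x < suppFun C (outerNormal K x)}.indicator 1 x) ?_
  · refine key.congr' ?_
    filter_upwards [hpos] with t ht
    rw [dilationQuot, setIntegral_sub_eq_diff hh K.isCompact (isCompact_add_smul K.isCompact C t)
      (subset_add_smul hC.zero_mem _ _), setIntegral_indicator (hmeas t)]
    congr 3
    ext x
    constructor
    · rintro ⟨h1, h2⟩; exact ⟨h2, h1.1⟩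
    · intro hx; exact ⟨add_smul_diff_subset_collar hCR ht.le hx, hx.1⟩
  · intro t x hx ht htR
    have hx' : normalScale K (t * R) x ∈ collar K (t * R * 1) := by
      rw [← normalScale_image_collar K (mul_pos ht hR)]; exact mem_image_of_mem _ hx
    have hmem : normalScale K (t * R) x ∈ (K : Set (E n)) + Metric.closedBall (0 : E n) 1 := by
      rw [← bodyDist_le_iff]
      exact hx'.2.trans (by linarith)
    exact (norm_indicator_le_norm_self h _).trans (hM _ hmem)
  -- According to the sign of `h_C(u) - R d`, the scaled point is eventually inside `K + tC` or
  -- always outside; equality is negligible.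
  · filter_upwards [ae_eventually_normalScale_mem K isClosed_univ hC hR, ae_suppFun_ne hn K C hR,
      ae_collar_differentiableAt K 1] with x hx1 hx2 hx h1
    have hT : Tendsto (fun t : ℝ => normalScale K (t * R) x) (𝓝[>] 0) (𝓝 (proj K x)) := by
      have : Continuous fun t : ℝ => normalScale K (t * R) x := by unfold normalScale; fun_prop
      have h := this.tendsto 0
      simp only [normalScale, zero_mul, zero_smul, add_zero] at h
      exact h.mono_left nhdsWithin_le_nhds
    rcases lt_or_gt_of_ne (hx2 h1) with hlt | hgt
    · have h3 := hx1 h1 (mem_univ _) hlt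
      rw [indicator_of_mem (by exact hlt), Pi.one_apply, mul_one]
      refine ((hh.tendsto _).comp hT).congr' ?_
      filter_upwards [h3] with t ht
      rw [inter_univ] at ht
      rw [indicator_of_mem ht, Function.comp]
    · rw [indicator_of_notMem (by simpa using hgt.le), mul_zero]
      refine tendsto_const_nhds.congr' ?_
      filter_upwards [hpos] with t ht
      rw [indicator_of_notMem (normalScale_notMem_add_smul hx.1 ht hgt)]

/-- Project to `K`. If the foot point is not in `L`, the scaled point is eventually outside `L +
tC`. If it is in `L`, density points put the scaled point in `(K ∩ L) + tC` whenever it is low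
enough, and otherwise it is outside `K + tC`. In every case it leaves the gap, apart from points
that carry no weight in the limit. -/
theorem tendsto_volume_gapSet_diff (hn : 0 < n) (K L : Body n) {C : Body n} (hC : IsProbe C) :
    Tendsto (fun t => t⁻¹ * volume.real (gapSet C K L t \ K)) (𝓝[>] 0) (𝓝 0) := by
  obtain ⟨R, hR, hCR⟩ := exists_subset_closedBall C
  have hpos : ∀ᶠ t : ℝ in 𝓝[>] 0, 0 < t := eventually_mem_nhdsWithin
  have hmeas := measurableSet_gapSet C K.isCompact L.isCompact
  have key := tendsto_integral_collar_div K hR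
    (F := fun t => (gapSet C K L t).indicator 1) (M := 1)
    (fun t => measurable_one.indicator (hmeas t)) ?_ (G := 0) ?_
  · simp only [Pi.zero_apply, mul_zero, integral_zero] at key
    refine key.congr' ?_
    filter_upwards [hpos] with t ht
    rw [setIntegral_indicator (hmeas t)]
    simp only [Pi.one_apply, integral_const, smul_eq_mul, mul_one, measureReal_restrict_apply_univ]
    congr 2
    ext x
    constructor
    · rintro ⟨h1, h2⟩; exact ⟨h2, h1.1⟩
    · intro hx; exact ⟨add_smul_diff_subset_collar hCR ht.le ⟨hx.1.1.1, hx.2⟩, hx.1⟩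
  · intro t x _ _ _
    by_cases h : normalScale K (t * R) x ∈ gapSet C K L t <;> simp [h]
  · filter_upwards [ae_eventually_normalScale_mem K L.isClosed hC hR, ae_suppFun_ne hn K C hR,
      ae_collar_differentiableAt K 1] with x hx1 hx2 hx h1
    suffices h : ∀ᶠ t : ℝ in 𝓝[>] 0, normalScale K (t * R) x ∉ gapSet C K L t by
      refine tendsto_const_nhds.congr' ?_
      filter_upwards [h] with t ht
      rw [indicator_of_notMem ht, Pi.zero_apply]
    rcases lt_or_gt_of_ne (hx2 h1) with hlt | hgt
    · by_cases hL : proj K x ∈ (L : Set (E n))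
      · filter_upwards [hx1 h1 hL hlt] with t ht hg
        exact hg.2 ht
      · obtain ⟨ε, hε, hball⟩ := Metric.isOpen_iff.1 L.isClosed.isOpen_compl _ hL
        have hpos' : 0 < R * bodyDist K x + R :=
          add_pos_of_nonneg_of_pos (mul_nonneg hR.le (bodyDist_nonneg K x)) hR
        filter_upwards [Ioo_mem_nhdsGT (div_pos hε hpos')] with t ht hg
        obtain ⟨l, hl, -, ⟨c, hc, rfl⟩, hlc⟩ := hg.1.2
        refine hball ?_ hl
        have hlc' : l + t • c = normalScale K (t * R) x := hlc
        have h4 : l - proj K x = (t * R) • (x - proj K x) - t • c := by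
          rw [normalScale] at hlc'
          rw [eq_sub_iff_add_eq, sub_add_eq_add_sub, hlc', add_sub_cancel_left]
        have hcR : ‖c‖ ≤ R := by simpa using hCR hc
        rw [Metric.mem_ball, dist_eq_norm, h4]
        refine (norm_sub_le _ _).trans_lt ?_
        rw [norm_smul, norm_smul, Real.norm_of_nonneg (mul_pos ht.1 hR).le,
          Real.norm_of_nonneg ht.1.le]
        have h5 := (lt_div_iff₀ hpos').1 ht.2
        have h6 : t * ‖c‖ ≤ t * R := mul_le_mul_of_nonneg_left hcR ht.1.le
        rw [bodyDist] at h5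
        linarith
    · filter_upwards [hpos] with t ht hg
      exact normalScale_notMem_add_smul hx.1 ht hgt hg.1.1

/-- Since `0 ∈ C`, no point of `K ∩ L` lies in the gap, so the gap is covered by its parts outside
`K` and outside `L`. -/
theorem tendsto_volume_gapSet_body (hn : 0 < n) (K L : Body n) {C : Body n} (hC : IsProbe C) :
    Tendsto (fun t => t⁻¹ * volume.real (gapSet C K L t)) (𝓝[>] 0) (𝓝 0) := by
  have h := (tendsto_volume_gapSet_diff hn K L hC).add (tendsto_volume_gapSet_diff hn L K hC)
  rw [add_zero] at h
  have hpos : ∀ᶠ t : ℝ in 𝓝[>] 0, 0 < t := eventually_mem_nhdsWithin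
  refine tendsto_of_tendsto_of_tendsto_of_le_of_le' tendsto_const_nhds h ?_ ?_
  · filter_upwards [hpos] with t ht
    positivity
  · filter_upwards [hpos] with t ht
    rw [← mul_add]
    gcongr
    rw [gapSet_comm C L K]
    have hfin : ∀ B : Set (E n), volume (gapSet C K L t \ B) ≠ ∞ := fun B =>
      ((measure_mono (fun x hx => hx.1.1.1)).trans_lt
        (isCompact_add_smul K.isCompact C t).measure_lt_top).ne
    refine le_trans (measureReal_mono ?_ ?_) (measureReal_union_le _ _)
    · intro x hx
      by_cases hK : x ∈ (K : Set (E n))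
      · refine Or.inr ⟨hx, fun hL => hx.2 ?_⟩
        exact subset_add_smul hC.zero_mem _ _ ⟨hK, hL⟩
      · exact Or.inl ⟨hx, hK⟩
    · exact (measure_union_lt_top (hfin _).lt_top (hfin _).lt_top).ne

end

section

variable {n : ℕ}

/-! ### Density of differences of support functions -/

theorem suppFun_add (A B : Body n) (u : E n) : suppFun (A + B) u = suppFun A u + suppFun B u := by
  refine le_antisymm (suppFun_le_iff.2 ?_) ?_
  · rintro _ ⟨a, ha, b, hb, rfl⟩
    dsimp only
    rw [inner_add_left]
    exact add_le_add (inner_le_suppFun ha u) (inner_le_suppFun hb u)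
  · obtain ⟨a, ha, hau⟩ := exists_inner_eq_suppFun A u
    obtain ⟨b, hb, hbu⟩ := exists_inner_eq_suppFun B u
    rw [← hau, ← hbu, ← inner_add_left]
    exact inner_le_suppFun (show a + b ∈ A + B from ⟨a, ha, b, hb, rfl⟩) u

theorem IsProbe.add {A B : Body n} (hA : IsProbe A) (hB : IsProbe B) : IsProbe (A + B) := by
  refine interior_mono (s := (A : Set (E n))) (fun a ha => ?_) hA
  exact ⟨a, ha, 0, hB.zero_mem, add_zero a⟩

/-- The closed convex hull of the union of two convex bodies. -/
def joinBody (A B : Body n) : Body n where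
  carrier := closure (convexHull ℝ ((A : Set (E n)) ∪ B))
  convex' := (convex_convexHull ℝ _).closure
  isCompact' := Metric.isCompact_of_isClosed_isBounded isClosed_closure
    (isBounded_convexHull.2 (A.isBounded.union B.isBounded)).closure
  nonempty' := (A.nonempty.mono ((subset_union_left.trans (subset_convexHull ℝ _)).trans
    subset_closure))

theorem union_subset_joinBody (A B : Body n) :
    (A : Set (E n)) ∪ B ⊆ joinBody A B := (subset_convexHull ℝ _).trans subset_closure

theorem suppFun_joinBody (A B : Body n) (u : E n) :
    suppFun (joinBody A B) u = max (suppFun A u) (suppFun B u) := by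
  refine le_antisymm (suppFun_le_iff.2 ?_) (max_le ?_ ?_)
  · have hcl : IsClosed {c : E n | inner ℝ c u ≤ max (suppFun A u) (suppFun B u)} :=
      isClosed_le (by fun_prop) continuous_const
    have hconv : Convex ℝ {c : E n | inner ℝ c u ≤ max (suppFun A u) (suppFun B u)} :=
      convex_halfSpace_le ⟨fun x y => inner_add_left x y u,
        fun c x => real_inner_smul_left x u c⟩ _
    refine fun c hc => closure_minimal (convexHull_min ?_ hconv) hcl hc
    rintro c (hc | hc)
    · exact (inner_le_suppFun hc u).trans (le_max_left _ _)
    · exact (inner_le_suppFun hc u).trans (le_max_right _ _)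
  · exact suppFun_le_iff.2 fun c hc => inner_le_suppFun (union_subset_joinBody A B (Or.inl hc)) u
  · exact suppFun_le_iff.2 fun c hc => inner_le_suppFun (union_subset_joinBody A B (Or.inr hc)) u

theorem IsProbe.join {A B : Body n} (hA : IsProbe A) : IsProbe (joinBody A B) :=
  interior_mono (fun _ ha => union_subset_joinBody A B (Or.inl ha)) hA

/-- A closed ball as a convex body. -/
def ballBody (w : E n) {ρ : ℝ} (hρ : 0 ≤ ρ) : Body n where
  carrier := Metric.closedBall w ρ
  convex' := convex_closedBall w ρ
  isCompact' := isCompact_closedBall w ρ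
  nonempty' := ⟨w, Metric.mem_closedBall_self hρ⟩

theorem suppFun_ballBody (w : E n) {ρ : ℝ} (hρ : 0 ≤ ρ) (u : Sph n) :
    suppFun (ballBody w hρ) u = inner ℝ w (u : E n) + ρ := by
  have hu := norm_coe_sph u
  refine le_antisymm (suppFun_le_iff.2 fun c hc => ?_) ?_
  · have h1 : ‖c - w‖ ≤ ρ := by
      simpa [dist_eq_norm] using (show c ∈ Metric.closedBall w ρ from hc)
    have h2 := real_inner_le_norm (c - w) (u : E n)
    rw [hu, mul_one, inner_sub_left] at h2
    linarith
  · have : w + ρ • (u : E n) ∈ ballBody w hρ := by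
      change w + ρ • (u : E n) ∈ Metric.closedBall w ρ
      simp [norm_smul, hu, abs_of_nonneg hρ]
    refine le_trans (le_of_eq ?_) (inner_le_suppFun this (u : E n))
    rw [inner_add_left, real_inner_smul_left, real_inner_self_eq_norm_sq, hu]
    ring

theorem isProbe_ballBody {w : E n} {ρ : ℝ} (hρ : 0 ≤ ρ) (h : ‖w‖ < ρ) : IsProbe (ballBody w hρ) :=
  interior_maximal Metric.ball_subset_closedBall Metric.isOpen_ball (by simpa using h)

/-- Differences of support functions form a lattice that contains the restrictions of affine
functions, hence interpolates any two values; the lattice version of Stone–Weierstrass applies. -/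
theorem exists_suppFun_sub_suppFun_near (g : C(Sph n, ℝ)) {ε : ℝ} (hε : 0 < ε) :
    ∃ C C' : Body n, IsProbe C ∧ IsProbe C' ∧
      ∀ u : Sph n, |g u - (suppFun C u - suppFun C' u)| ≤ ε := by
  set L : Set C(Sph n, ℝ) := {f | ∃ C C' : Body n, IsProbe C ∧ IsProbe C' ∧
    ∀ u : Sph n, f u = suppFun C u - suppFun C' u} with hL
  -- A ball centered at `w` minus a ball centered at `0`; the radii differ by `c` and are large
  -- enough for `0` to be interior to both.
  have haff : ∀ (w : E n) (c : ℝ), ∃ f ∈ L, ∀ u : Sph n, f u = inner ℝ w (u : E n) + c := by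
    intro w c
    have h1 : 0 ≤ ‖w‖ + 1 + |c| := by positivity
    have h2 : 0 < ‖w‖ + 1 + |c| - c := by linarith [norm_nonneg w, le_abs_self c]
    refine ⟨⟨fun u => inner ℝ w (u : E n) + c, by fun_prop⟩, ⟨ballBody w h1, ballBody 0 h2.le,
      isProbe_ballBody _ (by linarith [abs_nonneg c]), isProbe_ballBody _ (by simpa using h2),
      fun u => ?_⟩, fun u => rfl⟩
    rw [suppFun_ballBody, suppFun_ballBody, inner_zero_left]
    simp only [ContinuousMap.coe_mk]
    ring
  have hcl : closure L = ⊤ := by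
    refine ContinuousMap.sublattice_closure_eq_top L ?_ ?_ ?_ ?_
    · obtain ⟨f, hf, -⟩ := haff 0 0
      exact ⟨f, hf⟩
    -- Uses `min(a - a', b - b') = (a + b) - max(a' + b, b' + a)`: sums are Minkowski sums and
    -- maxima are convex hulls of unions.
    · rintro f ⟨A, A', hA, hA', hf⟩ g ⟨B, B', hB, hB', hg⟩
      refine ⟨A + B, joinBody (A' + B) (B' + A), hA.add hB, (hA'.add hB).join, fun u => ?_⟩
      rw [ContinuousMap.inf_apply, hf, hg, suppFun_joinBody, suppFun_add, suppFun_add, suppFun_add]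
      rcases le_total (suppFun A' u + suppFun B u) (suppFun B' u + suppFun A u) with h | h
      · rw [max_eq_right h, inf_eq_right.2 (by linarith)]; ring
      · rw [max_eq_left h, inf_eq_left.2 (by linarith)]; ring
    · rintro f ⟨A, A', hA, hA', hf⟩ g ⟨B, B', hB, hB', hg⟩
      refine ⟨joinBody (A + B') (B + A'), A' + B', (hA.add hB').join, hA'.add hB', fun u => ?_⟩
      rw [ContinuousMap.sup_apply, hf, hg, suppFun_joinBody, suppFun_add, suppFun_add, suppFun_add]
      rcases le_total (suppFun A u + suppFun B' u) (suppFun B u + suppFun A' u) with h | h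
      · rw [max_eq_right h, sup_eq_right.2 (by linarith)]; ring
      · rw [max_eq_left h, sup_eq_left.2 (by linarith)]; ring
    · intro v x y
      by_cases hxy : x = y
      · obtain ⟨f, hf, hfu⟩ := haff 0 (v x)
        exact ⟨f, hf, by simp [hfu], by simp [hfu, hxy]⟩
      · have hne : (x : E n) - y ≠ 0 := sub_ne_zero.2 fun h => hxy (Subtype.ext h)
        have hn2 : ‖(x : E n) - y‖ ^ 2 ≠ 0 := by simpa using hne
        -- The affine function in the direction `x - y` that takes the prescribed values at `x` and
        -- `y`.
        obtain ⟨f, hf, hfu⟩ := haff (((v x - v y) / ‖(x : E n) - y‖ ^ 2) • ((x : E n) - y))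
          (v x - inner ℝ (((v x - v y) / ‖(x : E n) - y‖ ^ 2) • ((x : E n) - y)) (x : E n))
        refine ⟨f, hf, by rw [hfu]; ring, ?_⟩
        have h3 : inner ℝ (((v x - v y) / ‖(x : E n) - y‖ ^ 2) • ((x : E n) - y)) (x : E n) -
            inner ℝ (((v x - v y) / ‖(x : E n) - y‖ ^ 2) • ((x : E n) - y)) (y : E n) =
            v x - v y := by
          rw [← inner_sub_right, real_inner_smul_left, real_inner_self_eq_norm_sq]
          field_simp
        rw [hfu]
        linarith
  have hg : g ∈ closure L := by rw [hcl]; trivial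
  obtain ⟨f, ⟨C, C', hC, hC', hf⟩, hfg⟩ := Metric.mem_closure_iff.1 hg ε hε
  refine ⟨C, C', hC, hC', fun u => ?_⟩
  rw [← hf]
  have := (ContinuousMap.dist_apply_le_dist (f := g) (g := f) u).trans hfg.le
  rwa [Real.dist_eq] at this

/-! ### Surface measures of polyconvex sets -/

/-- The difference of `μ` and `ν` is the surface measure of `A`: it gives the first variation of
integrals over `A`. -/
structure SurfRep (A : Set (E n)) (μ ν : Measure (E n × Sph n)) : Prop where
  fin_left : IsFiniteMeasure μ
  fin_right : IsFiniteMeasure ν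
  bounded : ∃ B : Set (E n), IsCompact B ∧ (∀ᵐ z ∂μ, z.1 ∈ B) ∧ ∀ᵐ z ∂ν, z.1 ∈ B
  tendsto : ∀ (h : E n → ℝ) (C : Body n), Continuous h → IsProbe C →
    Tendsto (dilationQuot h C A) (𝓝[>] 0)
      (𝓝 ((∫ z, h z.1 * suppFun C z.2 ∂μ) - ∫ z, h z.1 * suppFun C z.2 ∂ν))

theorem integrable_of_continuous {V : Type*} [NormedAddCommGroup V] {μ : Measure (E n × Sph n)}
    [IsFiniteMeasure μ] {B : Set (E n)} (hB : IsCompact B) (hμ : ∀ᵐ z ∂μ, z.1 ∈ B)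
    {f : E n × Sph n → V} (hf : Continuous f) : Integrable f μ := by
  obtain ⟨M, hM⟩ := (hB.prod (isCompact_univ (X := Sph n))).exists_bound_of_continuousOn
    hf.continuousOn
  exact Integrable.of_bound (hf.aestronglyMeasurable) M
    (hμ.mono fun z hz => hM z ⟨hz, mem_univ _⟩)

theorem continuous_mul_suppFun {h : E n → ℝ} (hh : Continuous h) (C : Body n) :
    Continuous fun z : E n × Sph n => h z.1 * suppFun C z.2 :=
  (hh.comp continuous_fst).mul ((continuous_suppFun C).comp (by fun_prop))

theorem abs_integral_sub_suppFun_le {m : Measure (E n × Sph n)} [IsFiniteMeasure m]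
    {T : Set (E n)} (hT : IsCompact T) (hmT : ∀ᵐ z ∂m, z.1 ∈ T) {f : E n → ℝ} (hf : Continuous f)
    {M : ℝ} (hM : ∀ x ∈ T, ‖f x‖ ≤ M) {g : C(Sph n, ℝ)} {C C' : Body n} {ε : ℝ} (hε : 0 ≤ ε)
    (hg : ∀ u : Sph n, |g u - (suppFun C u - suppFun C' u)| ≤ ε) :
    |(∫ p, f p.1 * g p.2 ∂m) -
      ((∫ z, f z.1 * suppFun C z.2 ∂m) - ∫ z, f z.1 * suppFun C' z.2 ∂m)| ≤
      ε * M * m.real univ := by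
  have hcg : Continuous fun z : E n × Sph n => f z.1 * g z.2 := by fun_prop
  have i1 := integrable_of_continuous hT hmT hcg
  have i2 := integrable_of_continuous hT hmT (continuous_mul_suppFun hf C)
  have i3 := integrable_of_continuous hT hmT (continuous_mul_suppFun hf C')
  have e : (∫ p, f p.1 * g p.2 ∂m) -
      ((∫ z, f z.1 * suppFun C z.2 ∂m) - ∫ z, f z.1 * suppFun C' z.2 ∂m) =
      ∫ z, f z.1 * (g z.2 - (suppFun C z.2 - suppFun C' z.2)) ∂m := by
    rw [← integral_sub i2 i3, ← integral_sub i1]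
    · simp only [mul_sub]
    · exact i2.sub i3
  rw [e, ← Real.norm_eq_abs]
  refine norm_integral_le_of_norm_le_const (hmT.mono fun z hz => ?_)
  rw [norm_mul, mul_comm]
  exact mul_le_mul (hg z.2) (hM _ hz) (norm_nonneg _) hε

theorem surfRep_empty : SurfRep (∅ : Set (E n)) 0 0 where
  fin_left := inferInstance
  fin_right := inferInstance
  bounded := ⟨∅, isCompact_empty, by simp, by simp⟩
  tendsto h C _ _ := by
    have : dilationQuot h C ∅ = fun _ => 0 := by
      ext t; simp [dilationQuot]
    rw [this]
    simp

theorem setIntegral_union_add_inter {V : Type*} [NormedAddCommGroup V] [NormedSpace ℝ V]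
    {f : E n → V} {A B : Set (E n)} (hB : MeasurableSet B)
    (hfA : IntegrableOn f A) (hfB : IntegrableOn f B) :
    (∫ x in A ∪ B, f x) + ∫ x in A ∩ B, f x = (∫ x in A, f x) + ∫ x in B, f x := by
  rw [← integral_add_measure (hfA.union hfB) (hfA.mono_set inter_subset_left),
    Measure.restrict_union_add_inter A hB, integral_add_measure hfA hfB]

/-- Dilation commutes with unions, but for intersections it loses exactly the gap set. As `h` is
bounded near `A`, the defect is at most a constant times the gap volume. -/
theorem tendsto_dilationQuot_union {A B : Set (E n)} (hA : IsCompact A) (hB : IsCompact B)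
    {C : Body n} {h : E n → ℝ} (hh : Continuous h)
    (hgap : Tendsto (fun t => t⁻¹ * volume.real (gapSet C A B t)) (𝓝[>] 0) (𝓝 0)) :
    Tendsto (fun t => dilationQuot h C (A ∪ B) t + dilationQuot h C (A ∩ B) t -
      dilationQuot h C A t - dilationQuot h C B t) (𝓝[>] 0) (𝓝 0) := by
  obtain ⟨R, hR, hCR⟩ := exists_subset_closedBall C
  obtain ⟨M, hM⟩ := (hA.add (isCompact_closedBall (0 : E n) R)).exists_bound_of_continuousOn
    hh.continuousOn
  have hlim := hgap.const_mul |M|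
  rw [mul_zero] at hlim
  refine squeeze_zero_norm' ?_ hlim
  filter_upwards [Ioc_mem_nhdsGT (zero_lt_one : (0 : ℝ) < 1)] with t ht
  have hi : ∀ {S : Set (E n)}, IsCompact S → IntegrableOn h S := fun hS =>
    hh.continuousOn.integrableOn_compact hS
  have cA := isCompact_add_smul hA C t
  have cB := isCompact_add_smul hB C t
  have cI := isCompact_add_smul (hA.inter hB) C t
  have h1 : (∫ x in (A ∪ B) + t • (C : Set (E n)), h x) +
      ∫ x in (A + t • (C : Set (E n))) ∩ (B + t • (C : Set (E n))), h x =
      (∫ x in A + t • (C : Set (E n)), h x) + ∫ x in B + t • (C : Set (E n)), h x := by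
    rw [union_add]
    exact setIntegral_union_add_inter cB.measurableSet (hi cA) (hi cB)
  have h2 : (∫ x in A ∪ B, h x) + ∫ x in A ∩ B, h x = (∫ x in A, h x) + ∫ x in B, h x :=
    setIntegral_union_add_inter hB.measurableSet (hi hA) (hi hB)
  have h3 : (∫ x in (A + t • (C : Set (E n))) ∩ (B + t • (C : Set (E n))), h x) -
      ∫ x in (A ∩ B) + t • (C : Set (E n)), h x = ∫ x in gapSet C A B t, h x :=
    setIntegral_sub_eq_diff hh cI (cA.inter cB) (inter_add_subset)
  have h4 : dilationQuot h C (A ∪ B) t + dilationQuot h C (A ∩ B) t -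
      dilationQuot h C A t - dilationQuot h C B t = -(t⁻¹ * ∫ x in gapSet C A B t, h x) := by
    simp only [dilationQuot]
    rw [← h3]
    linear_combination t⁻¹ * h1 - t⁻¹ * h2
  rw [h4, norm_neg, norm_mul, norm_inv, Real.norm_of_nonneg ht.1.le, mul_left_comm]
  have ht0 := ht.1
  gcongr
  refine norm_setIntegral_le_of_norm_le_const ?_ fun x hx => ?_
  · exact (measure_mono (fun x hx => hx.1.1)).trans_lt cA.measure_lt_top
  · refine (hM x ?_).trans (le_abs_self M)
    refine add_subset_add_left ?_ (add_smul_subset_closedBall hCR ht.1.le A hx.1.1)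
    exact Metric.closedBall_subset_closedBall (by nlinarith [ht.2])

/-- Inclusion–exclusion; the measures of the intersection enter with their roles exchanged, which
keeps all measures nonnegative. -/
theorem SurfRep.union {A B : Set (E n)} (hA : IsCompact A) (hB : IsCompact B)
    (hgap : ∀ C, IsProbe C → Tendsto (fun t => t⁻¹ * volume.real (gapSet C A B t)) (𝓝[>] 0) (𝓝 0))
    {μ ν μ' ν' μ'' ν'' : Measure (E n × Sph n)} (h : SurfRep A μ ν) (h' : SurfRep B μ' ν')
    (h'' : SurfRep (A ∩ B) μ'' ν'') : SurfRep (A ∪ B) (μ + μ' + ν'') (ν + ν' + μ'') := by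
  have := h.fin_left
  have := h.fin_right
  have := h'.fin_left
  have := h'.fin_right
  have := h''.fin_left
  have := h''.fin_right
  obtain ⟨S, hS, hSμ, hSν⟩ := h.bounded
  obtain ⟨S', hS', hSμ', hSν'⟩ := h'.bounded
  obtain ⟨S'', hS'', hSμ'', hSν''⟩ := h''.bounded
  refine ⟨inferInstance, inferInstance, ⟨S ∪ S' ∪ S'', (hS.union hS').union hS'', ?_, ?_⟩, ?_⟩
  · simp only [ae_add_measure_iff]
    exact ⟨⟨hSμ.mono fun z hz => Or.inl (Or.inl hz), hSμ'.mono fun z hz => Or.inl (Or.inr hz)⟩,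
      hSν''.mono fun z hz => Or.inr hz⟩
  · simp only [ae_add_measure_iff]
    exact ⟨⟨hSν.mono fun z hz => Or.inl (Or.inl hz), hSν'.mono fun z hz => Or.inl (Or.inr hz)⟩,
      hSμ''.mono fun z hz => Or.inr hz⟩
  · intro f C hf hC
    have hc := continuous_mul_suppFun hf C
    have l := ((tendsto_dilationQuot_union hA hB hf (hgap C hC)).add
      ((h.tendsto f C hf hC).add (h'.tendsto f C hf hC))).sub (h''.tendsto f C hf hC)
    have i1 := integrable_of_continuous hS hSμ hc
    have i2 := integrable_of_continuous hS hSν hc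
    have i3 := integrable_of_continuous hS' hSμ' hc
    have i4 := integrable_of_continuous hS' hSν' hc
    have i5 := integrable_of_continuous hS'' hSμ'' hc
    have i6 := integrable_of_continuous hS'' hSν'' hc
    rw [integral_add_measure (i1.add_measure i3) i6, integral_add_measure i1 i3,
      integral_add_measure (i2.add_measure i4) i5, integral_add_measure i2 i4]
    convert l using 2
    · ring
    · ring

/-- Uniqueness of limits gives equality on the products `h(x) h_C(u)`, approximation gives it on
`h(x) g(u)`, and such products determine finite measures. The additive form expresses `μ - ν = μ' -
ν'` without signed measures. -/
theorem SurfRep.add_eq_add {A : Set (E n)} {μ ν μ' ν' : Measure (E n × Sph n)}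
    (h : SurfRep A μ ν) (h' : SurfRep A μ' ν') : μ + ν' = μ' + ν := by
  have := h.fin_left
  have := h.fin_right
  have := h'.fin_left
  have := h'.fin_right
  obtain ⟨S, hS, hSμ, hSν⟩ := h.bounded
  obtain ⟨S', hS', hSμ', hSν'⟩ := h'.bounded
  refine _root_.Measure.ext_of_integral_mul_boundedContinuousFunction fun f g => ?_
  set m := μ.real univ + ν.real univ + μ'.real univ + ν'.real univ with hm
  have key : ∀ ε > 0, |(∫ p, f p.1 * g p.2 ∂(μ + ν')) - ∫ p, f p.1 * g p.2 ∂(μ' + ν)| ≤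
      ε * (‖f‖ * m) := by
    intro ε hε
    obtain ⟨C, C', hC, hC', hg⟩ := exists_suppFun_sub_suppFun_near g.toContinuousMap hε
    have hcg : Continuous fun z : E n × Sph n => f z.1 * g z.2 := by fun_prop
    have e1 := tendsto_nhds_unique (h.tendsto f C f.continuous hC) (h'.tendsto f C f.continuous hC)
    have e2 := tendsto_nhds_unique (h.tendsto f C' f.continuous hC')
      (h'.tendsto f C' f.continuous hC')
    have bd : ∀ (m : Measure (E n × Sph n)) [IsFiniteMeasure m] (T : Set (E n)), IsCompact T →
        (∀ᵐ z ∂m, z.1 ∈ T) → |(∫ p, f p.1 * g p.2 ∂m) -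
          ((∫ z, f z.1 * suppFun C z.2 ∂m) - ∫ z, f z.1 * suppFun C' z.2 ∂m)| ≤
          ε * ‖f‖ * m.real univ := fun m _ T hT hmT =>
      abs_integral_sub_suppFun_le hT hmT f.continuous (fun x _ => f.norm_coe_le_norm x) hε.le hg
    have b1 := bd μ S hS hSμ
    have b2 := bd ν S hS hSν
    have b3 := bd μ' S' hS' hSμ'
    have b4 := bd ν' S' hS' hSν'
    rw [integral_add_measure (integrable_of_continuous hS hSμ hcg)
      (integrable_of_continuous hS' hSν' hcg),
      integral_add_measure (integrable_of_continuous hS' hSμ' hcg)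
      (integrable_of_continuous hS hSν hcg)]
    rw [hm]
    rw [abs_le] at *
    constructor <;> nlinarith
  have hz : ∀ x : ℝ, 0 ≤ x → (∀ ε > 0, x ≤ ε * (‖f‖ * m)) → x = 0 := by
    intro x hx hxε
    have hl : Tendsto (fun ε : ℝ => ε * (‖f‖ * m)) (𝓝[>] 0) (𝓝 0) := by
      have : Tendsto (fun ε : ℝ => ε * (‖f‖ * m)) (𝓝 0) (𝓝 (0 * (‖f‖ * m))) :=
        (continuous_mul_const _).tendsto 0
      rw [zero_mul] at this
      exact this.mono_left nhdsWithin_le_nhds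
    exact le_antisymm (ge_of_tendsto hl (eventually_mem_nhdsWithin.mono hxε)) hx
  exact sub_eq_zero.1 (abs_eq_zero.1 (hz _ (abs_nonneg _) key))

theorem SurfRep.integral_sub_eq {V : Type*} [NormedAddCommGroup V] [NormedSpace ℝ V]
    {A : Set (E n)} {μ ν μ' ν' : Measure (E n × Sph n)} (h : SurfRep A μ ν)
    (h' : SurfRep A μ' ν') {f : E n × Sph n → V} (hf : Continuous f) :
    (∫ z, f z ∂μ) - ∫ z, f z ∂ν = (∫ z, f z ∂μ') - ∫ z, f z ∂ν' := by
  have := h.fin_left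
  have := h.fin_right
  have := h'.fin_left
  have := h'.fin_right
  obtain ⟨S, hS, hSμ, hSν⟩ := h.bounded
  obtain ⟨S', hS', hSμ', hSν'⟩ := h'.bounded
  have e : ∫ z, f z ∂(μ + ν') = ∫ z, f z ∂(μ' + ν) := by rw [h.add_eq_add h']
  rw [integral_add_measure (integrable_of_continuous hS hSμ hf)
      (integrable_of_continuous hS' hSν' hf),
      integral_add_measure (integrable_of_continuous hS' hSμ' hf)
      (integrable_of_continuous hS hSν hf)] at e
  rw [sub_eq_sub_iff_add_eq_add, e]

variable [Nonempty (Sph n)]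

theorem surfRep_body (hn : 0 < n) (K : Body n) : SurfRep (K : Set (E n)) (surfMeasure K) 0 where
  fin_left := inferInstance
  fin_right := inferInstance
  bounded := ⟨K, K.isCompact, ae_surfMeasure_mem K, by simp⟩
  tendsto h C hh hC := by
    simpa using tendsto_dilationQuot_body hn K hC hh

end

section

variable {n : ℕ}

/-! ### Polyconvex sets -/

/-- The union of a list of convex bodies. -/
def bodyUnion (l : List (Body n)) : Set (E n) := ⋃ K ∈ l, (K : Set (E n))

theorem bodyUnion_nil : bodyUnion ([] : List (Body n)) = ∅ := by simp [bodyUnion]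

theorem bodyUnion_cons (K : Body n) (l : List (Body n)) :
    bodyUnion (K :: l) = (K : Set (E n)) ∪ bodyUnion l := by
  simp [bodyUnion, iUnion_or, iUnion_union_distrib]

theorem mem_bodyUnion {l : List (Body n)} {x : E n} : x ∈ bodyUnion l ↔ ∃ K ∈ l, x ∈ K := by
  simp [bodyUnion]

theorem polyconvex_iff {A : Set (E n)} : Polyconvex A ↔ ∃ l : List (Body n), A = bodyUnion l := by
  constructor
  · rintro ⟨s, hs, rfl⟩
    refine ⟨hs.toFinset.toList, ?_⟩
    ext x
    simp [mem_bodyUnion]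
  · rintro ⟨l, rfl⟩
    exact ⟨{K | K ∈ l}, l.finite_toSet, rfl⟩

theorem Polyconvex.isCompact {A : Set (E n)} (hA : Polyconvex A) : IsCompact A := by
  obtain ⟨s, hs, rfl⟩ := hA
  exact hs.isCompact_biUnion fun K _ => K.isCompact

theorem polyconvex_empty : Polyconvex (∅ : Set (E n)) := ⟨∅, finite_empty, by simp⟩

theorem polyconvex_body (K : Body n) : Polyconvex (K : Set (E n)) := ⟨{K}, finite_singleton K, by simp⟩

theorem Polyconvex.union {A B : Set (E n)} (hA : Polyconvex A) (hB : Polyconvex B) :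
    Polyconvex (A ∪ B) := by
  obtain ⟨s, hs, rfl⟩ := hA
  obtain ⟨t, ht, rfl⟩ := hB
  exact ⟨s ∪ t, hs.union ht, (biUnion_union _ _ _).symm⟩

open Classical in
/-- The intersection of two convex bodies, if it is not empty. -/
def interBody (K L : Body n) : Option (Body n) :=
  if h : ((K : Set (E n)) ∩ L).Nonempty then
    some ⟨K ∩ L, K.convex.inter L.convex, K.isCompact.inter L.isCompact, h⟩
  else none

theorem coe_eq_inter_of_interBody {K L M : Body n} (h : interBody K L = some M) :
    (M : Set (E n)) = (K : Set (E n)) ∩ L := by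
  unfold interBody at h
  split_ifs at h
  rw [Option.some.injEq] at h
  rw [← h]
  rfl

theorem inter_bodyUnion (K : Body n) (l : List (Body n)) :
    (K : Set (E n)) ∩ bodyUnion l = bodyUnion (l.filterMap (interBody K)) := by
  ext x
  simp only [mem_inter_iff, mem_bodyUnion, List.mem_filterMap]
  constructor
  · rintro ⟨hK, L, hL, hx⟩
    have hne : ((K : Set (E n)) ∩ L).Nonempty := ⟨x, hK, hx⟩
    exact ⟨⟨K ∩ L, K.convex.inter L.convex, K.isCompact.inter L.isCompact, hne⟩,
      ⟨L, hL, by rw [interBody, dif_pos hne]⟩, hK, hx⟩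
  · rintro ⟨M, ⟨L, hL, hM⟩, hx⟩
    have hx' : x ∈ (M : Set (E n)) := hx
    rw [coe_eq_inter_of_interBody hM] at hx'
    exact ⟨hx'.1, L, hL, hx'.2⟩

theorem Polyconvex.body_inter {A : Set (E n)} (hA : Polyconvex A) (K : Body n) :
    Polyconvex ((K : Set (E n)) ∩ A) := by
  obtain ⟨l, rfl⟩ := polyconvex_iff.1 hA
  rw [inter_bodyUnion]
  exact polyconvex_iff.2 ⟨_, rfl⟩

/-- Intersecting a union of at most `m` bodies with `K` gives again at most `m` bodies, so both
hypotheses are available at level `m`. The counter serves the quantitative mass bound. -/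
theorem bodyUnion_induction {S : Set (E n)} {P : ℕ → Set (E n) → Prop} (h0 : ∀ m, P m ∅)
    (h1 : ∀ (m : ℕ) (K : Body n) (A : Set (E n)), (K : Set (E n)) ⊆ S → Polyconvex A →
      P m A → P m ((K : Set (E n)) ∩ A) → P (m + 1) ((K : Set (E n)) ∪ A)) :
    ∀ (m : ℕ) (l : List (Body n)), l.length ≤ m → (∀ K ∈ l, (K : Set (E n)) ⊆ S) →
      P m (bodyUnion l) := by
  intro m
  induction m with
  | zero =>
    intro l hl _
    rw [List.eq_nil_of_length_eq_zero (Nat.le_zero.1 hl), bodyUnion_nil]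
    exact h0 0
  | succ m ih =>
    rintro (_ | ⟨K, l⟩) hl hS
    · rw [bodyUnion_nil]; exact h0 _
    · rw [bodyUnion_cons]
      have hl' : l.length ≤ m := by simpa using hl
      refine h1 m K _ (hS K (by simp)) (polyconvex_iff.2 ⟨l, rfl⟩)
        (ih l hl' fun L hL => hS L (by simp [hL])) ?_
      rw [inter_bodyUnion]
      refine ih _ ((List.length_filterMap_le _ _).trans hl') fun M hM => ?_
      obtain ⟨L, hL, hM⟩ := List.mem_filterMap.1 hM
      rw [coe_eq_inter_of_interBody hM]
      exact inter_subset_left.trans (hS K (by simp))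

theorem polyconvex_induction {P : Set (E n) → Prop} (h0 : P ∅)
    (h1 : ∀ (K : Body n) (A : Set (E n)), Polyconvex A →
      P A → P ((K : Set (E n)) ∩ A) → P ((K : Set (E n)) ∪ A)) {A : Set (E n)}
    (hA : Polyconvex A) : P A := by
  obtain ⟨l, rfl⟩ := polyconvex_iff.1 hA
  exact bodyUnion_induction (S := univ) (P := fun _ => P) (fun _ => h0)
    (fun _ K A _ hA => h1 K A hA) l.length l le_rfl fun K _ => subset_univ _

theorem Polyconvex.inter {A B : Set (E n)} (hA : Polyconvex A) (hB : Polyconvex B) :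
    Polyconvex (A ∩ B) := by
  refine polyconvex_induction (P := fun A => Polyconvex (A ∩ B)) ?_ ?_ hA
  · simpa using polyconvex_empty
  · intro K A _ h1 _
    rw [union_inter_distrib_right]
    exact (hB.body_inter K).union h1

/-! ### Additive extensions -/

theorem IsAdditiveExtension.eq {p : ℕ} {φ : Body n → SymTensor n p}
    {ψ ψ' : Set (E n) → SymTensor n p} (h : IsAdditiveExtension φ ψ)
    (h' : IsAdditiveExtension φ ψ') : ψ = ψ' := by
  ext1 A
  by_cases hA : Polyconvex A
  · refine polyconvex_induction (P := fun A => ψ A = ψ' A) ?_ ?_ hA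
    · rw [h.map_empty, h'.map_empty]
    · intro K A hA h1 h2
      have e := h.map_union K A (polyconvex_body K) hA
      have e' := h'.map_union K A (polyconvex_body K) hA
      rw [h.extends_body, h1, h2] at e
      rw [h'.extends_body, ← e] at e'
      exact (add_right_cancel e').symm
  · rw [h.map_other A hA, h'.map_other A hA]

theorem additiveExtension_eq {p : ℕ} {φ : Body n → SymTensor n p} {ψ : Set (E n) → SymTensor n p}
    (h : IsAdditiveExtension φ ψ) : additiveExtension φ = ψ := by
  have hex : ∃ ψ, IsAdditiveExtension φ ψ := ⟨ψ, h⟩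
  rw [additiveExtension, dif_pos hex]
  exact hex.choose_spec.eq h

/-! ### Gaps between polyconvex sets -/

/-- The gap of `A ∪ A'` and `B` is contained in the union of the gaps of `A`, `B` and of `A'`, `B`.
-/
theorem tendsto_volume_gapSet_union {C : Body n} {A A' B : Set (E n)} (hA : IsCompact A)
    (hA' : IsCompact A')
    (h : Tendsto (fun t => t⁻¹ * volume.real (gapSet C A B t)) (𝓝[>] 0) (𝓝 0))
    (h' : Tendsto (fun t => t⁻¹ * volume.real (gapSet C A' B t)) (𝓝[>] 0) (𝓝 0)) :
    Tendsto (fun t => t⁻¹ * volume.real (gapSet C (A ∪ A') B t)) (𝓝[>] 0) (𝓝 0) := by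
  have hl := h.add h'
  rw [add_zero] at hl
  have hpos : ∀ᶠ t : ℝ in 𝓝[>] 0, 0 < t := eventually_mem_nhdsWithin
  refine tendsto_of_tendsto_of_tendsto_of_le_of_le' tendsto_const_nhds hl ?_ ?_
  · filter_upwards [hpos] with t ht
    positivity
  · filter_upwards [hpos] with t ht
    rw [← mul_add]
    gcongr
    have hfin : ∀ {S : Set (E n)}, IsCompact S → volume (gapSet C S B t) < ∞ := fun hS =>
      (measure_mono (fun x hx => hx.1.1)).trans_lt (isCompact_add_smul hS C t).measure_lt_top
    refine le_trans (measureReal_mono ?_ (measure_union_lt_top (hfin hA) (hfin hA')).ne)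
      (measureReal_union_le _ _)
    rintro x ⟨⟨hx1, hx2⟩, hx3⟩
    rw [union_add] at hx1
    rcases hx1 with hx1 | hx1
    · exact Or.inl ⟨⟨hx1, hx2⟩, fun h => hx3 (add_subset_add_right
        (inter_subset_inter_left _ subset_union_left) h)⟩
    · exact Or.inr ⟨⟨hx1, hx2⟩, fun h => hx3 (add_subset_add_right
        (inter_subset_inter_left _ subset_union_right) h)⟩

theorem tendsto_volume_gapSet_empty (C : Body n) (B : Set (E n)) :
    Tendsto (fun t => t⁻¹ * volume.real (gapSet C ∅ B t)) (𝓝[>] 0) (𝓝 0) := by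
  simp [gapSet]

variable [Nonempty (Sph n)]

theorem tendsto_volume_gapSet (hn : 0 < n) {A B : Set (E n)} (hA : Polyconvex A)
    (hB : Polyconvex B) {C : Body n} (hC : IsProbe C) :
    Tendsto (fun t => t⁻¹ * volume.real (gapSet C A B t)) (𝓝[>] 0) (𝓝 0) := by
  have hK : ∀ K : Body n, Tendsto (fun t => t⁻¹ * volume.real (gapSet C K B t)) (𝓝[>] 0) (𝓝 0) := by
    intro K
    simp only [gapSet_comm C (K : Set (E n))]
    refine polyconvex_induction
      (P := fun B => Tendsto (fun t => t⁻¹ * volume.real (gapSet C B K t)) (𝓝[>] 0) (𝓝 0))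
      (tendsto_volume_gapSet_empty C _) ?_ hB
    intro L B hB h _
    exact tendsto_volume_gapSet_union L.isCompact hB.isCompact
      (tendsto_volume_gapSet_body hn L K hC) h
  refine polyconvex_induction
    (P := fun A => Tendsto (fun t => t⁻¹ * volume.real (gapSet C A B t)) (𝓝[>] 0) (𝓝 0))
    (tendsto_volume_gapSet_empty C _) ?_ hA
  intro K A hA h _
  exact tendsto_volume_gapSet_union K.isCompact hA.isCompact (hK K) h

theorem SurfRep.polyconvex_union (hn : 0 < n) {A B : Set (E n)} (hA : Polyconvex A)
    (hB : Polyconvex B) {μ ν μ' ν' μ'' ν'' : Measure (E n × Sph n)} (h : SurfRep A μ ν)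
    (h' : SurfRep B μ' ν') (h'' : SurfRep (A ∩ B) μ'' ν'') :
    SurfRep (A ∪ B) (μ + μ' + ν'') (ν + ν' + μ'') :=
  h.union hA.isCompact hB.isCompact (fun _ hC => tendsto_volume_gapSet hn hA hB hC) h' h''

/-- Adding `K` to `A` costs the masses for `K`, `A` and `K ∩ A`, hence a factor `3` per body. An
exponential bound is enough because Poisson variables have exponential moments. -/
theorem exists_surfRep_bodyUnion (hn : 0 < n) (W : Set (E n)) (m : ℕ) (l : List (Body n))
    (hl : l.length ≤ m) (hW : ∀ K ∈ l, (K : Set (E n)) ⊆ W) :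
    ∃ μ ν, SurfRep (bodyUnion l) μ ν ∧ (∀ᵐ z ∂μ, z.1 ∈ W) ∧ (∀ᵐ z ∂ν, z.1 ∈ W) ∧
      μ univ + ν univ ≤ 3 ^ m * volume (W + Metric.closedBall (0 : E n) 1) := by
  refine bodyUnion_induction (S := W) (P := fun m A => ∃ μ ν, SurfRep A μ ν ∧
      (∀ᵐ z ∂μ, z.1 ∈ W) ∧ (∀ᵐ z ∂ν, z.1 ∈ W) ∧
      μ univ + ν univ ≤ 3 ^ m * volume (W + Metric.closedBall (0 : E n) 1)) ?_ ?_ m l hl hW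
  · exact fun m => ⟨0, 0, surfRep_empty, by simp, by simp, by simp⟩
  · rintro m K A hK hA ⟨μ, ν, h, hμ, hν, hb⟩ ⟨μ', ν', h', hμ', hν', hb'⟩
    refine ⟨_, _, (surfRep_body hn K).polyconvex_union hn (polyconvex_body K) hA h h', ?_, ?_, ?_⟩
    · rw [ae_add_measure_iff, ae_add_measure_iff]
      exact ⟨⟨(ae_surfMeasure_mem K).mono fun z hz => hK hz, hμ⟩, hν'⟩
    · rw [zero_add, ae_add_measure_iff]
      exact ⟨hν, hμ'⟩
    simp only [Measure.add_apply, zero_add]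
    set c := volume (W + Metric.closedBall (0 : E n) 1)
    have hKc : surfMeasure K univ ≤ 3 ^ m * c := by
      refine (surfMeasure_univ_le K).trans ?_
      refine (measure_mono ((collar_subset K 1).trans (add_subset_add_right hK))).trans ?_
      exact le_mul_of_one_le_left bot_le (one_le_pow₀ (by norm_num))
    calc surfMeasure K univ + μ univ + ν' univ + (ν univ + μ' univ)
        = surfMeasure K univ + (μ univ + ν univ) + (μ' univ + ν' univ) := by ring
      _ ≤ 3 ^ m * c + 3 ^ m * c + 3 ^ m * c := by gcongr
      _ = 3 ^ (m + 1) * c := by ring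

theorem Polyconvex.exists_surfRep (hn : 0 < n) {A : Set (E n)} (hA : Polyconvex A) :
    ∃ μ ν, SurfRep A μ ν := by
  obtain ⟨l, rfl⟩ := polyconvex_iff.1 hA
  obtain ⟨μ, ν, h, -⟩ := exists_surfRep_bodyUnion hn univ l.length l le_rfl fun _ _ => subset_univ _
  exact ⟨μ, ν, h⟩

end

section

variable {n : ℕ}

/-! ### Coordinates of symmetric tensors -/

/-- The coordinate of a symmetric tensor with respect to the standard basis. -/
def tensorCoord {p : ℕ} (i : Fin p → Fin n) : SymTensor n p →L[ℝ] ℝ :=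
  (ContinuousMultilinearMap.apply ℝ (fun _ : Fin p => E n) ℝ
    (fun k => EuclideanSpace.basisFun (Fin n) ℝ (i k))).comp (symSubmodule n p).subtypeL

theorem tensorCoord_apply {p : ℕ} (i : Fin p → Fin n) (T : SymTensor n p) :
    tensorCoord i T = T.1 (fun k => EuclideanSpace.basisFun (Fin n) ℝ (i k)) := rfl

theorem tensor_ext {p : ℕ} {T T' : SymTensor n p} (h : ∀ i : Fin p → Fin n,
    tensorCoord i T = tensorCoord i T') : T = T' := by
  refine Subtype.ext (ContinuousMultilinearMap.toMultilinearMap_injective ?_)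
  refine Module.Basis.ext_multilinear (fun _ => (EuclideanSpace.basisFun (Fin n) ℝ).toBasis) ?_
  intro v
  simpa [tensorCoord_apply] using h v

theorem exists_tensor_eq_sum (n p : ℕ) : ∃ b : (Fin p → Fin n) → SymTensor n p,
    ∀ T : SymTensor n p, T = ∑ i, tensorCoord i T • b i := by
  let f : SymTensor n p →ₗ[ℝ] ((Fin p → Fin n) → ℝ) :=
    LinearMap.pi fun i => (tensorCoord i : SymTensor n p →ₗ[ℝ] ℝ)
  have hf : LinearMap.ker f = ⊥ := by
    refine LinearMap.ker_eq_bot.2 fun T T' h => tensor_ext fun i => ?_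
    exact congrFun h i
  obtain ⟨g, hg⟩ := LinearMap.exists_leftInverse_of_injective f hf
  refine ⟨fun i => g (Pi.single i 1), fun T => ?_⟩
  have h1 : T = g (f T) := (LinearMap.congr_fun hg T).symm
  conv_lhs => rw [h1, pi_eq_sum_univ' (f T)]
  rw [map_sum]
  refine Finset.sum_congr rfl fun i _ => ?_
  rw [map_smul]
  rfl

theorem continuous_tensor {α : Type*} [TopologicalSpace α] {p : ℕ} {f : α → SymTensor n p}
    (h : ∀ i, Continuous fun a => tensorCoord i (f a)) : Continuous f := by
  obtain ⟨b, hb⟩ := exists_tensor_eq_sum n p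
  have : f = fun a => ∑ i, tensorCoord i (f a) • b i := funext fun a => hb (f a)
  rw [this]
  exact continuous_finsetSum _ fun i _ => (h i).smul continuous_const

theorem integrable_tensor {α : Type*} [MeasurableSpace α] {μ : Measure α} {p : ℕ}
    {f : α → SymTensor n p} (h : ∀ i, Integrable (fun a => tensorCoord i (f a)) μ) :
    Integrable f μ := by
  obtain ⟨b, hb⟩ := exists_tensor_eq_sum n p
  have : f = fun a => ∑ i, tensorCoord i (f a) • b i := funext fun a => hb (f a)
  rw [this]
  exact integrable_finsetSum _ fun i _ => (h i).smul_const _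

theorem tensorCoord_integral {α : Type*} [MeasurableSpace α] {μ : Measure α} {p : ℕ}
    {f : α → SymTensor n p} (hf : Integrable f μ) (i : Fin p → Fin n) :
    tensorCoord i (∫ a, f a ∂μ) = ∫ a, tensorCoord i (f a) ∂μ :=
  ((tensorCoord i).integral_comp_comm hf).symm

theorem tensorCoord_tensorPow {r : ℕ} (i : Fin r → Fin n) (x : E n) :
    tensorCoord i (tensorPow r x) =
      ∏ k, inner ℝ x (EuclideanSpace.basisFun (Fin n) ℝ (i k)) := by
  rw [tensorCoord_apply, tensorPow]
  simp [ContinuousMultilinearMap.compContinuousLinearMap_apply]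

theorem tensorCoord_symMul {p q m : ℕ} (h : p + q = m) (a : SymTensor n p) (b : SymTensor n q)
    (i : Fin m → Fin n) : tensorCoord i (symMul h a b) = (m.factorial : ℝ)⁻¹ *
      ∑ σ : Equiv.Perm (Fin m), tensorCoord (fun k => i (σ (Fin.cast h (Fin.castAdd q k)))) a *
        tensorCoord (fun k => i (σ (Fin.cast h (Fin.natAdd p k)))) b := by
  rw [tensorCoord_apply, symMul]
  simp only [smul_apply, sum_apply, ContinuousMultilinearMap.domDomCongr_apply, outerMul_apply,
    smul_eq_mul]
  rfl

theorem continuous_tensorPow (r : ℕ) : Continuous (tensorPow (n := n) r) := by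
  refine continuous_tensor fun i => ?_
  simp only [tensorCoord_tensorPow]
  fun_prop

/-- The integrand of the Minkowski tensors. -/
def pairTensor (r s : ℕ) (z : E n × Sph n) : SymTensor n (r + s) :=
  symMul rfl (tensorPow r z.1) (tensorPow s (z.2 : E n))

theorem continuous_pairTensor (r s : ℕ) : Continuous (pairTensor (n := n) r s) := by
  refine continuous_tensor fun i => ?_
  simp only [pairTensor, tensorCoord_symMul]
  refine continuous_const.mul (continuous_finsetSum _ fun σ _ => ?_)
  exact ((tensorCoord _).continuous.comp ((continuous_tensorPow r).comp continuous_fst)).mul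
    ((tensorCoord _).continuous.comp ((continuous_tensorPow s).comp (by fun_prop)))

/-! ### The additive extensions of the volume and surface tensors -/

open Classical in
theorem isAdditiveExtension_volumeTensor (r : ℕ) : IsAdditiveExtension (volumeTensor (n := n) r)
    fun A => if Polyconvex A then (1 / (r.factorial : ℝ)) • ∫ x in A, tensorPow r x else 0 where
  extends_body K := by rw [if_pos (polyconvex_body K), volumeTensor]
  map_empty := by simp
  map_union A B hA hB := by
    have hi : ∀ {S : Set (E n)}, Polyconvex S → IntegrableOn (tensorPow (n := n) r) S := fun hS =>
      (continuous_tensorPow r).continuousOn.integrableOn_compact hS.isCompact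
    rw [if_pos (hA.union hB), if_pos (hA.inter hB), if_pos hA, if_pos hB, ← smul_add, ← smul_add,
      setIntegral_union_add_inter hB.isCompact.measurableSet (hi hA) (hi hB)]
  map_other A hA := if_neg hA

/-- The normalizing constant of the Minkowski tensors of order `n - 1`, relative to the surface
measure. -/
def surfConst (r s : ℕ) : ℝ :=
  (1 / ((r.factorial : ℝ) * s.factorial)) * (omega 1 / omega (1 + s)) * (kappa 1)⁻¹

theorem additiveExtension_volumeTensor (r : ℕ) {A : Set (E n)} (hA : Polyconvex A) :
    additiveExtension (volumeTensor r) A = (1 / (r.factorial : ℝ)) • ∫ x in A, tensorPow r x := by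
  rw [additiveExtension_eq (isAdditiveExtension_volumeTensor r)]
  exact if_pos hA

open Classical in
/-- The value of the additive extension of the surface tensor, in terms of a representation of the
surface measure. -/
def surfExtension (r s : ℕ) (A : Set (E n)) : SymTensor n (r + s) :=
  if h : Polyconvex A ∧ ∃ m : Measure (E n × Sph n) × Measure (E n × Sph n), SurfRep A m.1 m.2 then
    surfConst r s • ((∫ z, pairTensor r s z ∂h.2.choose.1) -
      ∫ z, pairTensor r s z ∂h.2.choose.2) else 0

theorem surfExtension_eq {r s : ℕ} {A : Set (E n)} (hA : Polyconvex A)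
    {μ ν : Measure (E n × Sph n)} (h : SurfRep A μ ν) : surfExtension r s A =
      surfConst r s • ((∫ z, pairTensor r s z ∂μ) - ∫ z, pairTensor r s z ∂ν) := by
  have hex : Polyconvex A ∧ ∃ m : Measure (E n × Sph n) × Measure (E n × Sph n),
    SurfRep A m.1 m.2 := ⟨hA, ⟨(μ, ν), h⟩⟩
  rw [surfExtension, dif_pos hex]
  congr 1
  exact hex.2.choose_spec.integral_sub_eq h (continuous_pairTensor r s)

variable [Nonempty (Sph n)]

theorem minkowskiTensor_top (hn : 0 < n) (r s : ℕ) (K : Body n) :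
    minkowskiTensor ⟨n - 1, Nat.sub_lt hn one_pos⟩ r s K =
      surfConst r s • ∫ z, pairTensor r s z ∂surfMeasure K := by
  rw [minkowskiTensor, supportMeasure_top hn, integral_smul_measure, smul_smul, surfConst]
  simp only [show n - (n - 1) = 1 by omega, ENNReal.toReal_inv,
    ENNReal.toReal_ofReal (kappa_pos 1).le]
  rfl

/-- A representation for `A ∪ B` can be assembled from those for `A`, `B` and `A ∩ B`; since the
value does not depend on the representation, additivity is linearity of the integral. -/
theorem isAdditiveExtension_surfExtension (hn : 0 < n) (r s : ℕ) : IsAdditiveExtension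
    (minkowskiTensor (n := n) ⟨n - 1, Nat.sub_lt hn one_pos⟩ r s) (surfExtension r s) where
  extends_body K := by
    rw [surfExtension_eq (polyconvex_body K) (surfRep_body hn K), minkowskiTensor_top hn]
    simp
  map_empty := by
    rw [surfExtension_eq polyconvex_empty surfRep_empty]
    simp
  map_union A B hA hB := by
    obtain ⟨μ, ν, h⟩ := hA.exists_surfRep hn
    obtain ⟨μ', ν', h'⟩ := hB.exists_surfRep hn
    obtain ⟨μ'', ν'', h''⟩ := (hA.inter hB).exists_surfRep hn
    have := h.fin_left
    have := h.fin_right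
    have := h'.fin_left
    have := h'.fin_right
    have := h''.fin_left
    have := h''.fin_right
    obtain ⟨S, hS, hSμ, hSν⟩ := h.bounded
    obtain ⟨S', hS', hSμ', hSν'⟩ := h'.bounded
    obtain ⟨S'', hS'', hSμ'', hSν''⟩ := h''.bounded
    have hc := continuous_pairTensor (n := n) r s
    have i1 := integrable_of_continuous hS hSμ hc
    have i2 := integrable_of_continuous hS hSν hc
    have i3 := integrable_of_continuous hS' hSμ' hc
    have i4 := integrable_of_continuous hS' hSν' hc
    have i5 := integrable_of_continuous hS'' hSμ'' hc
    have i6 := integrable_of_continuous hS'' hSν'' hc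
    rw [surfExtension_eq hA h, surfExtension_eq hB h', surfExtension_eq (hA.inter hB) h'',
      surfExtension_eq (hA.union hB) (h.polyconvex_union hn hA hB h' h''), ← smul_add, ← smul_add,
      integral_add_measure (i1.add_measure i3) i6, integral_add_measure i1 i3,
      integral_add_measure (i2.add_measure i4) i5, integral_add_measure i2 i4]
    congr 1
    abel
  map_other A hA := by
    rw [surfExtension, dif_neg fun h => hA h.1]

theorem additiveExtension_minkowskiTensor (hn : 0 < n) (r s : ℕ) {A : Set (E n)}
    (hA : Polyconvex A) {μ ν : Measure (E n × Sph n)} (h : SurfRep A μ ν) :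
    additiveExtension (minkowskiTensor ⟨n - 1, Nat.sub_lt hn one_pos⟩ r s) A =
      surfConst r s • ((∫ z, pairTensor r s z ∂μ) - ∫ z, pairTensor r s z ∂ν) := by
  rw [additiveExtension_eq (isAdditiveExtension_surfExtension hn r s), surfExtension_eq hA h]

end

section

variable {n : ℕ}

/-! ### Measurability on the space of convex bodies -/

/-- The convex bodies that hit `S`. -/
def hitSet (S : Set (E n)) : Set (Body n) := {K | ((K : Set (E n)) ∩ S).Nonempty}

theorem isClosed_hitSet {S : Set (E n)} (hS : IsCompact S) : IsClosed (hitSet S) := by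
  rw [← isOpen_compl_iff, Metric.isOpen_iff]
  intro K hK
  have hdisj : Disjoint (K : Set (E n)) S := by
    rw [disjoint_iff_inter_eq_empty, ← not_nonempty_iff_eq_empty]; exact hK
  obtain ⟨δ, hδ, hd⟩ := hdisj.exists_thickenings K.isCompact hS.isClosed
  refine ⟨δ, hδ, fun L hL hLS => ?_⟩
  obtain ⟨x, hxL, hxS⟩ := hLS
  have hL' : Metric.hausdorffDist (L : Set (E n)) K < δ := hL
  obtain ⟨y, hy, hxy⟩ := Metric.exists_dist_lt_of_hausdorffDist_lt hxL hL'
    ConvexBody.hausdorffEDist_ne_top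
  exact disjoint_left.1 hd (Metric.mem_thickening_iff.2 ⟨y, hy, hxy⟩)
    (Metric.self_subset_thickening hδ S hxS)

theorem measurableSet_hitSet {S : Set (E n)} (hS : IsCompact S) : MeasurableSet (hitSet S) :=
  (isClosed_hitSet hS).measurableSet

theorem mem_translate {K : Body n} {x y : E n} : y ∈ translate K x ↔ y - x ∈ K := by
  change y ∈ (K : Set (E n)) + {x} ↔ _
  rw [add_singleton, mem_image]
  constructor
  · rintro ⟨k, hk, rfl⟩
    simpa using hk
  · exact fun h => ⟨y - x, h, by simp⟩

theorem continuous_translate : Continuous fun z : Body n × E n => translate z.1 z.2 := by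
  refine (LipschitzWith.of_dist_le_mul (K := 2) fun z w => ?_).continuous
  have key : dist (translate z.1 z.2) (translate w.1 w.2) ≤ dist z.1 w.1 + dist z.2 w.2 := by
    refine le_of_forall_gt_imp_ge_of_dense fun r hr => ?_
    have aux : ∀ (K L : Body n) (a b : E n), dist K L + dist a b < r →
        ∀ x ∈ translate K a, ∃ y ∈ translate L b, dist x y ≤ r := by
      intro K L a b h x hx
      have h1 : Metric.hausdorffDist (K : Set (E n)) L < r - dist a b := by
        change dist K L < _
        linarith
      obtain ⟨y, hy, hxy⟩ := Metric.exists_dist_lt_of_hausdorffDist_lt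
        (mem_translate.1 hx) h1 ConvexBody.hausdorffEDist_ne_top
      refine ⟨y + b, mem_translate.2 (by simpa using hy), ?_⟩
      have h2 : dist x (y + b) ≤ dist (x - a) y + dist a b := by
        rw [dist_eq_norm, dist_eq_norm, dist_eq_norm]
        refine le_trans (le_of_eq ?_) (norm_add_le _ _)
        congr 1
        abel
      linarith
    have hr0 : 0 ≤ r := le_trans (by positivity) hr.le
    refine Metric.hausdorffDist_le_of_mem_dist hr0 (aux _ _ _ _ hr) (aux _ _ _ _ ?_)
    rwa [dist_comm w.1, dist_comm w.2]
  refine key.trans ?_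
  have h1 : dist z.1 w.1 ≤ dist z w := le_max_left _ _
  have h2 : dist z.2 w.2 ≤ dist z w := le_max_right _ _
  push_cast
  linarith

theorem measurable_translate : Measurable fun z : Body n × E n => translate z.1 z.2 :=
  continuous_translate.measurable

/-- `x ∈ K + B` means that `K - x` hits `-B`, a closed condition on the pair. -/
theorem measurableSet_mem_add {B : Set (E n)} (hB : IsCompact B) :
    MeasurableSet {z : Body n × E n | z.2 ∈ (z.1 : Set (E n)) + B} := by
  have hcl : IsClosed ((fun z : Body n × E n => translate z.1 (-z.2)) ⁻¹' hitSet (-B)) :=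
    (isClosed_hitSet hB.neg).preimage
      (continuous_translate.comp (continuous_fst.prodMk continuous_snd.neg))
  convert! hcl.measurableSet using 1
  ext z
  constructor
  · rintro ⟨k, hk, b, hb, hkb⟩
    refine ⟨-b, mem_translate.2 ?_, by simpa using hb⟩
    have : k + b = z.2 := hkb
    rw [← this]
    simpa using hk
  · rintro ⟨y, hy, hyB⟩
    exact ⟨y - -z.2, mem_translate.1 hy, -y, hyB, by simp⟩

theorem measurable_volume_add {B : Set (E n)} (hB : IsCompact B) :
    Measurable fun K : Body n => volume ((K : Set (E n)) + B) :=
  measurable_measure_prodMk_left (measurableSet_mem_add hB)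

/-- Cover the ball of radius `R` by `N` unit balls and use translation invariance. Thus the moment
assumption with the unit ball controls every bounded dilation. -/
theorem exists_volume_add_closedBall_le (n : ℕ) (R : ℝ) : ∃ N : ℕ, ∀ K : Body n,
    volume ((K : Set (E n)) + Metric.closedBall (0 : E n) R) ≤
      N * volume ((K : Set (E n)) + Metric.closedBall (0 : E n) 1) := by
  obtain ⟨t, -, ht, hcov⟩ := (isCompact_closedBall (0 : E n) R).finite_cover_balls one_pos
  refine ⟨ht.toFinset.card, fun K => ?_⟩
  have hsub : (K : Set (E n)) + Metric.closedBall (0 : E n) R ⊆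
      ⋃ x ∈ ht.toFinset, x +ᵥ ((K : Set (E n)) + Metric.closedBall (0 : E n) 1) := by
    rintro _ ⟨k, hk, b, hb, rfl⟩
    obtain ⟨x, hx, hbx⟩ := mem_iUnion₂.1 (hcov hb)
    refine mem_iUnion₂.2 ⟨x, ht.mem_toFinset.2 hx, k + (b - x), ⟨k, hk, b - x, ?_, rfl⟩, ?_⟩
    · rw [mem_closedBall_zero_iff, ← dist_eq_norm]
      exact (Metric.mem_ball.1 hbx).le
    · simp only [vadd_eq_add]; abel
  calc volume ((K : Set (E n)) + Metric.closedBall (0 : E n) R)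
      ≤ ∑ x ∈ ht.toFinset, volume (x +ᵥ ((K : Set (E n)) + Metric.closedBall (0 : E n) 1)) :=
        (measure_mono hsub).trans (measure_biUnion_finset_le _ _)
    _ = ht.toFinset.card * volume ((K : Set (E n)) + Metric.closedBall (0 : E n) 1) := by
        simp only [measure_vadd, Finset.sum_const, nsmul_eq_mul]

/-! ### Averages over the grain distribution -/

section Grain

variable {Q : Measure (Body n)}

theorem lintegral_volume_add_lt_top
    (hQ : ∫⁻ K, volume ((K : Set (E n)) + Metric.closedBall (0 : E n) 1) ∂Q < ∞) {B : Set (E n)}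
    (hB : Bornology.IsBounded B) : ∫⁻ K, volume ((K : Set (E n)) + B) ∂Q < ∞ := by
  obtain ⟨R, hR⟩ := hB.subset_closedBall 0
  obtain ⟨N, hN⟩ := exists_volume_add_closedBall_le n R
  calc ∫⁻ K, volume ((K : Set (E n)) + B) ∂Q
      ≤ ∫⁻ K, N * volume ((K : Set (E n)) + Metric.closedBall (0 : E n) 1) ∂Q :=
        lintegral_mono fun K => (measure_mono (add_subset_add_left hR)).trans (hN K)
    _ = N * ∫⁻ K, volume ((K : Set (E n)) + Metric.closedBall (0 : E n) 1) ∂Q :=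
        lintegral_const_mul _ (measurable_volume_add (isCompact_closedBall _ _))
    _ < ∞ := ENNReal.mul_lt_top (ENNReal.natCast_lt_top N) hQ

theorem integrable_volume_add
    (hQ : ∫⁻ K, volume ((K : Set (E n)) + Metric.closedBall (0 : E n) 1) ∂Q < ∞) {B : Set (E n)}
    (hB : IsCompact B) : Integrable (fun K : Body n => volume.real ((K : Set (E n)) + B)) Q :=
  integrable_toReal_of_lintegral_ne_top (measurable_volume_add hB).aemeasurable
    (lintegral_volume_add_lt_top hQ hB.isBounded).ne

theorem integrable_volume_body
    (hQ : ∫⁻ K, volume ((K : Set (E n)) + Metric.closedBall (0 : E n) 1) ∂Q < ∞) :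
    Integrable (fun K : Body n => volume.real (K : Set (E n))) Q := by
  simpa using integrable_volume_add hQ (isCompact_singleton (x := (0 : E n)))

theorem volume_add_smul_diff_le (K : Body n) {C : Body n} {R : ℝ}
    (hCR : (C : Set (E n)) ⊆ Metric.closedBall 0 R) {t : ℝ} (ht : 0 < t) (ht1 : t ≤ 1) :
    volume.real (((K : Set (E n)) + t • (C : Set (E n))) \ K) ≤
      t * volume.real ((K : Set (E n)) + Metric.closedBall (0 : E n) R) := by
  have h : volume (((K : Set (E n)) + t • (C : Set (E n))) \ K) ≤
      ENNReal.ofReal t * volume ((K : Set (E n)) + Metric.closedBall (0 : E n) R) :=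
    (measure_mono (add_smul_diff_subset_collar hCR ht.le)).trans
      ((volume_collar_mul_le K ht ht1 R).trans (mul_le_mul_right (measure_mono (collar_subset K R)) _))
  have hfin : volume ((K : Set (E n)) + Metric.closedBall (0 : E n) R) ≠ ∞ :=
    (K.isCompact.add (isCompact_closedBall _ _)).measure_lt_top.ne
  have := ENNReal.toReal_mono (ENNReal.mul_ne_top ENNReal.ofReal_ne_top hfin) h
  rwa [ENNReal.toReal_mul, ENNReal.toReal_ofReal ht.le] at this

theorem dilationQuot_one {C : Body n} (hC : (0 : E n) ∈ C) (K : Body n) (t : ℝ) :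
    dilationQuot 1 C K t =
      t⁻¹ * (volume.real ((K : Set (E n)) + t • (C : Set (E n))) - volume.real (K : Set (E n))) ∧
    dilationQuot 1 C K t = t⁻¹ * volume.real (((K : Set (E n)) + t • (C : Set (E n))) \ K) := by
  have h1 : dilationQuot 1 C K t =
      t⁻¹ * (volume.real ((K : Set (E n)) + t • (C : Set (E n))) - volume.real (K : Set (E n))) := by
    simp [dilationQuot]
  refine ⟨h1, ?_⟩
  rw [h1, measureReal_sdiff (subset_add_smul hC _ _) K.isClosed.measurableSet
    (isCompact_add_smul K.isCompact C t).measure_lt_top.ne]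

theorem norm_dilationQuot_one_le (K : Body n) {C : Body n} (hC : IsProbe C) {R : ℝ}
    (hCR : (C : Set (E n)) ⊆ Metric.closedBall 0 R) {t : ℝ} (ht : 0 < t) (ht1 : t ≤ 1) :
    ‖dilationQuot 1 C K t‖ ≤ volume.real ((K : Set (E n)) + Metric.closedBall (0 : E n) R) := by
  rw [(dilationQuot_one hC.zero_mem K t).2, Real.norm_of_nonneg (by positivity),
    inv_mul_le_iff₀ ht]
  exact volume_add_smul_diff_le K hCR ht ht1

theorem measurable_dilationQuot_one {C : Body n} (hC : IsProbe C) (t : ℝ) :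
    Measurable fun K : Body n => dilationQuot 1 C K t := by
  simp only [(dilationQuot_one hC.zero_mem _ t).1]
  refine Measurable.const_mul (Measurable.sub ?_ ?_) _
  · exact (measurable_volume_add (C.isCompact.smul t)).ennreal_toReal
  · have := (measurable_volume_add (n := n) (isCompact_singleton (x := (0 : E n)))).ennreal_toReal
    simpa [Measure.real] using this

variable [Nonempty (Sph n)]

/-- Dominated convergence with majorant `λ(K + R Bⁿ)`. Measurability of the surface integral in `K`
also comes from here, as a limit of volume quotients. -/
theorem tendsto_integral_dilationQuot_one (hn : 0 < n)
    (hQ : ∫⁻ K, volume ((K : Set (E n)) + Metric.closedBall (0 : E n) 1) ∂Q < ∞) {C : Body n}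
    (hC : IsProbe C) :
    Integrable (fun K : Body n => ∫ z, suppFun C z.2 ∂surfMeasure K) Q ∧
    Tendsto (fun t => ∫ K : Body n, dilationQuot 1 C K t ∂Q) (𝓝[>] 0)
      (𝓝 (∫ K : Body n, ∫ z, suppFun C z.2 ∂surfMeasure K ∂Q)) := by
  obtain ⟨R, hR, hCR⟩ := exists_subset_closedBall C
  have hlim : ∀ K : Body n, Tendsto (dilationQuot 1 C K) (𝓝[>] 0)
      (𝓝 (∫ z, suppFun C z.2 ∂surfMeasure K)) := fun K => by
    simpa using tendsto_dilationQuot_body hn K hC (h := 1) continuous_one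
  have hbd : ∀ᶠ t : ℝ in 𝓝[>] 0, ∀ K : Body n,
      ‖dilationQuot 1 C K t‖ ≤ volume.real ((K : Set (E n)) + Metric.closedBall (0 : E n) R) := by
    filter_upwards [Ioc_mem_nhdsGT (zero_lt_one : (0 : ℝ) < 1)] with t ht K
    exact norm_dilationQuot_one_le K hC hCR ht.1 ht.2
  have hInt := integrable_volume_add hQ (isCompact_closedBall (0 : E n) R)
  constructor
  · refine hInt.mono' ?_ (Eventually.of_forall fun K => ?_)
    · exact aestronglyMeasurable_of_tendsto_ae (𝓝[>] (0 : ℝ))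
        (fun t => (measurable_dilationQuot_one hC t).aestronglyMeasurable)
        (Eventually.of_forall hlim)
    · exact le_of_tendsto (hlim K).norm (hbd.mono fun t h => h K)
  · exact tendsto_integral_filter_of_dominated_convergence _
      (Eventually.of_forall fun t => (measurable_dilationQuot_one hC t).aestronglyMeasurable)
      (hbd.mono fun t h => Eventually.of_forall h) hInt (Eventually.of_forall hlim)

theorem surfMeasure_real_univ_le (K : Body n) :
    (surfMeasure K).real univ ≤ volume.real ((K : Set (E n)) + Metric.closedBall (0 : E n) 1) :=
  ENNReal.toReal_mono (K.isCompact.add (isCompact_closedBall _ _)).measure_lt_top.ne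
    ((surfMeasure_univ_le K).trans (measure_mono (collar_subset K 1)))

/-- Measurability passes from support functions to `g` by uniform approximation; the total mass of
`surfMeasure K` gives the majorant. -/
theorem integrable_integral_surfMeasure (hn : 0 < n)
    (hQ : ∫⁻ K, volume ((K : Set (E n)) + Metric.closedBall (0 : E n) 1) ∂Q < ∞)
    (g : C(Sph n, ℝ)) : Integrable (fun K : Body n => ∫ z, g z.2 ∂surfMeasure K) Q := by
  choose C C' hC hC' hg using fun k : ℕ =>
    exists_suppFun_sub_suppFun_near g (ε := 1 / ((k : ℝ) + 1)) (by positivity)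
  have happ : ∀ (k : ℕ) (K : Body n), |(∫ z, g z.2 ∂surfMeasure K) -
      ((∫ z, suppFun (C k) z.2 ∂surfMeasure K) - ∫ z, suppFun (C' k) z.2 ∂surfMeasure K)| ≤
      1 / ((k : ℝ) + 1) * (surfMeasure K).real univ := by
    intro k K
    have := abs_integral_sub_suppFun_le K.isCompact (ae_surfMeasure_mem K) (f := 1)
      continuous_one (M := 1) (by simp) (by positivity) (hg k)
    simpa using this
  refine ((integrable_volume_add hQ (isCompact_closedBall (0 : E n) 1)).const_mul ‖g‖).mono' ?_ ?_
  · refine aestronglyMeasurable_of_tendsto_ae atTop (fun k : ℕ =>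
      ((tendsto_integral_dilationQuot_one hn hQ (hC k)).1.sub
        (tendsto_integral_dilationQuot_one hn hQ (hC' k)).1).aestronglyMeasurable)
      (Eventually.of_forall fun K => ?_)
    rw [tendsto_iff_dist_tendsto_zero]
    have hz := (tendsto_one_div_add_atTop_nhds_zero_nat (𝕜 := ℝ)).mul_const
      ((surfMeasure K).real univ)
    rw [zero_mul] at hz
    refine squeeze_zero (fun _ => dist_nonneg) (fun k => ?_) hz
    rw [dist_comm, Real.dist_eq]
    exact happ k K
  · refine Eventually.of_forall fun K => ?_
    refine (norm_integral_le_of_norm_le_const (C := ‖g‖)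
      (Eventually.of_forall fun z => g.norm_coe_le_norm _)).trans ?_
    gcongr
    exact surfMeasure_real_univ_le K

end Grain

end

section

variable {n : ℕ}

/-! ### The intensity measure of the particle process -/

theorem particleIntensity_hitSet (γ : ℝ) (Q : Measure (Body n)) {S : Set (E n)}
    (hS : IsCompact S) : particleIntensity γ Q (hitSet S) =
      ENNReal.ofReal γ * ∫⁻ K, volume {z : E n | translate K z ∈ hitSet S} ∂Q := by
  rw [particleIntensity, Measure.smul_apply, smul_eq_mul,
    Measure.map_apply measurable_translate (measurableSet_hitSet hS),
    Measure.prod_apply (measurable_translate (measurableSet_hitSet hS))]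
  rfl

theorem isCompact_singleton_sub (x : E n) {B : Set (E n)} (hB : IsCompact B) :
    IsCompact ({x} - B) := by
  rw [sub_eq_add_neg]
  exact isCompact_singleton.add hB.neg

/-- `K + z` hits `x - B` exactly when `x - z ∈ K + B`, and `z ↦ x - z` preserves volume. In
particular the value does not depend on `x`. -/
theorem particleIntensity_hitSet_sub (γ : ℝ) (Q : Measure (Body n)) {B : Set (E n)}
    (hB : IsCompact B) (x : E n) : particleIntensity γ Q (hitSet ({x} - B)) =
      ENNReal.ofReal γ * ∫⁻ K, volume ((K : Set (E n)) + B) ∂Q := by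
  rw [particleIntensity_hitSet γ Q (isCompact_singleton_sub x hB)]
  congr 1
  refine lintegral_congr fun K => ?_
  have hm : MeasurableSet ((K : Set (E n)) + B) := (K.isCompact.add hB).measurableSet
  rw [← (volume.measurePreserving_sub_left x).measure_preimage hm.nullMeasurableSet]
  congr 1
  ext z
  constructor
  · rintro ⟨y, hy, hyB⟩
    rw [singleton_sub, mem_image] at hyB
    obtain ⟨b, hb, rfl⟩ := hyB
    exact ⟨x - b - z, mem_translate.1 hy, b, hb, by simp only; abel⟩
  · rintro ⟨k, hk, b, hb, hkb⟩
    refine ⟨x - b, mem_translate.2 ?_, by rw [singleton_sub]; exact ⟨b, hb, rfl⟩⟩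
    have : k + b = x - z := hkb
    rwa [show x - b - z = k by rw [sub_right_comm, ← this]; simp]

theorem hitSet_mono {S T : Set (E n)} (h : S ⊆ T) : hitSet S ⊆ hitSet T := fun _ hK =>
  hK.mono (inter_subset_inter_right _ h)

theorem particleIntensity_hitSet_lt_top {γ : ℝ} {Q : Measure (Body n)}
    (hQ : ∫⁻ K, volume ((K : Set (E n)) + Metric.closedBall (0 : E n) 1) ∂Q < ∞) {S : Set (E n)}
    (hS : IsCompact S) : particleIntensity γ Q (hitSet S) < ∞ := by
  have h : S = {0} - (-S) := by simp
  rw [h, particleIntensity_hitSet_sub γ Q hS.neg]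
  exact ENNReal.mul_lt_top ENNReal.ofReal_lt_top (lintegral_volume_add_lt_top hQ hS.neg.isBounded)

/-- The intensity of the particles that hit `S`. -/
def hitRate (γ : ℝ) (Q : Measure (Body n)) (S : Set (E n)) : ℝ :=
  (particleIntensity γ Q (hitSet S)).toReal

theorem hitRate_mono {γ : ℝ} {Q : Measure (Body n)}
    (hQ : ∫⁻ K, volume ((K : Set (E n)) + Metric.closedBall (0 : E n) 1) ∂Q < ∞) {S T : Set (E n)}
    (hT : IsCompact T) (h : S ⊆ T) : hitRate γ Q S ≤ hitRate γ Q T :=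
  ENNReal.toReal_mono (particleIntensity_hitSet_lt_top hQ hT).ne (measure_mono (hitSet_mono h))

theorem hitRate_sub {γ : ℝ} (hγ : 0 ≤ γ) (Q : Measure (Body n)) {B : Set (E n)} (hB : IsCompact B) (x : E n) :
    hitRate γ Q ({x} - B) = γ * ∫ K, volume.real ((K : Set (E n)) + B) ∂Q := by
  rw [hitRate, particleIntensity_hitSet_sub γ Q hB, ENNReal.toReal_mul, ENNReal.toReal_ofReal hγ]
  congr 1
  refine (integral_toReal (measurable_volume_add hB).aemeasurable (Eventually.of_forall fun K => ?_)).symm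
  exact (K.isCompact.add hB).measure_lt_top

/-! ### Hitting probabilities of the Boolean model -/

section Model

variable {Ω : Type*} {X : Ω → Set (Body n)}

theorem unionSet_inter_nonempty_iff (ω : Ω) (S : Set (E n)) :
    (unionSet X ω ∩ S).Nonempty ↔ (X ω ∩ hitSet S).encard ≠ 0 := by
  rw [encard_ne_zero]
  constructor
  · rintro ⟨x, hx, hxS⟩
    obtain ⟨K, hK, hxK⟩ := mem_iUnion₂.1 hx
    exact ⟨K, hK, x, hxK, hxS⟩
  · rintro ⟨K, hK, x, hxK, hxS⟩
    exact ⟨x, mem_iUnion₂.2 ⟨K, hK, hxK⟩, hxS⟩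

theorem unionSet_inter_eq_bodyUnion (W : Body n) {ω : Ω}
    (h : (X ω ∩ hitSet (W : Set (E n))).Finite) :
    ∃ l : List (Body n), l.length ≤ (X ω ∩ hitSet (W : Set (E n))).ncard ∧
      (∀ K ∈ l, (K : Set (E n)) ⊆ W) ∧ unionSet X ω ∩ W = bodyUnion l := by
  refine ⟨h.toFinset.toList.filterMap (interBody W), ?_, ?_, ?_⟩
  · refine (List.length_filterMap_le _ _).trans ?_
    rw [Finset.length_toList, ncard_eq_toFinset_card _ h]
  · intro K hK
    obtain ⟨L, -, hL⟩ := List.mem_filterMap.1 hK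
    rw [coe_eq_inter_of_interBody hL]
    exact inter_subset_left
  · rw [← inter_bodyUnion]
    ext x
    simp only [mem_inter_iff, mem_bodyUnion, Finset.mem_toList, Finite.mem_toFinset, unionSet,
      mem_iUnion, exists_prop]
    constructor
    · rintro ⟨⟨K, hK, hx⟩, hW⟩
      exact ⟨hW, K, ⟨hK, x, hx, hW⟩, hx⟩
    · rintro ⟨hW, K, ⟨hK, -⟩, hx⟩
      exact ⟨⟨K, hK, hx⟩, hW⟩

variable [MeasurableSpace Ω] {P : Measure Ω} {γ : ℝ} {Q : Measure (Body n)}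

theorem IsBooleanModel.measurable_count (hX : IsBooleanModel P γ Q X) {S : Set (E n)}
    (hS : IsCompact S) : Measurable fun ω => (X ω ∩ hitSet S).encard :=
  hX.poisson.measurable_count _ (measurableSet_hitSet hS)

theorem IsBooleanModel.measurableSet_hit (hX : IsBooleanModel P γ Q X) {S : Set (E n)}
    (hS : IsCompact S) : MeasurableSet {ω | (unionSet X ω ∩ S).Nonempty} := by
  simp only [unionSet_inter_nonempty_iff]
  exact hX.measurable_count hS (MeasurableSet.of_discrete (s := {0}ᶜ))

theorem IsBooleanModel.map_count (hX : IsBooleanModel P γ Q X) {S : Set (E n)}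
    (hS : IsCompact S) : P.map (fun ω => (X ω ∩ hitSet S).encard) =
      (poissonMeasure (particleIntensity γ Q (hitSet S)).toNNReal).map (Nat.cast : ℕ → ℕ∞) :=
  hX.poisson.poisson_count _ (measurableSet_hitSet hS)
    (particleIntensity_hitSet_lt_top hX.grain_integrable hS).ne

/-- The union misses `S` exactly when the Poisson number of particles hitting `S` is zero. -/
theorem IsBooleanModel.measureReal_hit [IsProbabilityMeasure P] (hX : IsBooleanModel P γ Q X)
    {S : Set (E n)} (hS : IsCompact S) :
    P.real {ω | (unionSet X ω ∩ S).Nonempty} = 1 - Real.exp (-hitRate γ Q S) := by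
  have h := congrArg (Measure.real · {(0 : ℕ∞)}) (hX.map_count hS)
  rw [map_measureReal_apply (hX.measurable_count hS) .of_discrete,
    map_measureReal_apply .of_discrete .of_discrete] at h
  have h0 : (Nat.cast : ℕ → ℕ∞) ⁻¹' {0} = {0} := by ext; simp
  rw [h0, poissonMeasure_real_singleton] at h
  have hc : {ω | (unionSet X ω ∩ S).Nonempty} =
      ((fun ω => (X ω ∩ hitSet S).encard) ⁻¹' {0})ᶜ := by
    ext ω
    simp only [mem_ofPred_eq, unionSet_inter_nonempty_iff]
    rfl
  rw [hc, probReal_compl_eq_one_sub (hX.measurable_count hS .of_discrete), h]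
  simp [hitRate, ENNReal.coe_toNNReal_eq_toReal]

theorem IsBooleanModel.ae_finite (hX : IsBooleanModel P γ Q X) {S : Set (E n)}
    (hS : IsCompact S) : ∀ᵐ ω ∂P, (X ω ∩ hitSet S).Finite := by
  have h := congrArg (fun m => m {(⊤ : ℕ∞)}) (hX.map_count hS)
  rw [Measure.map_apply (hX.measurable_count hS) .of_discrete,
    Measure.map_apply .of_discrete .of_discrete] at h
  have h0 : (Nat.cast : ℕ → ℕ∞) ⁻¹' {⊤} = ∅ := by ext; simp
  rw [h0, measure_empty] at h
  filter_upwards [measure_eq_zero_iff_ae_notMem.1 h] with ω hω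
  rw [← encard_ne_top_iff]
  exact hω

/-- The Poisson generating function is finite at `3`, the base of the mass bound for surface
measures. -/
theorem IsBooleanModel.integrable_pow_ncard (hX : IsBooleanModel P γ Q X) {S : Set (E n)}
    (hS : IsCompact S) : Integrable (fun ω => (3 : ℝ) ^ (X ω ∩ hitSet S).ncard) P := by
  have hf : Integrable (fun k : ℕ∞ => (3 : ℝ) ^ k.toNat)
      (P.map fun ω => (X ω ∩ hitSet S).encard) := by
    rw [hX.map_count hS, integrable_map_cast_poissonMeasure_iff, integrable_poissonMeasure_iff]
    set r := (particleIntensity γ Q (hitSet S)).toNNReal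
    refine ((Real.summable_pow_div_factorial (r * 3)).mul_left (Real.exp (-r))).congr fun k => ?_
    simp only [Function.comp, ENat.toNat_natCast, norm_pow, Real.norm_ofNat, mul_pow]
    ring
  exact (integrable_map_measure .of_discrete (hX.measurable_count hS).aemeasurable).1 hf

theorem IsBooleanModel.ae_polyconvex (hX : IsBooleanModel P γ Q X) (W : Body n) :
    ∀ᵐ ω ∂P, Polyconvex (unionSet X ω ∩ W) := by
  filter_upwards [hX.ae_finite W.isCompact] with ω hω
  obtain ⟨l, -, -, hl⟩ := unionSet_inter_eq_bodyUnion W hω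
  rw [hl]
  exact polyconvex_iff.2 ⟨l, rfl⟩

/-! ### Expected integrals over dilations of the Boolean model -/

theorem mem_inter_add_iff {Z W B : Set (E n)} {x : E n} :
    x ∈ Z ∩ W + B ↔ (Z ∩ (W ∩ ({x} - B))).Nonempty := by
  constructor
  · rintro ⟨a, ha, b, hb, rfl⟩
    refine ⟨a, ha.1, ha.2, ?_⟩
    rw [singleton_sub]
    exact ⟨b, hb, by simp⟩
  · rintro ⟨a, haZ, haW, ha⟩
    rw [singleton_sub] at ha
    obtain ⟨b, hb, rfl⟩ := ha
    exact ⟨x - b, ⟨haZ, haW⟩, b, hb, by simp⟩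

/-- The distance is less than `r` when `Z ∩ W` meets a certain open set. Writing that set as a
countable union of closed sets turns this into a union of hitting events of compact sets. -/
theorem IsBooleanModel.measurable_infEDist (hX : IsBooleanModel P γ Q X) (W : Body n)
    (B : Set (E n)) (x : E n) :
    Measurable fun ω => Metric.infEDist x (unionSet X ω ∩ W + B) := by
  refine measurable_of_Iio fun r => ?_
  have hO : IsOpen {a : E n | ∃ b ∈ B, edist x (a + b) < r} := by
    have : {a : E n | ∃ b ∈ B, edist x (a + b) < r} = ⋃ b ∈ B, {a | edist x (a + b) < r} := by
      ext a; simp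
    rw [this]
    exact isOpen_biUnion fun b _ => isOpen_lt (by fun_prop) continuous_const
  obtain ⟨F, hF, -, hFU, -⟩ := hO.exists_iUnion_isClosed
  have hset : (fun ω => Metric.infEDist x (unionSet X ω ∩ W + B)) ⁻¹' Iio r =
      ⋃ k, {ω | (unionSet X ω ∩ ((W : Set (E n)) ∩ F k)).Nonempty} := by
    ext ω
    simp only [mem_preimage, mem_Iio, Metric.infEDist_lt_iff, mem_iUnion, mem_ofPred_eq]
    constructor
    · rintro ⟨_, ⟨a, ha, b, hb, rfl⟩, hr⟩
      have : a ∈ ⋃ k, F k := by rw [hFU]; exact ⟨b, hb, hr⟩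
      obtain ⟨k, hk⟩ := mem_iUnion.1 this
      exact ⟨k, a, ha.1, ha.2, hk⟩
    · rintro ⟨k, a, haZ, haW, hk⟩
      have : a ∈ ⋃ k, F k := mem_iUnion.2 ⟨k, hk⟩
      rw [hFU] at this
      obtain ⟨b, hb, hr⟩ := this
      exact ⟨a + b, ⟨a, ⟨haZ, haW⟩, b, hb, rfl⟩, hr⟩
  rw [hset]
  exact MeasurableSet.iUnion fun k => hX.measurableSet_hit (W.isCompact.inter_right (hF k))

/-- The distance is continuous in the point and measurable in `ω`, hence jointly measurable. The
closure is taken because polyconvexity of `Z ∩ W` holds only almost surely. -/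
theorem IsBooleanModel.measurableSet_mem_closure (hX : IsBooleanModel P γ Q X) (W : Body n)
    (B : Set (E n)) :
    MeasurableSet {z : Ω × E n | z.2 ∈ closure (unionSet X z.1 ∩ W + B)} := by
  have h := measurable_uncurry_of_continuous_of_measurable
    (u := fun (x : E n) ω => Metric.infEDist x (unionSet X ω ∩ W + B))
    (fun ω => Metric.continuous_infEDist) (hX.measurable_infEDist W B)
  have := (h.comp measurable_swap) (measurableSet_singleton (0 : ℝ≥0∞))
  convert! this using 1
  ext z
  exact Metric.mem_closure_iff_infEDist_zero

/-- Fubini, with the probability that `x` belongs to `(Z ∩ W) + B` expressed as the probability that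
`Z` hits `W ∩ (x - B)`. -/
theorem IsBooleanModel.integral_setIntegral_add [IsProbabilityMeasure P]
    (hX : IsBooleanModel P γ Q X) (W : Body n) {B : Set (E n)} (hB : IsCompact B) {h : E n → ℝ}
    (hh : Continuous h) :
    Integrable (fun ω => ∫ x in unionSet X ω ∩ W + B, h x) P ∧
    IntegrableOn (fun x => h x * (1 - Real.exp (-hitRate γ Q ((W : Set (E n)) ∩ ({x} - B)))))
      ((W : Set (E n)) + B) ∧
    ∫ ω, (∫ x in unionSet X ω ∩ W + B, h x) ∂P =
      ∫ x in (W : Set (E n)) + B, h x *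
        (1 - Real.exp (-hitRate γ Q ((W : Set (E n)) ∩ ({x} - B)))) := by
  set M := {z : Ω × E n | z.2 ∈ closure (unionSet X z.1 ∩ W + B)} with hM
  have hMm : MeasurableSet M := hX.measurableSet_mem_closure W B
  have hWB : IsCompact ((W : Set (E n)) + B) := W.isCompact.add hB
  set f : Ω × E n → ℝ := M.indicator fun z => ((W : Set (E n)) + B).indicator h z.2 with hf
  have hInt : Integrable f (P.prod volume) := by
    refine Integrable.indicator ?_ hMm
    have := (integrable_indicator_iff hWB.measurableSet).2
      (hh.continuousOn.integrableOn_compact (μ := volume) hWB)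
    exact this.comp_snd P
  have hcl : ∀ᵐ ω ∂P, closure (unionSet X ω ∩ W + B) = unionSet X ω ∩ W + B := by
    filter_upwards [hX.ae_polyconvex W] with ω hω
    exact (hω.isCompact.add hB).isClosed.closure_eq
  have hsub : ∀ ω, unionSet X ω ∩ W + B ⊆ (W : Set (E n)) + B := fun ω =>
    add_subset_add_right inter_subset_right
  have hJ : (fun ω => ∫ x in unionSet X ω ∩ W + B, h x) =ᵐ[P] fun ω => ∫ x, f (ω, x) := by
    filter_upwards [hX.ae_polyconvex W, hcl] with ω hω hc
    rw [← integral_indicator (hω.isCompact.add hB).measurableSet]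
    refine integral_congr_ae (Eventually.of_forall fun x => ?_)
    have hmem : (ω, x) ∈ M ↔ x ∈ unionSet X ω ∩ W + B := by
      change x ∈ closure _ ↔ _
      rw [hc]
    change _ = f (ω, x)
    by_cases hx : x ∈ unionSet X ω ∩ W + B
    · rw [hf, indicator_of_mem hx, indicator_of_mem (hmem.2 hx), indicator_of_mem (hsub ω hx)]
    · rw [hf, indicator_of_notMem hx, indicator_of_notMem (mt hmem.1 hx)]
  have hx : ∀ x, ∫ ω, f (ω, x) ∂P = ((W : Set (E n)) + B).indicator
      (fun x => h x * (1 - Real.exp (-hitRate γ Q ((W : Set (E n)) ∩ ({x} - B))))) x := by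
    intro x
    have hS : IsCompact ((W : Set (E n)) ∩ ({x} - B)) :=
      W.isCompact.inter (isCompact_singleton_sub x hB)
    have hfx : (fun ω => f (ω, x)) =ᵐ[P]
        {ω | (unionSet X ω ∩ ((W : Set (E n)) ∩ ({x} - B))).Nonempty}.indicator
          fun _ => ((W : Set (E n)) + B).indicator h x := by
      filter_upwards [hcl] with ω hc
      have hmem : (ω, x) ∈ M ↔ (unionSet X ω ∩ ((W : Set (E n)) ∩ ({x} - B))).Nonempty := by
        rw [← mem_inter_add_iff]
        change x ∈ closure _ ↔ _
        rw [hc]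
      by_cases hx : ω ∈ {ω | (unionSet X ω ∩ ((W : Set (E n)) ∩ ({x} - B))).Nonempty}
      · rw [hf, indicator_of_mem (hmem.2 hx), indicator_of_mem hx]
      · rw [hf, indicator_of_notMem (mt hmem.1 hx), indicator_of_notMem hx]
    rw [integral_congr_ae hfx, integral_indicator_const _ (hX.measurableSet_hit hS),
      hX.measureReal_hit hS, smul_eq_mul, mul_comm]
    by_cases hxW : x ∈ (W : Set (E n)) + B
    · simp [hxW]
    · simp [hxW]
  refine ⟨hInt.integral_prod_left.congr hJ.symm, ?_, ?_⟩
  · rw [← integrable_indicator_iff hWB.measurableSet]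
    exact hInt.integral_prod_right.congr (Eventually.of_forall hx)
  · rw [integral_congr_ae hJ, integral_integral_swap (f := fun ω x => f (ω, x)) hInt,
      ← integral_indicator hWB.measurableSet]
    exact integral_congr_ae (Eventually.of_forall hx)

end Model

end

section

variable {n : ℕ}

/-! ### Hitting rates of small sets -/

theorem hitRate_singleton {γ : ℝ} (hγ : 0 ≤ γ) (Q : Measure (Body n)) (x : E n) :
    hitRate γ Q {x} = volumeDensity γ Q := by
  have := hitRate_sub hγ Q (isCompact_singleton (x := (0 : E n))) x
  simpa [volumeDensity] using this

/-- The hitting rate of the translates of `-t C`. -/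
def dilatedDensity (γ : ℝ) (Q : Measure (Body n)) (C : Body n) (t : ℝ) : ℝ :=
  γ * ∫ K, volume.real ((K : Set (E n)) + t • (C : Set (E n))) ∂Q

theorem hitRate_sub_smul {γ : ℝ} (hγ : 0 ≤ γ) (Q : Measure (Body n)) (C : Body n) (t : ℝ)
    (x : E n) : hitRate γ Q ({x} - t • (C : Set (E n))) = dilatedDensity γ Q C t :=
  hitRate_sub hγ Q (C.isCompact.smul t) x

theorem mem_add_iff_inter_sub_nonempty {W B : Set (E n)} {x : E n} :
    x ∈ W + B ↔ (W ∩ ({x} - B)).Nonempty := by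
  simpa using mem_inter_add_iff (Z := univ) (W := W) (B := B) (x := x)

/-- The set `W ∩ (x - tC)` contains a point and is contained in `x - tC`. This keeps the hitting
rate within `O(t)` of the volume density, even near the boundary of `W`. -/
theorem hitRate_inter_mem_Icc {γ : ℝ} (hγ : 0 ≤ γ) {Q : Measure (Body n)}
    (hQ : ∫⁻ K, volume ((K : Set (E n)) + Metric.closedBall (0 : E n) 1) ∂Q < ∞) (W C : Body n)
    (t : ℝ) {x : E n} (hx : x ∈ (W : Set (E n)) + t • (C : Set (E n))) :
    hitRate γ Q ((W : Set (E n)) ∩ ({x} - t • (C : Set (E n)))) ∈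
      Icc (volumeDensity γ Q) (dilatedDensity γ Q C t) := by
  have hc := isCompact_singleton_sub x (C.isCompact.smul t)
  constructor
  · obtain ⟨y, hy⟩ := mem_add_iff_inter_sub_nonempty.1 hx
    rw [← hitRate_singleton hγ Q y]
    exact hitRate_mono hQ (W.isCompact.inter hc) (singleton_subset_iff.2 hy)
  · rw [← hitRate_sub_smul hγ Q C t x]
    exact hitRate_mono hQ hc inter_subset_right

theorem abs_exp_sub_exp_le {a b c : ℝ} (ha : 0 ≤ a) (hb : b ∈ Icc a c) :
    |Real.exp (-a) - Real.exp (-b)| ≤ c - a := by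
  have h1 : Real.exp (-b) ≤ Real.exp (-a) := Real.exp_le_exp.2 (by linarith [hb.1])
  have h2 : Real.exp (-a) ≤ 1 := Real.exp_le_one_iff.2 (by linarith)
  have h3 : Real.exp (-b) = Real.exp (-a) * Real.exp (-(b - a)) := by
    rw [← Real.exp_add]; congr 1; ring
  have h4 := Real.add_one_le_exp (-(b - a))
  rw [abs_of_nonneg (by linarith)]
  have h5 := Real.exp_pos (-a)
  nlinarith [hb.1, hb.2]

theorem volumeDensity_nonneg {γ : ℝ} (hγ : 0 ≤ γ) (Q : Measure (Body n)) :
    0 ≤ volumeDensity γ Q :=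
  mul_nonneg hγ (integral_nonneg fun _ => measureReal_nonneg)

theorem dilatedDensity_sub {γ : ℝ} {Q : Measure (Body n)}
    (hQ : ∫⁻ K, volume ((K : Set (E n)) + Metric.closedBall (0 : E n) 1) ∂Q < ∞) {C : Body n}
    (hC : IsProbe C) (t : ℝ) :
    t⁻¹ * (dilatedDensity γ Q C t - volumeDensity γ Q) =
      γ * ∫ K : Body n, dilationQuot 1 C K t ∂Q := by
  simp only [(dilationQuot_one hC.zero_mem _ t).1]
  rw [integral_const_mul, integral_sub (integrable_volume_add hQ (C.isCompact.smul t))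
    (integrable_volume_body hQ), dilatedDensity, volumeDensity]
  ring

theorem dilatedDensity_sub_le {γ : ℝ} (hγ : 0 ≤ γ) {Q : Measure (Body n)}
    (hQ : ∫⁻ K, volume ((K : Set (E n)) + Metric.closedBall (0 : E n) 1) ∂Q < ∞) {C : Body n}
    (hC : IsProbe C) {R : ℝ} (hCR : (C : Set (E n)) ⊆ Metric.closedBall 0 R) {t : ℝ} (ht : 0 < t)
    (ht1 : t ≤ 1) : t⁻¹ * (dilatedDensity γ Q C t - volumeDensity γ Q) ≤
      γ * ∫ K : Body n, volume.real ((K : Set (E n)) + Metric.closedBall (0 : E n) R) ∂Q := by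
  rw [dilatedDensity_sub hQ hC]
  refine mul_le_mul_of_nonneg_left ?_ hγ
  refine integral_mono_of_nonneg (Eventually.of_forall fun K => ?_)
    (integrable_volume_add hQ (isCompact_closedBall _ _)) (Eventually.of_forall fun K => ?_)
  · simp only [Pi.zero_apply, (dilationQuot_one hC.zero_mem _ t).2]
    positivity
  · exact (le_abs_self _).trans (norm_dilationQuot_one_le K hC hCR ht ht1)

theorem eventually_sub_smul_subset {W : Set (E n)} {x : E n} (hx : x ∈ interior W) (C : Body n) :
    ∀ᶠ t : ℝ in 𝓝[>] 0, {x} - t • (C : Set (E n)) ⊆ W := by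
  obtain ⟨δ, hδ, hb⟩ := Metric.isOpen_iff.1 isOpen_interior x hx
  obtain ⟨R, hR, hCR⟩ := exists_subset_closedBall C
  filter_upwards [Ioo_mem_nhdsGT (show (0 : ℝ) < δ / R by positivity)] with t ht
  rw [singleton_sub]
  rintro _ ⟨_, ⟨c, hc, rfl⟩, rfl⟩
  refine interior_subset (hb ?_)
  have hc' : ‖c‖ ≤ R := by simpa using hCR hc
  rw [Metric.mem_ball, dist_eq_norm]
  simp only [sub_sub_cancel_left, norm_neg, norm_smul, Real.norm_of_nonneg ht.1.le]
  calc t * ‖c‖ ≤ t * R := by gcongr; exact ht.1.le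
    _ < δ / R * R := by gcongr; exact ht.2
    _ = δ := by field_simp

theorem ae_mem_interior (W : Body n) :
    ∀ᵐ x ∂volume.restrict (W : Set (E n)), x ∈ interior (W : Set (E n)) := by
  rw [ae_restrict_iff' W.isClosed.measurableSet]
  filter_upwards [measure_eq_zero_iff_ae_notMem.1 (W.convex.addHaar_frontier volume)] with x hx hxW
  by_contra h
  exact hx ⟨subset_closure hxW, h⟩

section Limit

variable [Nonempty (Sph n)] {γ : ℝ} {Q : Measure (Body n)}

theorem tendsto_dilatedDensity_sub (hn : 0 < n)
    (hQ : ∫⁻ K, volume ((K : Set (E n)) + Metric.closedBall (0 : E n) 1) ∂Q < ∞) {C : Body n}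
    (hC : IsProbe C) :
    Tendsto (fun t => t⁻¹ * (dilatedDensity γ Q C t - volumeDensity γ Q)) (𝓝[>] 0)
      (𝓝 (γ * ∫ K : Body n, ∫ z, suppFun C z.2 ∂surfMeasure K ∂Q)) := by
  simp only [dilatedDensity_sub hQ hC]
  exact (tendsto_integral_dilationQuot_one hn hQ hC).2.const_mul γ

theorem tendsto_dilatedDensity (hn : 0 < n)
    (hQ : ∫⁻ K, volume ((K : Set (E n)) + Metric.closedBall (0 : E n) 1) ∂Q < ∞) {C : Body n}
    (hC : IsProbe C) :
    Tendsto (fun t => dilatedDensity γ Q C t - volumeDensity γ Q) (𝓝[>] 0) (𝓝 0) := by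
  have h := (tendsto_nhdsWithin_of_tendsto_nhds (s := Ioi 0) (tendsto_id (x := 𝓝 (0 : ℝ)))).mul
    (tendsto_dilatedDensity_sub (γ := γ) hn hQ hC)
  rw [zero_mul] at h
  refine h.congr' ?_
  filter_upwards [self_mem_nhdsWithin] with t ht
  have : t ≠ 0 := ne_of_gt ht
  simp only [id]
  field_simp

/-- Chain rule for `s ↦ exp(-s)`. Using `dslope` avoids a division by zero when the dilated density
equals the volume density. -/
theorem tendsto_exp_dilatedDensity (hn : 0 < n)
    (hQ : ∫⁻ K, volume ((K : Set (E n)) + Metric.closedBall (0 : E n) 1) ∂Q < ∞) {C : Body n}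
    (hC : IsProbe C) :
    Tendsto (fun t => t⁻¹ * (Real.exp (-volumeDensity γ Q) - Real.exp (-dilatedDensity γ Q C t)))
      (𝓝[>] 0) (𝓝 (Real.exp (-volumeDensity γ Q) *
        (γ * ∫ K : Body n, ∫ z, suppFun C z.2 ∂surfMeasure K ∂Q))) := by
  have hd : HasDerivAt (fun s : ℝ => Real.exp (-s)) (-Real.exp (-volumeDensity γ Q))
      (volumeDensity γ Q) := by
    simpa using (hasDerivAt_neg (volumeDensity γ Q)).exp
  have hV : Tendsto (dilatedDensity γ Q C) (𝓝[>] 0) (𝓝 (volumeDensity γ Q)) := by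
    simpa using (tendsto_dilatedDensity (γ := γ) hn hQ hC).add_const (volumeDensity γ Q)
  have hcont : ContinuousAt (dslope (fun s : ℝ => Real.exp (-s)) (volumeDensity γ Q))
      (volumeDensity γ Q) := continuousAt_dslope_same.2 hd.differentiableAt
  have h := (hcont.tendsto.comp hV).mul (tendsto_dilatedDensity_sub (γ := γ) hn hQ hC)
  rw [dslope_same, hd.deriv] at h
  have h' := h.neg
  rw [← neg_mul, neg_neg] at h'
  refine h'.congr fun t => ?_
  have := sub_smul_dslope (fun s : ℝ => Real.exp (-s)) (volumeDensity γ Q) (dilatedDensity γ Q C t)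
  simp only [smul_eq_mul] at this
  simp only [Function.comp]
  linear_combination (-t⁻¹) * this

end Limit

end

section

variable {n : ℕ}

/-! ### The limit of the expected difference quotients -/

section Model

variable {Ω : Type*} {X : Ω → Set (Body n)} [MeasurableSpace Ω] {P : Measure Ω} {γ : ℝ}
  {Q : Measure (Body n)}

theorem IsBooleanModel.integral_setIntegral [IsProbabilityMeasure P]
    (hX : IsBooleanModel P γ Q X) (W : Body n) {h : E n → ℝ} (hh : Continuous h) :
    Integrable (fun ω => ∫ x in unionSet X ω ∩ W, h x) P ∧
    ∫ ω, (∫ x in unionSet X ω ∩ W, h x) ∂P =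
      (1 - Real.exp (-volumeDensity γ Q)) * ∫ x in (W : Set (E n)), h x := by
  have key := hX.integral_setIntegral_add W (isCompact_singleton (x := (0 : E n))) hh
  simp only [add_singleton, add_zero, image_id', sub_singleton, image_singleton, sub_zero] at key
  refine ⟨key.1, key.2.2.trans ?_⟩
  rw [← integral_const_mul]
  refine setIntegral_congr_fun W.isClosed.measurableSet fun x hx => ?_
  rw [inter_eq_self_of_subset_right (singleton_subset_iff.2 hx),
    hitRate_singleton hX.intensity_pos.le, mul_comm]

/-- The difference quotient of the avoidance probability. -/
def avoidQuot (γ : ℝ) (Q : Measure (Body n)) (W C : Body n) (t : ℝ) (x : E n) : ℝ :=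
  t⁻¹ * (Real.exp (-volumeDensity γ Q) -
    Real.exp (-hitRate γ Q ((W : Set (E n)) ∩ ({x} - t • (C : Set (E n))))))

theorem abs_avoidQuot_le (hγ : 0 ≤ γ)
    (hQ : ∫⁻ K, volume ((K : Set (E n)) + Metric.closedBall (0 : E n) 1) ∂Q < ∞) (W : Body n)
    {C : Body n} (hC : IsProbe C) {R : ℝ} (hCR : (C : Set (E n)) ⊆ Metric.closedBall 0 R) {t : ℝ}
    (ht : 0 < t) (ht1 : t ≤ 1) {x : E n} (hx : x ∈ (W : Set (E n)) + t • (C : Set (E n))) :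
    |avoidQuot γ Q W C t x| ≤
      γ * ∫ K : Body n, volume.real ((K : Set (E n)) + Metric.closedBall (0 : E n) R) ∂Q := by
  rw [avoidQuot, abs_mul, abs_of_pos (inv_pos.2 ht)]
  refine le_trans ?_ (dilatedDensity_sub_le hγ hQ hC hCR ht ht1)
  gcongr
  exact abs_exp_sub_exp_le (volumeDensity_nonneg hγ Q) (hitRate_inter_mem_Icc hγ hQ W C t hx)

/-- Write the hitting probability as `(1 - exp(-V)) + t * avoidQuot`: the constant part gives the
quotient of `W` itself, and the rest is split into `W` and the layer around it. -/
theorem IsBooleanModel.integral_dilationQuot [IsProbabilityMeasure P]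
    (hX : IsBooleanModel P γ Q X) (W : Body n) {C : Body n} (hC : IsProbe C) {h : E n → ℝ}
    (hh : Continuous h) {t : ℝ} (ht : 0 < t) :
    Integrable (fun ω => dilationQuot h C (unionSet X ω ∩ W) t) P ∧
    IntegrableOn (fun x => h x * avoidQuot γ Q W C t x)
      ((W : Set (E n)) + t • (C : Set (E n))) ∧
    ∫ ω, dilationQuot h C (unionSet X ω ∩ W) t ∂P =
      (1 - Real.exp (-volumeDensity γ Q)) * dilationQuot h C W t +
        (∫ x in ((W : Set (E n)) + t • (C : Set (E n))) \ W, h x * avoidQuot γ Q W C t x) +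
        ∫ x in (W : Set (E n)), h x * avoidQuot γ Q W C t x := by
  obtain ⟨i1, e1⟩ := hX.integral_setIntegral W hh
  obtain ⟨i2, i3, e2⟩ := hX.integral_setIntegral_add W (C.isCompact.smul t) hh
  have hc := isCompact_add_smul W.isCompact C t
  have hhi : IntegrableOn h ((W : Set (E n)) + t • (C : Set (E n))) :=
    hh.continuousOn.integrableOn_compact hc
  have hp : (fun x => h x * (1 - Real.exp (-hitRate γ Q
      ((W : Set (E n)) ∩ ({x} - t • (C : Set (E n))))))) = fun x =>
      (1 - Real.exp (-volumeDensity γ Q)) * h x + t * (h x * avoidQuot γ Q W C t x) := by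
    ext x
    rw [avoidQuot]
    field_simp
    ring
  have hq : IntegrableOn (fun x => h x * avoidQuot γ Q W C t x)
      ((W : Set (E n)) + t • (C : Set (E n))) := by
    rw [hp] at i3
    have := (i3.sub (hhi.const_mul (1 - Real.exp (-volumeDensity γ Q)))).const_mul t⁻¹
    refine this.congr (Eventually.of_forall fun x => ?_)
    simp only [Pi.sub_apply]
    field_simp
    ring
  refine ⟨(i2.sub i1).const_mul _, hq, ?_⟩
  have hsub := subset_add_smul hC.zero_mem (W : Set (E n)) t
  simp only [dilationQuot]
  rw [integral_const_mul, integral_sub i2 i1, e1, e2, hp,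
    integral_add (hhi.const_mul _) (hq.const_mul t), integral_const_mul, integral_const_mul,
    setIntegral_sdiff W.isClosed.measurableSet hq hsub]
  field_simp
  ring

variable [Nonempty (Sph n)]

theorem IsBooleanModel.tendsto_integral_dilationQuot [IsProbabilityMeasure P] (hn : 0 < n)
    (hX : IsBooleanModel P γ Q X) (W : Body n) {C : Body n} (hC : IsProbe C) {h : E n → ℝ}
    (hh : Continuous h) :
    Tendsto (fun t => ∫ ω, dilationQuot h C (unionSet X ω ∩ W) t ∂P) (𝓝[>] 0)
      (𝓝 ((1 - Real.exp (-volumeDensity γ Q)) * (∫ z, h z.1 * suppFun C z.2 ∂surfMeasure W) +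
        (∫ x in (W : Set (E n)), h x) * (Real.exp (-volumeDensity γ Q) *
          (γ * ∫ K : Body n, ∫ z, suppFun C z.2 ∂surfMeasure K ∂Q)))) := by
  have hγ := hX.intensity_pos.le
  have hQ := hX.grain_integrable
  obtain ⟨R, hR, hCR⟩ := exists_subset_closedBall C
  have hWR : IsCompact ((W : Set (E n)) + Metric.closedBall (0 : E n) R) :=
    W.isCompact.add (isCompact_closedBall _ _)
  obtain ⟨M, hM⟩ := hWR.exists_bound_of_continuousOn hh.continuousOn
  set c := γ * ∫ K : Body n, volume.real ((K : Set (E n)) + Metric.closedBall (0 : E n) R) ∂Q with hc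
  have hc0 : 0 ≤ c := mul_nonneg hγ (integral_nonneg fun _ => measureReal_nonneg)
  have hM0 : 0 ≤ M := by
    obtain ⟨x, hx⟩ := W.nonempty
    exact (norm_nonneg _).trans (hM (x + 0) (add_mem_add hx (by simp [hR.le])))
  have hsub : ∀ t : ℝ, 0 < t → t ≤ 1 → (W : Set (E n)) + t • (C : Set (E n)) ⊆
      (W : Set (E n)) + Metric.closedBall (0 : E n) R := fun t ht ht1 =>
    (add_smul_subset_closedBall hCR ht.le _).trans
      (add_subset_add_left (Metric.closedBall_subset_closedBall (by nlinarith)))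
  have hbd : ∀ t : ℝ, 0 < t → t ≤ 1 → ∀ x ∈ (W : Set (E n)) + t • (C : Set (E n)),
      ‖h x * avoidQuot γ Q W C t x‖ ≤ M * c := by
    intro t ht ht1 x hx
    rw [norm_mul]
    exact mul_le_mul (hM x (hsub t ht ht1 hx)) (abs_avoidQuot_le hγ hQ W hC hCR ht ht1 hx)
      (norm_nonneg _) hM0
  have hsm : ∀ᶠ t : ℝ in 𝓝[>] 0, t ∈ Ioc (0 : ℝ) 1 := Ioc_mem_nhdsGT zero_lt_one
  have hid : Tendsto (fun t : ℝ => t) (𝓝[>] 0) (𝓝 0) := tendsto_nhdsWithin_of_tendsto_nhds tendsto_id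
  have l1 : Tendsto (dilationQuot h C W) (𝓝[>] 0)
      (𝓝 (∫ z, h z.1 * suppFun C z.2 ∂surfMeasure W)) := tendsto_dilationQuot_body hn W hC hh
  -- The integrand is bounded and the layer has volume `O(t)`.
  have l2 : Tendsto (fun t => ∫ x in ((W : Set (E n)) + t • (C : Set (E n))) \ W,
      h x * avoidQuot γ Q W C t x) (𝓝[>] 0) (𝓝 0) := by
    have hz := hid.mul_const (M * c * volume.real ((W : Set (E n)) + Metric.closedBall (0 : E n) R))
    rw [zero_mul] at hz
    refine squeeze_zero_norm' ?_ hz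
    filter_upwards [hsm] with t ht
    refine (norm_setIntegral_le_of_norm_le_const (C := M * c) ?_
      fun x hx => hbd t ht.1 ht.2 x hx.1).trans ?_
    · exact (measure_mono sdiff_subset).trans_lt
        (isCompact_add_smul W.isCompact C t).measure_lt_top
    · calc M * c * volume.real (((W : Set (E n)) + t • (C : Set (E n))) \ W)
          ≤ M * c * (t * volume.real ((W : Set (E n)) + Metric.closedBall (0 : E n) R)) := by
            gcongr
            exact volume_add_smul_diff_le W hCR ht.1 ht.2
        _ = _ := by ring
  -- Almost every point of `W` is interior because the boundary of a convex set is null; there `x -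
  -- tC` is eventually inside `W` and the rate is the dilated density.
  have l3 : Tendsto (fun t => ∫ x in (W : Set (E n)), h x * avoidQuot γ Q W C t x) (𝓝[>] 0)
      (𝓝 (∫ x in (W : Set (E n)), h x * (Real.exp (-volumeDensity γ Q) *
          (γ * ∫ K : Body n, ∫ z, suppFun C z.2 ∂surfMeasure K ∂Q)))) := by
    refine tendsto_integral_filter_of_dominated_convergence (fun _ => M * c) ?_ ?_ ?_ ?_
    · filter_upwards [hsm] with t ht
      exact ((hX.integral_dilationQuot W hC hh ht.1).2.1.mono_set
        (subset_add_smul hC.zero_mem _ t)).aestronglyMeasurable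
    · filter_upwards [hsm] with t ht
      filter_upwards [ae_restrict_mem W.isClosed.measurableSet] with x hx
      exact hbd t ht.1 ht.2 x (subset_add_smul hC.zero_mem _ t hx)
    · exact integrableOn_const W.isCompact.measure_lt_top.ne
    · filter_upwards [ae_mem_interior W] with x hx
      refine ((tendsto_exp_dilatedDensity hn hQ hC).congr' ?_).const_mul (h x)
      filter_upwards [eventually_sub_smul_subset hx C] with t ht
      rw [avoidQuot, inter_eq_self_of_subset_right ht, hitRate_sub_smul hγ]
  have hlim := ((l1.const_mul (1 - Real.exp (-volumeDensity γ Q))).add l2).add l3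
  rw [add_zero, integral_mul_const] at hlim
  refine hlim.congr' ?_
  filter_upwards [hsm] with t ht
  exact (hX.integral_dilationQuot W hC hh ht.1).2.2.symm

end Model

end

section

variable {n : ℕ}

/-! ### Expected surface integrals of the Boolean model -/

/-- The layer around a union is covered by the layers of its members, so the bound is linear in
their number. -/
theorem volume_bodyUnion_add_smul_diff_le {W : Set (E n)} (hW : IsCompact W) {C : Body n} {R : ℝ}
    (hCR : (C : Set (E n)) ⊆ Metric.closedBall 0 R) {t : ℝ} (ht : 0 < t) (ht1 : t ≤ 1)
    (l : List (Body n)) (hl : ∀ K ∈ l, (K : Set (E n)) ⊆ W) :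
    volume.real ((bodyUnion l + t • (C : Set (E n))) \ bodyUnion l) ≤
      l.length * (t * volume.real (W + Metric.closedBall (0 : E n) R)) := by
  have hWR : volume (W + Metric.closedBall (0 : E n) R) ≠ ∞ :=
    (hW.add (isCompact_closedBall _ _)).measure_lt_top.ne
  induction l with
  | nil => simp [bodyUnion_nil]
  | cons K l ih =>
    have hK : (K : Set (E n)) ⊆ W := hl K List.mem_cons_self
    have hsub : (bodyUnion (K :: l) + t • (C : Set (E n))) \ bodyUnion (K :: l) ⊆
        (((K : Set (E n)) + t • (C : Set (E n))) \ K) ∪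
          ((bodyUnion l + t • (C : Set (E n))) \ bodyUnion l) := by
      rw [bodyUnion_cons, union_add]
      rintro x ⟨hx | hx, hn⟩
      · exact Or.inl ⟨hx, fun h => hn (Or.inl h)⟩
      · exact Or.inr ⟨hx, fun h => hn (Or.inr h)⟩
    have hfin : volume ((((K : Set (E n)) + t • (C : Set (E n))) \ K) ∪
        ((bodyUnion l + t • (C : Set (E n))) \ bodyUnion l)) ≠ ∞ := by
      refine (measure_union_lt_top ?_ ?_).ne
      · exact (measure_mono sdiff_subset).trans_lt
          (isCompact_add_smul K.isCompact C t).measure_lt_top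
      · exact (measure_mono sdiff_subset).trans_lt (isCompact_add_smul
          (polyconvex_iff.2 ⟨l, rfl⟩ : Polyconvex _).isCompact C t).measure_lt_top
    refine (measureReal_mono hsub hfin).trans ((measureReal_union_le _ _).trans ?_)
    have h1 : volume.real (((K : Set (E n)) + t • (C : Set (E n))) \ K) ≤
        t * volume.real (W + Metric.closedBall (0 : E n) R) :=
      (volume_add_smul_diff_le K hCR ht ht1).trans
        (by gcongr)
    have h2 := ih fun L hL => hl L (List.mem_cons_of_mem _ hL)
    rw [List.length_cons]
    push_cast
    linarith

theorem norm_dilationQuot_bodyUnion_le {W : Set (E n)} (hW : IsCompact W) {C : Body n}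
    (hC : IsProbe C) {R : ℝ} (hCR : (C : Set (E n)) ⊆ Metric.closedBall 0 R) {h : E n → ℝ}
    (hh : Continuous h) {M : ℝ} (hM0 : 0 ≤ M)
    (hM : ∀ x ∈ W + Metric.closedBall (0 : E n) R, ‖h x‖ ≤ M) {t : ℝ} (ht : 0 < t) (ht1 : t ≤ 1)
    (l : List (Body n)) (hl : ∀ K ∈ l, (K : Set (E n)) ⊆ W) :
    ‖dilationQuot h C (bodyUnion l) t‖ ≤
      l.length * (M * volume.real (W + Metric.closedBall (0 : E n) R)) := by
  have hA : IsCompact (bodyUnion l) := (polyconvex_iff.2 ⟨l, rfl⟩ : Polyconvex _).isCompact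
  have hAC := isCompact_add_smul hA C t
  have hlW : bodyUnion l ⊆ W := fun x hx => by
    obtain ⟨K, hK, hxK⟩ := mem_bodyUnion.1 hx
    exact hl K hK hxK
  have hR : 0 ≤ R := by simpa using hCR hC.zero_mem
  have hsub : bodyUnion l + t • (C : Set (E n)) ⊆ W + Metric.closedBall (0 : E n) R :=
    (add_smul_subset_closedBall hCR ht.le _).trans
      (add_subset_add hlW (Metric.closedBall_subset_closedBall (by nlinarith)))
  rw [dilationQuot, setIntegral_sub_eq_diff hh hA hAC (subset_add_smul hC.zero_mem _ t), norm_mul,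
    norm_inv, Real.norm_of_nonneg ht.le, inv_mul_le_iff₀ ht]
  refine (norm_setIntegral_le_of_norm_le_const (C := M)
    ((measure_mono sdiff_subset).trans_lt hAC.measure_lt_top)
    fun x hx => hM x (hsub hx.1)).trans ?_
  calc M * volume.real ((bodyUnion l + t • (C : Set (E n))) \ bodyUnion l)
      ≤ M * (l.length * (t * volume.real (W + Metric.closedBall (0 : E n) R))) := by
        gcongr
        exact volume_bodyUnion_add_smul_diff_le hW hCR ht ht1 l hl
    _ = _ := by ring

/-- A representation of the surface measure of a subset of `W`, with a bound of its total mass that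
is exponential in `N`. -/
structure SurfRepIn (W : Body n) (N : ℕ) (A : Set (E n)) (μ ν : Measure (E n × Sph n)) : Prop
    extends SurfRep A μ ν where
  left_mem : ∀ᵐ z ∂μ, z.1 ∈ (W : Set (E n))
  right_mem : ∀ᵐ z ∂ν, z.1 ∈ (W : Set (E n))
  mass_le : μ.real univ + ν.real univ ≤
    3 ^ N * volume.real ((W : Set (E n)) + Metric.closedBall (0 : E n) 1)

/-- The integral of `h(x) g(u)` with respect to `μ - ν`. -/
def pairIntegral (h : E n → ℝ) (g : Sph n → ℝ) (μ ν : Measure (E n × Sph n)) : ℝ :=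
  (∫ z, h z.1 * g z.2 ∂μ) - ∫ z, h z.1 * g z.2 ∂ν

theorem SurfRepIn.abs_pairIntegral_le {W : Body n} {N : ℕ} {A : Set (E n)}
    {μ ν : Measure (E n × Sph n)} (hA : SurfRepIn W N A μ ν) {h : E n → ℝ} {M : ℝ} (hM0 : 0 ≤ M)
    (hM : ∀ x ∈ W, ‖h x‖ ≤ M) (g : C(Sph n, ℝ)) :
    |pairIntegral h g μ ν| ≤
      3 ^ N * (M * ‖g‖ * volume.real ((W : Set (E n)) + Metric.closedBall (0 : E n) 1)) := by
  have := hA.fin_left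
  have := hA.fin_right
  have key : ∀ m : Measure (E n × Sph n), IsFiniteMeasure m → (∀ᵐ z ∂m, z.1 ∈ (W : Set (E n))) →
      |∫ z, h z.1 * g z.2 ∂m| ≤ M * ‖g‖ * m.real univ := by
    intro m _ hm
    rw [← Real.norm_eq_abs]
    refine norm_integral_le_of_norm_le_const (hm.mono fun z hz => ?_)
    rw [norm_mul]
    exact mul_le_mul (hM _ hz) (g.norm_coe_le_norm _) (norm_nonneg _) hM0
  calc |pairIntegral h g μ ν| ≤ M * ‖g‖ * μ.real univ + M * ‖g‖ * ν.real univ :=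
        (abs_sub _ _).trans (add_le_add (key μ ‹_› hA.left_mem) (key ν ‹_› hA.right_mem))
    _ = M * ‖g‖ * (μ.real univ + ν.real univ) := by ring
    _ ≤ M * ‖g‖ * (3 ^ N * volume.real ((W : Set (E n)) + Metric.closedBall (0 : E n) 1)) := by
        gcongr
        exact hA.mass_le
    _ = _ := by ring

theorem SurfRepIn.abs_pairIntegral_sub_le {W : Body n} {N : ℕ} {A : Set (E n)}
    {μ ν : Measure (E n × Sph n)} (hA : SurfRepIn W N A μ ν) {h : E n → ℝ} (hh : Continuous h)
    {M : ℝ} (hM0 : 0 ≤ M) (hM : ∀ x ∈ W, ‖h x‖ ≤ M) {g : C(Sph n, ℝ)} {C C' : Body n} {ε : ℝ}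
    (hε : 0 ≤ ε) (hg : ∀ u : Sph n, |g u - (suppFun C u - suppFun C' u)| ≤ ε) :
    |pairIntegral h g μ ν - (pairIntegral h (fun u => suppFun C u) μ ν -
      pairIntegral h (fun u => suppFun C' u) μ ν)| ≤
      ε * (3 ^ N * (M * volume.real ((W : Set (E n)) + Metric.closedBall (0 : E n) 1))) := by
  have := hA.fin_left
  have := hA.fin_right
  have h1 := abs_integral_sub_suppFun_le W.isCompact hA.left_mem hh hM hε hg
  have h2 := abs_integral_sub_suppFun_le W.isCompact hA.right_mem hh hM hε hg
  simp only [pairIntegral]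
  calc _ = |((∫ p, h p.1 * g p.2 ∂μ) - ((∫ z, h z.1 * suppFun C z.2 ∂μ) -
          ∫ z, h z.1 * suppFun C' z.2 ∂μ)) - ((∫ p, h p.1 * g p.2 ∂ν) -
          ((∫ z, h z.1 * suppFun C z.2 ∂ν) - ∫ z, h z.1 * suppFun C' z.2 ∂ν))| := by
        congr 1; ring
    _ ≤ ε * M * μ.real univ + ε * M * ν.real univ := (abs_sub _ _).trans (add_le_add h1 h2)
    _ = ε * M * (μ.real univ + ν.real univ) := by ring
    _ ≤ ε * M * (3 ^ N * volume.real ((W : Set (E n)) + Metric.closedBall (0 : E n) 1)) := by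
        gcongr
        exact hA.mass_le
    _ = _ := by ring

section Model

variable {Ω : Type*} {X : Ω → Set (Body n)} [MeasurableSpace Ω] {P : Measure Ω} {γ : ℝ}
  {Q : Measure (Body n)} [Nonempty (Sph n)]

/-- The measures are chosen separately for each `ω`, with no measurability claimed. Measurability of
their integrals is obtained later, from limits of dilation quotients. -/
theorem IsBooleanModel.exists_surfRepIn (hn : 0 < n) (hX : IsBooleanModel P γ Q X) (W : Body n) :
    ∃ μ ν : Ω → Measure (E n × Sph n), ∀ᵐ ω ∂P,
      SurfRepIn W (X ω ∩ hitSet (W : Set (E n))).ncard (unionSet X ω ∩ W) (μ ω) (ν ω) := by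
  have h : ∀ ω, ∃ m : Measure (E n × Sph n) × Measure (E n × Sph n),
      (X ω ∩ hitSet (W : Set (E n))).Finite →
      SurfRepIn W (X ω ∩ hitSet (W : Set (E n))).ncard (unionSet X ω ∩ W) m.1 m.2 := by
    intro ω
    by_cases hω : (X ω ∩ hitSet (W : Set (E n))).Finite
    · obtain ⟨l, hl, hlW, hA⟩ := unionSet_inter_eq_bodyUnion W hω
      obtain ⟨μ, ν, hr, hμ, hν, hb⟩ := exists_surfRep_bodyUnion hn (W : Set (E n)) _ l hl hlW
      rw [hA]
      refine ⟨(μ, ν), fun _ => ⟨hr, hμ, hν, ?_⟩⟩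
      have := hr.fin_left
      have := hr.fin_right
      have hfin : volume ((W : Set (E n)) + Metric.closedBall (0 : E n) 1) ≠ ∞ :=
        (W.isCompact.add (isCompact_closedBall _ _)).measure_lt_top.ne
      have := ENNReal.toReal_mono (ENNReal.mul_ne_top (by finiteness) hfin) hb
      rw [ENNReal.toReal_add (measure_ne_top _ _) (measure_ne_top _ _), ENNReal.toReal_mul] at this
      simpa [Measure.real] using this
    · exact ⟨(0, 0), fun h => absurd h hω⟩
  choose m hm using h
  refine ⟨fun ω => (m ω).1, fun ω => (m ω).2, ?_⟩
  filter_upwards [hX.ae_finite W.isCompact] with ω hω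
  exact hm ω hω

variable [IsProbabilityMeasure P]

/-- The random dilation quotients converge almost surely and are dominated by a multiple of `3 ^ N`.
The expected limit is then identified by comparison with the limit of the expectations. -/
theorem IsBooleanModel.integral_pairIntegral_suppFun (hn : 0 < n) (hX : IsBooleanModel P γ Q X)
    (W : Body n) {μ ν : Ω → Measure (E n × Sph n)} (hμν : ∀ᵐ ω ∂P,
      SurfRepIn W (X ω ∩ hitSet (W : Set (E n))).ncard (unionSet X ω ∩ W) (μ ω) (ν ω))
    {C : Body n} (hC : IsProbe C) {h : E n → ℝ} (hh : Continuous h) :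
    Integrable (fun ω => pairIntegral h (fun u => suppFun C u) (μ ω) (ν ω)) P ∧
    ∫ ω, pairIntegral h (fun u => suppFun C u) (μ ω) (ν ω) ∂P =
      (1 - Real.exp (-volumeDensity γ Q)) * (∫ z, h z.1 * suppFun C z.2 ∂surfMeasure W) +
        (∫ x in (W : Set (E n)), h x) * (Real.exp (-volumeDensity γ Q) *
          (γ * ∫ K : Body n, ∫ z, suppFun C z.2 ∂surfMeasure K ∂Q)) := by
  obtain ⟨R, hR, hCR⟩ := exists_subset_closedBall C
  have hWR : IsCompact ((W : Set (E n)) + Metric.closedBall (0 : E n) R) :=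
    W.isCompact.add (isCompact_closedBall _ _)
  obtain ⟨M, hM⟩ := hWR.exists_bound_of_continuousOn hh.continuousOn
  have hM0 : 0 ≤ M := by
    obtain ⟨x, hx⟩ := W.nonempty
    exact (norm_nonneg _).trans (hM (x + 0) (add_mem_add hx (by simp [hR.le])))
  set c := M * volume.real ((W : Set (E n)) + Metric.closedBall (0 : E n) R) with hc
  have hc0 : 0 ≤ c := by positivity
  have hsm : ∀ᶠ t : ℝ in 𝓝[>] 0, t ∈ Ioc (0 : ℝ) 1 := Ioc_mem_nhdsGT zero_lt_one
  have hlim : ∀ᵐ ω ∂P, Tendsto (fun t => dilationQuot h C (unionSet X ω ∩ W) t) (𝓝[>] 0)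
      (𝓝 (pairIntegral h (fun u => suppFun C u) (μ ω) (ν ω))) :=
    hμν.mono fun ω hω => hω.tendsto h C hh hC
  have hbd : ∀ᵐ ω ∂P, ∀ t : ℝ, t ∈ Ioc (0 : ℝ) 1 →
      ‖dilationQuot h C (unionSet X ω ∩ W) t‖ ≤
        3 ^ (X ω ∩ hitSet (W : Set (E n))).ncard * c := by
    filter_upwards [hX.ae_finite W.isCompact] with ω hω t ht
    obtain ⟨l, hl, hlW, hA⟩ := unionSet_inter_eq_bodyUnion W hω
    rw [hA]
    refine (norm_dilationQuot_bodyUnion_le W.isCompact hC hCR hh hM0 hM ht.1 ht.2 l hlW).trans ?_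
    gcongr
    calc (l.length : ℝ) ≤ ((X ω ∩ hitSet (W : Set (E n))).ncard : ℝ) := by exact_mod_cast hl
      _ ≤ 3 ^ (X ω ∩ hitSet (W : Set (E n))).ncard := by
        exact_mod_cast (Nat.lt_pow_self (by norm_num)).le
  have hInt : Integrable (fun ω => (3 : ℝ) ^ (X ω ∩ hitSet (W : Set (E n))).ncard * c) P :=
    (hX.integrable_pow_ncard W.isCompact).mul_const c
  have hmeas : ∀ᶠ t : ℝ in 𝓝[>] 0,
      AEStronglyMeasurable (fun ω => dilationQuot h C (unionSet X ω ∩ W) t) P := by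
    filter_upwards [hsm] with t ht
    exact (hX.integral_dilationQuot W hC hh ht.1).1.aestronglyMeasurable
  constructor
  · refine hInt.mono' ?_ ?_
    · obtain ⟨u, hu⟩ := (𝓝[>] (0 : ℝ)).exists_seq_tendsto
      obtain ⟨k, hk⟩ := eventually_atTop.1 (hu.eventually hmeas)
      refine aestronglyMeasurable_of_tendsto_ae atTop
        (fun j => hk (j + k) (by omega)) (hlim.mono fun ω hω => ?_)
      exact hω.comp (hu.comp (tendsto_add_atTop_nat k))
    · filter_upwards [hlim, hbd] with ω h1 h2
      exact le_of_tendsto h1.norm (hsm.mono fun t ht => h2 t ht)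
  · have := tendsto_integral_filter_of_dominated_convergence _ hmeas
      (hsm.mono fun t ht => hbd.mono fun ω h => h t ht) hInt hlim
    exact tendsto_nhds_unique this (hX.tendsto_integral_dilationQuot hn W hC hh)

/-- All terms are linear in the function on the sphere, and each error is at most `1 / (k + 1)`
times an integrable mass, so the formula passes to the uniform limit `g`. -/
theorem IsBooleanModel.integral_pairIntegral (hn : 0 < n) (hX : IsBooleanModel P γ Q X)
    (W : Body n) {μ ν : Ω → Measure (E n × Sph n)} (hμν : ∀ᵐ ω ∂P,
      SurfRepIn W (X ω ∩ hitSet (W : Set (E n))).ncard (unionSet X ω ∩ W) (μ ω) (ν ω))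
    {h : E n → ℝ} (hh : Continuous h) (g : C(Sph n, ℝ)) :
    Integrable (fun ω => pairIntegral h g (μ ω) (ν ω)) P ∧
    ∫ ω, pairIntegral h g (μ ω) (ν ω) ∂P =
      (1 - Real.exp (-volumeDensity γ Q)) * (∫ z, h z.1 * g z.2 ∂surfMeasure W) +
        (∫ x in (W : Set (E n)), h x) * (Real.exp (-volumeDensity γ Q) *
          (γ * ∫ K : Body n, ∫ z, g z.2 ∂surfMeasure K ∂Q)) := by
  have hQ := hX.grain_integrable
  choose C C' hC hC' hg using fun k : ℕ =>
    exists_suppFun_sub_suppFun_near g (ε := 1 / ((k : ℝ) + 1)) (by positivity)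
  obtain ⟨M, hM⟩ := W.isCompact.exists_bound_of_continuousOn hh.continuousOn
  have hM0 : 0 ≤ M := by
    obtain ⟨x, hx⟩ := W.nonempty
    exact (norm_nonneg _).trans (hM x hx)
  have hε := tendsto_one_div_add_atTop_nhds_zero_nat (𝕜 := ℝ)
  have hεm : ∀ a : ℝ, Tendsto (fun k : ℕ => 1 / ((k : ℝ) + 1) * a) atTop (𝓝 0) := fun a => by
    simpa using hε.mul_const a
  have i1 := fun k => hX.integral_pairIntegral_suppFun hn W hμν (hC k) hh
  have i2 := fun k => hX.integral_pairIntegral_suppFun hn W hμν (hC' k) hh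
  have i3 : ∀ k, Integrable (fun ω => pairIntegral h (fun u => suppFun (C k) u) (μ ω) (ν ω) -
      pairIntegral h (fun u => suppFun (C' k) u) (μ ω) (ν ω)) P := fun k => (i1 k).1.sub (i2 k).1
  have hnear : ∀ᵐ ω ∂P, ∀ k : ℕ, |pairIntegral h g (μ ω) (ν ω) -
      (pairIntegral h (fun u => suppFun (C k) u) (μ ω) (ν ω) -
        pairIntegral h (fun u => suppFun (C' k) u) (μ ω) (ν ω))| ≤
      1 / ((k : ℝ) + 1) * (3 ^ (X ω ∩ hitSet (W : Set (E n))).ncard *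
        (M * volume.real ((W : Set (E n)) + Metric.closedBall (0 : E n) 1))) := by
    filter_upwards [hμν] with ω hω k
    exact hω.abs_pairIntegral_sub_le hh hM0 hM (by positivity) (hg k)
  have hInt : Integrable (fun ω => pairIntegral h g (μ ω) (ν ω)) P := by
    refine ((hX.integrable_pow_ncard W.isCompact).mul_const (M * ‖g‖ *
      volume.real ((W : Set (E n)) + Metric.closedBall (0 : E n) 1))).mono' ?_ ?_
    · refine aestronglyMeasurable_of_tendsto_ae atTop
        (fun k => (i3 k).aestronglyMeasurable) ?_
      filter_upwards [hnear] with ω hω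
      rw [tendsto_iff_dist_tendsto_zero]
      refine squeeze_zero (fun _ => dist_nonneg) (fun k => ?_)
        (hεm (3 ^ (X ω ∩ hitSet (W : Set (E n))).ncard *
          (M * volume.real ((W : Set (E n)) + Metric.closedBall (0 : E n) 1))))
      rw [dist_comm, Real.dist_eq]
      exact hω k
    · filter_upwards [hμν] with ω hω
      exact hω.abs_pairIntegral_le hM0 hM g
  refine ⟨hInt, ?_⟩
  have t1 : Tendsto (fun k => (∫ ω, pairIntegral h (fun u => suppFun (C k) u) (μ ω) (ν ω) ∂P) -
      ∫ ω, pairIntegral h (fun u => suppFun (C' k) u) (μ ω) (ν ω) ∂P) atTop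
      (𝓝 (∫ ω, pairIntegral h g (μ ω) (ν ω) ∂P)) := by
    rw [tendsto_iff_dist_tendsto_zero]
    refine squeeze_zero (fun _ => dist_nonneg) (fun k => ?_) (hεm (∫ ω,
      3 ^ (X ω ∩ hitSet (W : Set (E n))).ncard *
        (M * volume.real ((W : Set (E n)) + Metric.closedBall (0 : E n) 1)) ∂P))
    rw [dist_comm, Real.dist_eq, ← integral_sub (i1 k).1 (i2 k).1,
      ← integral_sub hInt (i3 k), ← integral_const_mul, ← Real.norm_eq_abs]
    exact norm_integral_le_of_norm_le
      (((hX.integrable_pow_ncard W.isCompact).mul_const _).const_mul _)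
      (hnear.mono fun ω hω => hω k)
  have t2 : Tendsto (fun k => (∫ z, h z.1 * suppFun (C k) z.2 ∂surfMeasure W) -
      ∫ z, h z.1 * suppFun (C' k) z.2 ∂surfMeasure W) atTop
      (𝓝 (∫ z, h z.1 * g z.2 ∂surfMeasure W)) := by
    rw [tendsto_iff_dist_tendsto_zero]
    refine squeeze_zero (fun _ => dist_nonneg) (fun k => ?_) (hεm (M * (surfMeasure W).real univ))
    rw [dist_comm, Real.dist_eq, ← mul_assoc]
    exact abs_integral_sub_suppFun_le W.isCompact (ae_surfMeasure_mem W) hh hM (by positivity) (hg k)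
  have j1 := fun k => (tendsto_integral_dilationQuot_one hn hQ (hC k)).1
  have j2 := fun k => (tendsto_integral_dilationQuot_one hn hQ (hC' k)).1
  have j3 : ∀ k, Integrable (fun K : Body n => (∫ z, suppFun (C k) z.2 ∂surfMeasure K) -
      ∫ z, suppFun (C' k) z.2 ∂surfMeasure K) Q := fun k => (j1 k).sub (j2 k)
  have t3 : Tendsto (fun k => (∫ K : Body n, ∫ z, suppFun (C k) z.2 ∂surfMeasure K ∂Q) -
      ∫ K : Body n, ∫ z, suppFun (C' k) z.2 ∂surfMeasure K ∂Q) atTop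
      (𝓝 (∫ K : Body n, ∫ z, g z.2 ∂surfMeasure K ∂Q)) := by
    rw [tendsto_iff_dist_tendsto_zero]
    have hv := integrable_volume_add hQ (isCompact_closedBall (0 : E n) 1)
    refine squeeze_zero (fun _ => dist_nonneg) (fun k => ?_) (hεm (∫ K : Body n,
      volume.real ((K : Set (E n)) + Metric.closedBall (0 : E n) 1) ∂Q))
    rw [dist_comm, Real.dist_eq, ← integral_sub (j1 k) (j2 k),
      ← integral_sub (integrable_integral_surfMeasure hn hQ g) (j3 k),
      ← integral_const_mul, ← Real.norm_eq_abs]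
    refine norm_integral_le_of_norm_le (hv.const_mul _) (Eventually.of_forall fun K => ?_)
    have := abs_integral_sub_suppFun_le K.isCompact (ae_surfMeasure_mem K) (f := 1)
      continuous_one (M := 1) (by simp) (by positivity) (hg k)
    simp only [Pi.one_apply, one_mul, mul_one] at this
    refine this.trans ?_
    gcongr
    exact surfMeasure_real_univ_le K
  refine tendsto_nhds_unique t1 ?_
  have hlim := (t2.const_mul (1 - Real.exp (-volumeDensity γ Q))).add
    (((t3.const_mul γ).const_mul (Real.exp (-volumeDensity γ Q))).const_mul
      (∫ x in (W : Set (E n)), h x))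
  refine hlim.congr fun k => ?_
  rw [(i1 k).2, (i2 k).2]
  ring

end Model

end

section

variable {n : ℕ}

/-! ### Expected Minkowski tensors -/

/-- The monomial that is a coordinate of the tensor power `x ^ r`. -/
def powCoord {r : ℕ} (j : Fin r → Fin n) (x : E n) : ℝ :=
  ∏ k, inner ℝ x (EuclideanSpace.basisFun (Fin n) ℝ (j k))

theorem continuous_powCoord {r : ℕ} (j : Fin r → Fin n) : Continuous (powCoord j) := by
  unfold powCoord
  fun_prop

/-- The restriction of a monomial to the sphere. -/
def sphCoord {s : ℕ} (j : Fin s → Fin n) : C(Sph n, ℝ) :=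
  ⟨fun u => powCoord j u, (continuous_powCoord j).comp continuous_subtype_val⟩

theorem sphCoord_apply {s : ℕ} (j : Fin s → Fin n) (u : Sph n) :
    sphCoord j u = powCoord j u := rfl

theorem tensorCoord_pairTensor (r s : ℕ) (i : Fin (r + s) → Fin n) (z : E n × Sph n) :
    tensorCoord i (pairTensor r s z) = ((r + s).factorial : ℝ)⁻¹ *
      ∑ σ : Equiv.Perm (Fin (r + s)), powCoord (fun k => i (σ (Fin.castAdd s k))) z.1 *
        sphCoord (fun k => i (σ (Fin.natAdd r k))) z.2 := by
  rw [pairTensor, tensorCoord_symMul]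
  simp only [tensorCoord_tensorPow]
  rfl

/-- For `r = 0` the summands are one product with permuted factors, so symmetrization changes
nothing. -/
theorem tensorCoord_pairTensor_zero (s : ℕ) (i : Fin (0 + s) → Fin n) (z : E n × Sph n) :
    tensorCoord i (pairTensor 0 s z) = sphCoord i z.2 := by
  rw [tensorCoord_pairTensor]
  have h : ∀ σ : Equiv.Perm (Fin (0 + s)), powCoord (fun k => i (σ (Fin.castAdd s k))) z.1 *
      sphCoord (fun k => i (σ (Fin.natAdd 0 k))) z.2 = sphCoord i z.2 := by
    intro σ
    -- An empty product does not depend on its point; with the normal as base point the two products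
    -- join into one over `Fin (0 + s)`.
    have h0 : powCoord (fun k => i (σ (Fin.castAdd s k))) z.1 =
        powCoord (fun k => i (σ (Fin.castAdd s k))) (z.2 : E n) := by
      simp [powCoord]
    rw [h0, sphCoord_apply, sphCoord_apply]
    simp only [powCoord]
    rw [← Fin.prod_univ_add (fun k => inner ℝ (z.2 : E n) (EuclideanSpace.basisFun (Fin n) ℝ (i (σ k))))]
    exact Equiv.prod_comp σ fun k => inner ℝ (z.2 : E n) (EuclideanSpace.basisFun (Fin n) ℝ (i k))
  simp only [h, Finset.sum_const, Finset.card_univ, Fintype.card_perm, Fintype.card_fin,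
    nsmul_eq_mul]
  rw [inv_mul_cancel_left₀ (by positivity)]

theorem tensorCoord_integral_pairTensor {m : Measure (E n × Sph n)} [IsFiniteMeasure m]
    {B : Set (E n)} (hB : IsCompact B) (hm : ∀ᵐ z ∂m, z.1 ∈ B) (r s : ℕ)
    (i : Fin (r + s) → Fin n) :
    tensorCoord i (∫ z, pairTensor r s z ∂m) = ((r + s).factorial : ℝ)⁻¹ *
      ∑ σ : Equiv.Perm (Fin (r + s)), ∫ z, powCoord (fun k => i (σ (Fin.castAdd s k))) z.1 *
        sphCoord (fun k => i (σ (Fin.natAdd r k))) z.2 ∂m := by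
  rw [tensorCoord_integral (integrable_of_continuous hB hm (continuous_pairTensor r s))]
  simp only [tensorCoord_pairTensor]
  rw [integral_const_mul, integral_finsetSum]
  intro σ _
  refine integrable_of_continuous hB hm (Continuous.mul ?_ ?_)
  · exact (continuous_powCoord _).comp continuous_fst
  · exact (map_continuous _).comp continuous_snd

theorem surfConst_eq (r s : ℕ) : surfConst r s = 1 / (r.factorial : ℝ) * surfConst 0 s := by
  simp only [surfConst, Nat.factorial_zero, Nat.cast_one, one_mul]
  field_simp

theorem tensorCoord_volumeTensor {r : ℕ} (j : Fin r → Fin n) (W : Body n) :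
    tensorCoord j (volumeTensor r W) =
      1 / (r.factorial : ℝ) * ∫ x in (W : Set (E n)), powCoord j x := by
  rw [volumeTensor, map_smul, smul_eq_mul, tensorCoord_integral
    ((continuous_tensorPow r).continuousOn.integrableOn_compact W.isCompact)]
  simp only [tensorCoord_tensorPow]
  rfl

section Model

variable {Ω : Type*} {X : Ω → Set (Body n)} [MeasurableSpace Ω] {P : Measure Ω} {γ : ℝ}
  {Q : Measure (Body n)} [IsProbabilityMeasure P]

theorem IsBooleanModel.integral_volumeTensor (hX : IsBooleanModel P γ Q X) (W : Body n) (r : ℕ) :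
    Integrable (fun ω => additiveExtension (volumeTensor r) (unionSet X ω ∩ W)) P ∧
    ∫ ω, additiveExtension (volumeTensor r) (unionSet X ω ∩ W) ∂P =
      (1 - Real.exp (-volumeDensity γ Q)) • volumeTensor r W := by
  have hcoord : ∀ j : Fin r → Fin n,
      (fun ω => tensorCoord j (additiveExtension (volumeTensor r) (unionSet X ω ∩ W))) =ᵐ[P]
        fun ω => 1 / (r.factorial : ℝ) * ∫ x in unionSet X ω ∩ W, powCoord j x := by
    intro j
    filter_upwards [hX.ae_polyconvex W] with ω hω
    rw [additiveExtension_volumeTensor r hω, map_smul, smul_eq_mul, tensorCoord_integral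
      ((continuous_tensorPow r).continuousOn.integrableOn_compact hω.isCompact)]
    simp only [tensorCoord_tensorPow]
    rfl
  have key := fun j : Fin r → Fin n => hX.integral_setIntegral W (continuous_powCoord j)
  have hInt : Integrable (fun ω => additiveExtension (volumeTensor r) (unionSet X ω ∩ W)) P :=
    integrable_tensor fun j => ((key j).1.const_mul _).congr (hcoord j).symm
  refine ⟨hInt, tensor_ext fun j => ?_⟩
  rw [tensorCoord_integral hInt, integral_congr_ae (hcoord j), integral_const_mul, (key j).2,
    map_smul, smul_eq_mul, tensorCoord_volumeTensor]
  ring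

end Model

/-! ### Surface tensors -/

section Surface

variable [Nonempty (Sph n)] {Q : Measure (Body n)} {γ : ℝ}

theorem tensorCoord_minkowskiTensor_zero (hn : 0 < n) {s : ℕ} (j : Fin (0 + s) → Fin n)
    (K : Body n) : tensorCoord j (minkowskiTensor ⟨n - 1, Nat.sub_lt hn one_pos⟩ 0 s K) =
      surfConst 0 s * ∫ z, sphCoord j z.2 ∂surfMeasure K := by
  rw [minkowskiTensor_top hn, map_smul, smul_eq_mul, tensorCoord_integral
    (integrable_of_continuous K.isCompact (ae_surfMeasure_mem K) (continuous_pairTensor 0 s))]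
  simp only [tensorCoord_pairTensor_zero]

theorem integrable_minkowskiTensor (hn : 0 < n)
    (hQ : ∫⁻ K, volume ((K : Set (E n)) + Metric.closedBall (0 : E n) 1) ∂Q < ∞) (s : ℕ) :
    Integrable (minkowskiTensor ⟨n - 1, Nat.sub_lt hn one_pos⟩ 0 s) Q := by
  refine integrable_tensor fun j => ?_
  simp only [tensorCoord_minkowskiTensor_zero hn]
  exact (integrable_integral_surfMeasure hn hQ _).const_mul _

theorem tensorCoord_tensorDensity (hn : 0 < n)
    (hQ : ∫⁻ K, volume ((K : Set (E n)) + Metric.closedBall (0 : E n) 1) ∂Q < ∞) {s : ℕ}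
    (j : Fin (0 + s) → Fin n) :
    tensorCoord j (tensorDensity γ Q ⟨n - 1, Nat.sub_lt hn one_pos⟩ s) =
      surfConst 0 s * (γ * ∫ K : Body n, ∫ z, sphCoord j z.2 ∂surfMeasure K ∂Q) := by
  rw [tensorDensity, map_smul, smul_eq_mul,
    tensorCoord_integral (integrable_minkowskiTensor hn hQ s)]
  simp only [tensorCoord_minkowskiTensor_zero hn]
  rw [integral_const_mul]
  ring

variable {Ω : Type*} {X : Ω → Set (Body n)} [MeasurableSpace Ω] {P : Measure Ω}
  [IsProbabilityMeasure P]

/-- Each coordinate is an average over permutations of integrals of a monomial in `x` times a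
monomial in `u`. In the second term of the expectation these integrals factor, which is precisely
the symmetric product of the volume tensor and the density. -/
theorem IsBooleanModel.integral_minkowskiTensor (hn : 0 < n) (hX : IsBooleanModel P γ Q X)
    (W : Body n) (r s : ℕ) :
    Integrable (fun ω => additiveExtension (minkowskiTensor ⟨n - 1, Nat.sub_lt hn one_pos⟩ r s)
      (unionSet X ω ∩ W)) P ∧
    ∫ ω, additiveExtension (minkowskiTensor ⟨n - 1, Nat.sub_lt hn one_pos⟩ r s)
        (unionSet X ω ∩ W) ∂P =
      (1 - Real.exp (-volumeDensity γ Q)) •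
          minkowskiTensor ⟨n - 1, Nat.sub_lt hn one_pos⟩ r s W +
        Real.exp (-volumeDensity γ Q) •
          symMul (show r + (0 + s) = r + s by rw [Nat.zero_add]) (volumeTensor r W)
            (tensorDensity γ Q ⟨n - 1, Nat.sub_lt hn one_pos⟩ s) := by
  obtain ⟨μ, ν, hμν⟩ := hX.exists_surfRepIn hn W
  have key := fun (i : Fin (r + s) → Fin n) (σ : Equiv.Perm (Fin (r + s))) =>
    hX.integral_pairIntegral hn W hμν (continuous_powCoord fun k => i (σ (Fin.castAdd s k)))
      (sphCoord fun k => i (σ (Fin.natAdd r k)))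
  have hcoord : ∀ i : Fin (r + s) → Fin n,
      (fun ω => tensorCoord i (additiveExtension
        (minkowskiTensor ⟨n - 1, Nat.sub_lt hn one_pos⟩ r s) (unionSet X ω ∩ W))) =ᵐ[P]
      fun ω => surfConst r s * (((r + s).factorial : ℝ)⁻¹ * ∑ σ : Equiv.Perm (Fin (r + s)),
        pairIntegral (powCoord fun k => i (σ (Fin.castAdd s k)))
          (sphCoord fun k => i (σ (Fin.natAdd r k))) (μ ω) (ν ω)) := by
    intro i
    filter_upwards [hX.ae_polyconvex W, hμν] with ω hω hr
    have := hr.fin_left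
    have := hr.fin_right
    rw [additiveExtension_minkowskiTensor hn r s hω hr.toSurfRep, map_smul, smul_eq_mul, map_sub,
      tensorCoord_integral_pairTensor W.isCompact hr.left_mem,
      tensorCoord_integral_pairTensor W.isCompact hr.right_mem, ← mul_sub,
      ← Finset.sum_sub_distrib]
    rfl
  have hsum : ∀ i : Fin (r + s) → Fin n, Integrable (fun ω => ∑ σ : Equiv.Perm (Fin (r + s)),
      pairIntegral (powCoord fun k => i (σ (Fin.castAdd s k)))
        (sphCoord fun k => i (σ (Fin.natAdd r k))) (μ ω) (ν ω)) P := fun i =>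
    integrable_finsetSum _ fun σ _ => (key i σ).1
  have hInt : Integrable (fun ω => additiveExtension
      (minkowskiTensor ⟨n - 1, Nat.sub_lt hn one_pos⟩ r s) (unionSet X ω ∩ W)) P :=
    integrable_tensor fun i => (((hsum i).const_mul _).const_mul _).congr (hcoord i).symm
  refine ⟨hInt, tensor_ext fun i => ?_⟩
  -- The density has rank `0 + s`, so its indices are transported to rank `s` before the sums can be
  -- compared.
  have hsph : ∀ (σ : Equiv.Perm (Fin (r + s))) (h : r + (0 + s) = r + s),
      (sphCoord fun k => i (σ (Fin.cast h (Fin.natAdd r k)))) =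
        sphCoord fun k => i (σ (Fin.natAdd r k)) := by
    intro σ h
    ext u
    rw [sphCoord_apply, sphCoord_apply]
    refine Fintype.prod_equiv (finCongr (Nat.zero_add s)) _ _ fun k => ?_
    congr 4
  rw [tensorCoord_integral hInt, integral_congr_ae (hcoord i), integral_const_mul,
    integral_const_mul, integral_finsetSum _ fun σ _ => (key i σ).1, map_add, map_smul, map_smul,
    smul_eq_mul, smul_eq_mul, minkowskiTensor_top hn, map_smul, smul_eq_mul,
    tensorCoord_integral_pairTensor W.isCompact (ae_surfMeasure_mem W), tensorCoord_symMul]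
  simp only [(key i _).2, tensorCoord_volumeTensor, tensorCoord_tensorDensity hn
    hX.grain_integrable, hsph, Finset.sum_add_distrib, ← Finset.mul_sum]
  rw [surfConst_eq r s]
  have hcast : ∀ (σ : Equiv.Perm (Fin (r + s))) (h : r + (0 + s) = r + s),
      (fun k : Fin r => i (σ (Fin.cast h (Fin.castAdd (0 + s) k)))) =
        fun k => i (σ (Fin.castAdd s k)) := fun _ _ => rfl
  simp only [hcast, Finset.mul_sum, mul_add]
  congr 1
  · refine Finset.sum_congr rfl fun σ _ => ?_
    ring
  · refine Finset.sum_congr rfl fun σ _ => ?_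
    ring

end Surface

end

end

end MinkowskiBoolean

open MinkowskiBoolean in
theorem mainTheorem3 {n : ℕ} (hn : 0 < n) {Ω : Type*} [MeasurableSpace Ω]
    (P : Measure Ω) [IsProbabilityMeasure P]
    (γ : ℝ) (Q : Measure (Body n)) (X : Ω → Set (Body n))
    (hX : IsBooleanModel P γ Q X) (W : Body n) (r s : ℕ) :
    Integrable (fun K : Body n => volume.real (K : Set (E n))) Q ∧
    Integrable (fun K : Body n => minkowskiTensor ⟨n - 1, Nat.sub_lt hn one_pos⟩ 0 s K) Q ∧
    Integrable (fun ω => additiveExtension (minkowskiTensor ⟨n - 1, Nat.sub_lt hn one_pos⟩ r s)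
      (unionSet X ω ∩ (W : Set (E n)))) P ∧
    Integrable (fun ω => additiveExtension (volumeTensor r)
      (unionSet X ω ∩ (W : Set (E n)))) P ∧
    ∫ ω, additiveExtension (minkowskiTensor ⟨n - 1, Nat.sub_lt hn one_pos⟩ r s)
        (unionSet X ω ∩ (W : Set (E n))) ∂P =
      (1 - Real.exp (-volumeDensity γ Q)) •
          minkowskiTensor ⟨n - 1, Nat.sub_lt hn one_pos⟩ r s W +
        Real.exp (-volumeDensity γ Q) •
          symMul (show r + (0 + s) = r + s by rw [Nat.zero_add]) (volumeTensor r W)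
            (tensorDensity γ Q ⟨n - 1, Nat.sub_lt hn one_pos⟩ s) ∧
    ∫ ω, additiveExtension (volumeTensor r) (unionSet X ω ∩ (W : Set (E n))) ∂P =
      (1 - Real.exp (-volumeDensity γ Q)) • volumeTensor r W := by
  have := sph_nonempty hn
  obtain ⟨h1, e1⟩ := hX.integral_minkowskiTensor hn W r s
  obtain ⟨h2, e2⟩ := hX.integral_volumeTensor W r
  exact ⟨integrable_volume_body hX.grain_integrable,
    integrable_minkowskiTensor hn hX.grain_integrable s, h1, h2, e1, e2⟩
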